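/- Let $k$ be a field. A dg algebra (dga) is a unital associative $\mathbf Z$-graded $k$-algebra $F=\bigoplus_i F^i$ with a differential $d$ of degree $+1$, $d^2=0$, $d(ab)=da\,b+(-1)^{|a|}a\,db$. For a dga $F$ and a dg $F$-bimodule $M$, let $C^\bullet(F,M)=\prod_{n\ge 0}\underline{\mathrm{Hom}}(F[1]^{\otimes n},M)$ (product and inner Hom of $\mathbf Z$-graded spaces, $F[1]^i=F^{i+1}$) be the cohomological Hochschild complex: a cochain of degree $m$ is a family $c=(c_n)_{n\ge0}$ of multilinear maps $c_n:F^n\to M$ with $|c_n(a_1,\dots,a_n)|=\sum_i(|a_i|-1)+m$ for homogeneous $a_i$, and $$(\delta c)_n(a_1,\dots,a_n)=(-1)^{m|a_1|}a_1c_{n-1}(a_2,\dots,a_n)+\sum_{i=1}^{n-1}(-1)^{i+|a_1|+\dots+|a_i|}c_{n-1}(\dots,a_ia_{i+1},\dots)+(-1)^{n+|a_1|+\dots+|a_{n-1}|}c_{n-1}(a_1,\dots,a_{n-1})a_n$$ $$\qquad+(-1)^m d\,c_n(a_1,\dots,a_n)+\sum_{i=1}^n(-1)^{i-1+|a_1|+\dots+|a_{i-1}|}c_n(\dots,da_i,\dots)$$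 (the first line being absent for $n=0$). **Lemma.** Let $\phi:\tilde F\to F$ be a homomorphism of dg algebras that is a quasi-isomorphism (it induces an isomorphism of cohomology groups), and regard $F$ as a dg bimodule over $\tilde F$ via $\phi$. (1) The natural chain maps, given by composition with $\phi$ in the values and in the arguments respectively, $$C^\bullet(\tilde F,\tilde F)\longrightarrow C^\bullet(\tilde F,F)\longleftarrow C^\bullet(F,F)$$ are both quasi-isomorphisms; in particular $C^\bullet(\tilde F,\tilde F)$ and $C^\bullet(F,F)$ are quasi-isomorphic. (2) Suppose that $k$ has characteristic $0$ and that $\tilde F$ and $F$ are supercommutative, $ab=(-1)^{|a||b|}ba$. Let $e_n(j)$ be the Eulerian idempotents, $\sum_j x^je_n(j)=\frac1{n!}\sum_{\sigma\in S_n}(x-d_\sigma)(x-d_\sigma+1)\cdots(x-d_\sigma+n-1)\,\mathrm{sgn}(\sigma)\,\sigma$, where $d_\sigma$ is the number of descents of $\sigma$ and $\mathrm{sgn}(\sigma)\sigma$ acts on $F[1]^{\otimes n}$ by moving the $i$-th factor to the place $\sigma(i)$ with the Koszul sign of $F[1]^{\otimes n}$ (this is $\mathrm{sgn}(\sigma)$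 if $F$ is concentrated in degree $0$). For each of the three complexes $C^\bullet$ in (1) and each $j\ge0$, let $C^\bullet_{(j)}\subset C^\bullet$ consist of the cochains $c$ with $c_n\circ e_n(j)=c_n$ for all $n$. Then these are subcomplexes and $C^\bullet=\prod_jC^\bullet_{(j)}$ (the Hodge decomposition; $C^\bullet_{(1)}$ is the Harrison complex): every cochain $c$ of degree $m$ is, for a unique sequence $c_{(j)}\in C^m_{(j)}$, given by $c_n=\sum_{j\le n}(c_{(j)})_n$ for all $n$. The two chain maps in (1) preserve this decomposition, and for every $j$ they restrict to quasi-isomorphisms $$C^\bullet_{(j)}(\tilde F,\tilde F)\longrightarrow C^\bullet_{(j)}(\tilde F,F)\longleftarrow C^\bullet_{(j)}(F,F).$$ -/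

import Mathlib

open CategoryTheory

universe u v

noncomputable section

namespace DGHochschild

/-- The sign `(-1) ^ m` for an integer `m`, as an integer. -/
def sg (m : ℤ) : ℤ := (m.negOnePow : ℤ)

@[simp] lemma sg_zero : sg 0 = 1 := by simp [sg]
@[simp] lemma sg_one : sg 1 = -1 := by simp [sg]
lemma sg_add (a b : ℤ) : sg (a + b) = sg a * sg b := by simp [sg, Int.negOnePow_add]
lemma sg_succ (a : ℤ) : sg (a + 1) = -sg a := by simp [sg_add]
lemma sg_mul_self (a : ℤ) : sg a * sg a = 1 := by
  rw [← sg_add, ← two_mul]; simp [sg, Int.negOnePow_two_mul]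
lemma sg_sub (a b : ℤ) : sg (a - b) = sg a * sg b := by simp [sg, Int.negOnePow_sub]

section SignMap

variable {K : Type u} [Field K] {V : Type v} [AddCommGroup V] [Module K V]
  (𝒱 : ℤ → Submodule K V) [DirectSum.Decomposition 𝒱]

/-- The linear map of a graded vector space that multiplies an element of degree `i` by
`(-1) ^ (m * i)`. -/
def signMap (m : ℤ) : V →ₗ[K] V :=
  (DirectSum.toModule K ℤ V fun i => sg (m * i) • (𝒱 i).subtype) ∘ₗ
    (DirectSum.decomposeLinearEquiv 𝒱).toLinearMap

lemma signMap_apply (m : ℤ) {i : ℤ} {a : V} (ha : a ∈ 𝒱 i) :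
    signMap 𝒱 m a = sg (m * i) • a := by
  have := DirectSum.decomposeLinearEquiv_apply_coe 𝒱 i ⟨a, ha⟩
  simp only at this
  simp [signMap, this, DirectSum.toModule_lof]

lemma signMap_mem (m : ℤ) {i : ℤ} {a : V} (ha : a ∈ 𝒱 i) : signMap 𝒱 m a ∈ 𝒱 i := by
  rw [signMap_apply 𝒱 m ha]
  exact zsmul_mem ha _

/-- Two linear maps that agree on homogeneous elements are equal. -/
lemma ext_of_homogeneous {W : Type*} [AddCommGroup W] [Module K W] {f g : V →ₗ[K] W}
    (h : ∀ i, ∀ a ∈ 𝒱 i, f a = g a) (a : V) : f a = g a := by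
  induction a using DirectSum.Decomposition.inductionOn 𝒱 with
  | zero => simp
  | homogeneous a => exact h _ _ a.2
  | add a b ha hb => simp [ha, hb]

lemma signMap_add (m n : ℤ) (a : V) : signMap 𝒱 (m + n) a = signMap 𝒱 m (signMap 𝒱 n a) := by
  refine ext_of_homogeneous 𝒱 (f := signMap 𝒱 (m + n))
    (g := signMap 𝒱 m ∘ₗ signMap 𝒱 n) (fun i a ha => ?_) a
  simp [signMap_apply 𝒱 _ ha, add_mul, sg_add, mul_smul, smul_comm (sg (m * i))]

lemma signMap_one_one (a : V) : signMap 𝒱 1 (signMap 𝒱 1 a) = a := by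
  refine ext_of_homogeneous 𝒱 (f := signMap 𝒱 1 ∘ₗ signMap 𝒱 1)
    (g := LinearMap.id) (fun i a ha => ?_) a
  simp [signMap_apply 𝒱 _ ha, ← mul_smul, sg_mul_self]

lemma signMap_comp_of_degree_one {d : V →ₗ[K] V} (hd : ∀ {i a}, a ∈ 𝒱 i → d a ∈ 𝒱 (i + 1))
    (m : ℤ) (a : V) : signMap 𝒱 m (d a) = sg m • d (signMap 𝒱 m a) := by
  refine ext_of_homogeneous 𝒱 (f := signMap 𝒱 m ∘ₗ d)
    (g := sg m • d ∘ₗ signMap 𝒱 m) (fun i a ha => ?_) a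
  simp [signMap_apply 𝒱 _ ha, signMap_apply 𝒱 _ (hd ha), mul_add, sg_add, mul_smul,
    smul_comm (sg (m * i))]

end SignMap

/-- A (unital, associative) differential `ℤ`-graded algebra over the field `K`, with differential
of degree `+1`. -/
structure DGAlgebra (K : Type u) [Field K] where
  carrier : Type v
  [ring : Ring carrier]
  [algebra : Algebra K carrier]
  /-- the homogeneous components -/
  gr : ℤ → Submodule K carrier
  [graded : GradedAlgebra gr]
  /-- the differential -/
  d : carrier →ₗ[K] carrier
  d_mem : ∀ {i a}, a ∈ gr i → d a ∈ gr (i + 1)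
  d_d : ∀ a, d (d a) = 0
  leibniz : ∀ {i a} (b : carrier), a ∈ gr i → d (a * b) = d a * b + sg i • (a * d b)

namespace DGAlgebra

variable {K : Type u} [Field K]

instance : CoeSort (DGAlgebra.{u, v} K) (Type v) := ⟨DGAlgebra.carrier⟩

attribute [instance] DGAlgebra.ring DGAlgebra.algebra DGAlgebra.graded

/-- The underlying cochain complex of `K`-vector spaces. -/
def toComplex (F : DGAlgebra.{u, v} K) : CochainComplex (ModuleCat.{v} K) ℤ :=
  CochainComplex.of (fun i => ModuleCat.of K (F.gr i))
    (fun i => ModuleCat.ofHom (F.d.restrict (p := F.gr i) (q := F.gr (i + 1)) fun _ h => F.d_mem h))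
    (fun i => by ext x; exact F.d_d x)

/-- Graded commutativity: `a b = (-1)^{|a| |b|} b a` for homogeneous `a`, `b`. -/
def IsSupercommutative (F : DGAlgebra.{u, v} K) : Prop :=
  ∀ ⦃i j : ℤ⦄ ⦃a b : F⦄, a ∈ F.gr i → b ∈ F.gr j → a * b = sg (i * j) • (b * a)

/-- A homomorphism of differential graded algebras. -/
structure Hom (F G : DGAlgebra.{u, v} K) where
  toAlgHom : F →ₐ[K] G
  map_mem : ∀ {i a}, a ∈ F.gr i → toAlgHom a ∈ G.gr i
  map_d : ∀ a, toAlgHom (F.d a) = G.d (toAlgHom a)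

/-- The morphism of cochain complexes underlying a homomorphism of differential graded algebras. -/
def Hom.toComplexHom {F G : DGAlgebra.{u, v} K} (φ : Hom F G) : F.toComplex ⟶ G.toComplex :=
  CochainComplex.ofHom
    (fun i => ModuleCat.ofHom
      (φ.toAlgHom.toLinearMap.restrict (p := F.gr i) (q := G.gr i) fun _ h => φ.map_mem h))
    (fun i => by
      simp only [toComplex, CochainComplex.of_d]
      refine ModuleCat.hom_ext (LinearMap.ext fun x => Subtype.ext ?_)
      exact (φ.map_d x).symm)

/-- A homomorphism of differential graded algebras is a quasi-isomorphism if it induces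
isomorphisms of all cohomology groups. -/
def Hom.IsQuasiIso {F G : DGAlgebra.{u, v} K} (φ : Hom F G) : Prop :=
  QuasiIso φ.toComplexHom

variable (F : DGAlgebra.{u, v} K)

/-- Multiplication of elements of degree `i` by `(-1) ^ (m * i)`. -/
def sgn (m : ℤ) : F →ₗ[K] F := signMap F.gr m

/-- The parity automorphism: multiplication of elements of degree `i` by `(-1) ^ i`. -/
def eps : F →ₗ[K] F := F.sgn 1

lemma sgn_mul (m : ℤ) (a b : F) : F.sgn m (a * b) = F.sgn m a * F.sgn m b := by
  refine ext_of_homogeneous F.gr (f := F.sgn m ∘ₗ LinearMap.mulRight K b)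
    (g := LinearMap.mulRight K (F.sgn m b) ∘ₗ F.sgn m) (fun i a ha => ?_) a
  refine ext_of_homogeneous F.gr (f := F.sgn m ∘ₗ LinearMap.mulLeft K a)
    (g := LinearMap.mulLeft K (F.sgn m a) ∘ₗ F.sgn m) (fun j b hb => ?_) b
  simp [sgn, signMap_apply F.gr _ ha, signMap_apply F.gr _ hb, -zsmul_eq_mul,
    signMap_apply F.gr _ (SetLike.mul_mem_graded ha hb), mul_add, sg_add, mul_smul]
  exact smul_comm _ _ _

lemma eps_mul (a b : F) : F.eps (a * b) = F.eps a * F.eps b := F.sgn_mul 1 a b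
@[simp] lemma eps_eps (a : F) : F.eps (F.eps a) = a := signMap_one_one F.gr a
lemma sgn_succ (m : ℤ) (a : F) : F.sgn (m + 1) a = F.sgn m (F.eps a) := signMap_add F.gr m 1 a
lemma sgn_d (m : ℤ) (a : F) : F.sgn m (F.d a) = sg m • F.d (F.sgn m a) :=
  signMap_comp_of_degree_one F.gr F.d_mem m a
lemma eps_d (a : F) : F.eps (F.d a) = -F.d (F.eps a) := by
  simpa [eps] using F.sgn_d 1 a
lemma eps_sgn (m : ℤ) (a : F) : F.eps (F.sgn m a) = F.sgn m (F.eps a) := by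
  rw [← sgn_succ, add_comm]; exact (signMap_add F.gr 1 m a).symm
lemma eps_mem {i : ℤ} {a : F} (ha : a ∈ F.gr i) : F.eps a ∈ F.gr i := signMap_mem F.gr 1 ha
lemma sgn_mem (m : ℤ) {i : ℤ} {a : F} (ha : a ∈ F.gr i) : F.sgn m a ∈ F.gr i :=
  signMap_mem F.gr m ha
lemma eps_apply {i : ℤ} {a : F} (ha : a ∈ F.gr i) : F.eps a = sg i • a := by
  simpa [eps, sgn, -zsmul_eq_mul] using signMap_apply F.gr 1 ha
lemma d_mul (a b : F) : F.d (a * b) = F.d a * b + F.eps a * F.d b := by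
  refine ext_of_homogeneous F.gr (f := F.d ∘ₗ LinearMap.mulRight K b)
    (g := LinearMap.mulRight K b ∘ₗ F.d + LinearMap.mulRight K (F.d b) ∘ₗ F.eps)
    (fun i a ha => ?_) a
  simp [F.leibniz b ha, F.eps_apply ha, -zsmul_eq_mul]

variable {F} in
lemma Hom.map_sgn {G : DGAlgebra.{u, v} K} (φ : Hom F G) (m : ℤ) (a : F) :
    φ.toAlgHom (F.sgn m a) = G.sgn m (φ.toAlgHom a) := by
  refine ext_of_homogeneous F.gr (f := φ.toAlgHom.toLinearMap ∘ₗ F.sgn m)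
    (g := G.sgn m ∘ₗ φ.toAlgHom.toLinearMap) (fun i a ha => ?_) a
  simp [sgn, signMap_apply F.gr _ ha, signMap_apply G.gr _ (φ.map_mem ha)]

end DGAlgebra

variable {K : Type u} [Field K]

/-- A differential graded bimodule over the differential graded algebra `F`; `lact a x` is `a x`
and `ract x a` is `x a`. -/
structure DGBimodule (F : DGAlgebra.{u, v} K) where
  carrier : Type v
  [addCommGroup : AddCommGroup carrier]
  [module : Module K carrier]
  /-- the homogeneous components -/
  gr : ℤ → Submodule K carrier
  [decomposition : DirectSum.Decomposition gr]
  /-- the differential -/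
  d : carrier →ₗ[K] carrier
  d_mem : ∀ {i x}, x ∈ gr i → d x ∈ gr (i + 1)
  d_d : ∀ x, d (d x) = 0
  /-- the left action of `F` -/
  lact : F →ₗ[K] carrier →ₗ[K] carrier
  /-- the right action of `F` -/
  ract : carrier →ₗ[K] F →ₗ[K] carrier
  one_lact : ∀ x, lact 1 x = x
  mul_lact : ∀ a b x, lact (a * b) x = lact a (lact b x)
  ract_one : ∀ x, ract x 1 = x
  ract_mul : ∀ x a b, ract x (a * b) = ract (ract x a) b
  lact_ract : ∀ a x b, ract (lact a x) b = lact a (ract x b)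
  lact_mem : ∀ {i j a x}, a ∈ F.gr i → x ∈ gr j → lact a x ∈ gr (i + j)
  ract_mem : ∀ {i j x a}, x ∈ gr i → a ∈ F.gr j → ract x a ∈ gr (i + j)
  leibniz_left : ∀ {i a} (x : carrier), a ∈ F.gr i →
    d (lact a x) = lact (F.d a) x + sg i • lact a (d x)
  leibniz_right : ∀ {i x} (a : F), x ∈ gr i →
    d (ract x a) = ract (d x) a + sg i • ract x (F.d a)

namespace DGBimodule

attribute [instance] DGBimodule.addCommGroup DGBimodule.module DGBimodule.decomposition

instance {F : DGAlgebra.{u, v} K} : CoeSort (DGBimodule F) (Type v) := ⟨DGBimodule.carrier⟩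

/-- A differential graded algebra as a bimodule over itself. -/
@[reducible]
def regular (F : DGAlgebra.{u, v} K) : DGBimodule F where
  carrier := F
  gr := F.gr
  d := F.d
  d_mem := F.d_mem
  d_d := F.d_d
  lact := LinearMap.mul K F
  ract := LinearMap.mul K F
  one_lact := by simp
  mul_lact := by simp [mul_assoc]
  ract_one := by simp
  ract_mul := by simp [mul_assoc]
  lact_ract := by simp [mul_assoc]
  lact_mem := fun ha hx => SetLike.mul_mem_graded ha hx
  ract_mem := fun ha hx => SetLike.mul_mem_graded ha hx
  leibniz_left := by intro i a x ha; simpa [-zsmul_eq_mul] using F.leibniz x ha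
  leibniz_right := by intro i x a hx; simpa [-zsmul_eq_mul] using F.leibniz a hx

/-- Restriction of a bimodule along a homomorphism of differential graded algebras. -/
@[reducible]
def restrict {F G : DGAlgebra.{u, v} K} (φ : F.Hom G) (M : DGBimodule G) : DGBimodule F where
  carrier := M
  gr := M.gr
  d := M.d
  d_mem := M.d_mem
  d_d := M.d_d
  lact := M.lact ∘ₗ φ.toAlgHom.toLinearMap
  ract := M.ract.compl₂ φ.toAlgHom.toLinearMap
  one_lact := by simp [M.one_lact]
  mul_lact := by simp [M.mul_lact]
  ract_one := by simp [M.ract_one]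
  ract_mul := by simp [M.ract_mul]
  lact_ract := by simp [M.lact_ract]
  lact_mem := fun ha hx => M.lact_mem (φ.map_mem ha) hx
  ract_mem := fun hx ha => M.ract_mem hx (φ.map_mem ha)
  leibniz_left := by intro i a x ha; simpa [φ.map_d] using M.leibniz_left x (φ.map_mem ha)
  leibniz_right := by intro i x a hx; simpa [φ.map_d] using M.leibniz_right (φ.toAlgHom a) hx

/-- A homomorphism (of degree `0`, compatible with all structure) of differential graded
bimodules. -/
structure Hom {F : DGAlgebra.{u, v} K} (M N : DGBimodule F) where
  toLinearMap : M →ₗ[K] N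
  map_mem : ∀ {i x}, x ∈ M.gr i → toLinearMap x ∈ N.gr i
  map_d : ∀ x, toLinearMap (M.d x) = N.d (toLinearMap x)
  map_lact : ∀ a x, toLinearMap (M.lact a x) = N.lact a (toLinearMap x)
  map_ract : ∀ x a, toLinearMap (M.ract x a) = N.ract (toLinearMap x) a

/-- A homomorphism `φ : F → G` of differential graded algebras, as a homomorphism of
`F`-bimodules. -/
def homOfAlgHom {F G : DGAlgebra.{u, v} K} (φ : F.Hom G) :
    Hom (regular F) (restrict φ (regular G)) where
  toLinearMap := φ.toAlgHom.toLinearMap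
  map_mem := φ.map_mem
  map_d := φ.map_d
  map_lact := fun a x => map_mul φ.toAlgHom a x
  map_ract := fun x a => map_mul φ.toAlgHom x a

variable {F : DGAlgebra.{u, v} K} (M : DGBimodule F)

/-- The parity automorphism of a bimodule. -/
def eps : M →ₗ[K] M := signMap M.gr 1

lemma eps_apply {i : ℤ} {x : M} (hx : x ∈ M.gr i) : M.eps x = sg i • x := by
  simpa [eps] using signMap_apply M.gr 1 hx

lemma d_lact (a : F) (x : M) : M.d (M.lact a x) = M.lact (F.d a) x + M.lact (F.eps a) (M.d x) := by
  refine ext_of_homogeneous F.gr (f := M.d ∘ₗ M.lact.flip x)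
    (g := M.lact.flip x ∘ₗ F.d + M.lact.flip (M.d x) ∘ₗ F.eps) (fun i a ha => ?_) a
  simp [M.leibniz_left x ha, F.eps_apply ha, -zsmul_eq_mul]

lemma d_ract (x : M) (a : F) : M.d (M.ract x a) = M.ract (M.d x) a + M.ract (M.eps x) (F.d a) := by
  refine ext_of_homogeneous M.gr (f := M.d ∘ₗ M.ract.flip a)
    (g := M.ract.flip a ∘ₗ M.d + M.ract.flip (F.d a) ∘ₗ M.eps) (fun i x hx => ?_) x
  simp [M.leibniz_right a hx, M.eps_apply hx]

end DGBimodule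

section Cochains

variable {F : DGAlgebra.{u, v} K} (M : DGBimodule F)

/-- Families `(c_n)_{n ≥ 0}` of multilinear maps `F^n → M`, without any condition on degrees. -/
abbrev Fam : Type v := ∀ n : ℕ, MultilinearMap K (fun _ : Fin n => (F : Type v)) M

/-- Insertion of the differential at the `i`-th place of a multilinear map:
`(a_0, …, a_{n-1}) ↦ c (ε a_0, …, ε a_{i-1}, d a_i, a_{i+1}, …, a_{n-1})`, where `ε` is the parity
automorphism. On homogeneous arguments this is
`(-1)^{|a_0| + ⋯ + |a_{i-1}|} c (a_0, …, d a_i, …, a_{n-1})`. -/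
def dAt {n : ℕ} (i : Fin n) (c : MultilinearMap K (fun _ : Fin n => (F : Type v)) M) :
    MultilinearMap K (fun _ : Fin n => (F : Type v)) M :=
  c.compLinearMap fun j => if j < i then F.eps else if j = i then F.d else LinearMap.id

/-- The tuple `(ε a_0, …, ε a_{i-1}, ε a_i * a_{i+1}, a_{i+2}, …, a_n)`. -/
def contract {n : ℕ} (i : Fin n) (a : Fin (n + 1) → F) : Fin n → F := fun j =>
  if j < i then F.eps (a j.castSucc)
  else if j = i then F.eps (a i.castSucc) * a i.succ
  else a j.succ

lemma contract_update {n : ℕ} (i : Fin n) (l : Fin (n + 1)) :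
    ∃ (k : Fin n), ∀ a : Fin (n + 1) → F, ∃ (g : F →ₗ[K] F), ∀ x : F,
      contract i (Function.update a l x) = Function.update (contract i a) k (g x) := by
  rcases lt_trichotomy l i.castSucc with h | h | h
  · obtain ⟨k, rfl⟩ : ∃ k : Fin n, l = k.castSucc :=
      ⟨l.castLT (lt_trans h i.castSucc_lt_last), rfl⟩
    have hk : k < i := by simpa using h
    refine ⟨k, fun a => ⟨F.eps, fun x => ?_⟩⟩
    ext j
    rcases eq_or_ne j k with rfl | hj
    · simp [contract, hk]
    · have h1 : j.castSucc ≠ k.castSucc := by simpa using hj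
      have h2 : j.succ ≠ k.castSucc ∨ j < i := by
        by_contra! hc
        have : (j : ℕ) + 1 = k := by simpa using congrArg Fin.val hc.1
        have := hc.2; simp only [Fin.lt_def, Fin.le_def] at *; omega
      have h3 : i.castSucc ≠ k.castSucc := by simpa using hk.ne'
      have h4 : i.succ ≠ k.castSucc := by
        intro hc
        have : (i : ℕ) + 1 = k := by simpa using congrArg Fin.val hc
        simp only [Fin.lt_def] at *; omega
      simp only [contract, Function.update_of_ne hj, Function.update_of_ne h1,
        Function.update_of_ne h3, Function.update_of_ne h4]
      rcases h2 with h2 | h2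
      · rw [Function.update_of_ne h2]
      · simp [h2]
  · subst h
    refine ⟨i, fun a => ⟨LinearMap.mulRight K (a i.succ) ∘ₗ F.eps, fun x => ?_⟩⟩
    ext j
    have h4 : i.succ ≠ i.castSucc := by simp [Fin.ext_iff]
    rcases eq_or_ne j i with rfl | hj
    · simp [contract, Function.update_of_ne h4]
    · have h1 : j.castSucc ≠ i.castSucc := by simpa using hj
      have h2 : j.succ ≠ i.castSucc ∨ j < i := by
        by_contra! hc
        have : (j : ℕ) + 1 = i := by simpa using congrArg Fin.val hc.1
        have := hc.2; simp only [Fin.le_def] at *; omega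
      simp only [contract, Function.update_of_ne hj, Function.update_of_ne h1, hj, if_false]
      rcases h2 with h2 | h2
      · rw [Function.update_of_ne h2]
      · simp [h2]
  · obtain ⟨k, rfl⟩ : ∃ k : Fin n, l = k.succ :=
      ⟨l.pred (Fin.ne_zero_of_lt h), by simp⟩
    have hk : i ≤ k := by simp only [Fin.lt_def, Fin.le_def, Fin.val_castSucc, Fin.val_succ] at *; omega
    rcases hk.eq_or_lt with rfl | hk
    · refine ⟨i, fun a => ⟨LinearMap.mulLeft K (F.eps (a i.castSucc)), fun x => ?_⟩⟩
      ext j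
      have h4 : i.castSucc ≠ i.succ := by simp [Fin.ext_iff]
      rcases eq_or_ne j i with rfl | hj
      · simp [contract, Function.update_of_ne h4]
      · have h1 : j.succ ≠ i.succ := by simpa using hj
        have h2 : j < i → j.castSucc ≠ i.succ := by
          intro hji hc
          have : (j : ℕ) = i + 1 := by simpa using congrArg Fin.val hc
          simp only [Fin.lt_def] at *; omega
        simp only [contract, Function.update_of_ne hj, Function.update_of_ne h1, hj, if_false]
        split_ifs with h3
        · rw [Function.update_of_ne (h2 h3)]
        · rfl
    · refine ⟨k, fun a => ⟨LinearMap.id, fun x => ?_⟩⟩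
      ext j
      rcases eq_or_ne j k with rfl | hj
      · simp [contract, hk.not_gt, hk.ne']
      · have h1 : j.succ ≠ k.succ := by simpa using hj
        have h2 : j < i → j.castSucc ≠ k.succ := by
          intro hji hc
          have : (j : ℕ) = k + 1 := by simpa using congrArg Fin.val hc
          simp only [Fin.lt_def] at *; omega
        have h3 : i.castSucc ≠ k.succ := by
          intro hc
          have : (i : ℕ) = k + 1 := by simpa using congrArg Fin.val hc
          simp only [Fin.lt_def] at *; omega
        have h4 : i.succ ≠ k.succ := by simpa using hk.ne
        simp only [contract, Function.update_of_ne hj, Function.update_of_ne h1,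
          Function.update_of_ne h3, Function.update_of_ne h4]
        split_ifs with h3
        · rw [Function.update_of_ne (h2 h3)]
        · rfl
        · rfl

/-- Insertion of the product at the `i`-th place of a multilinear map:
`(a_0, …, a_n) ↦ c (ε a_0, …, ε a_{i-1}, ε a_i * a_{i+1}, a_{i+2}, …, a_n)`. On homogeneous
arguments this is `(-1)^{|a_0| + ⋯ + |a_i|} c (a_0, …, a_i a_{i+1}, …, a_n)`. -/
def mulAt {n : ℕ} (i : Fin n) (c : MultilinearMap K (fun _ : Fin n => (F : Type v)) M) :
    MultilinearMap K (fun _ : Fin (n + 1) => (F : Type v)) M :=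
  MultilinearMap.mk' (fun a => c (contract i a))
    (fun a l x y => by
      obtain ⟨k, hk⟩ := contract_update (F := F) i l
      obtain ⟨g, hg⟩ := hk a
      simp [hg])
    (fun a l r x => by
      obtain ⟨k, hk⟩ := contract_update (F := F) i l
      obtain ⟨g, hg⟩ := hk a
      simp [hg])

/-- `(a_0, …, a_n) ↦ (-1)^{m |a_0|} a_0 c (a_1, …, a_n)`. -/
def leftTerm (m : ℤ) {n : ℕ} (c : MultilinearMap K (fun _ : Fin n => (F : Type v)) M) :
    MultilinearMap K (fun _ : Fin (n + 1) => (F : Type v)) M :=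
  LinearMap.uncurryLeft
    { toFun := fun x => (M.lact (F.sgn m x)).compMultilinearMap c
      map_add' := by intros; ext; simp
      map_smul' := by intros; ext; simp }

/-- `(a_0, …, a_n) ↦ (-1)^{|a_0| + ⋯ + |a_{n-1}|} c (a_0, …, a_{n-1}) a_n`. -/
def rightTerm {n : ℕ} (c : MultilinearMap K (fun _ : Fin n => (F : Type v)) M) :
    MultilinearMap K (fun _ : Fin (n + 1) => (F : Type v)) M :=
  (M.ract.compMultilinearMap (c.compLinearMap fun _ => F.eps)).uncurryRight

/-- The part of the Hochschild differential that comes from the products, on families of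
degree `m`: its component with `n + 1` arguments is
`(-1)^{m |a_0|} a_0 c_n (a_1, …, a_n)
  + ∑_{i < n} (-1)^{i + 1 + |a_0| + ⋯ + |a_i|} c_n (a_0, …, a_i a_{i+1}, …, a_n)
  + (-1)^{n + 1 + |a_0| + ⋯ + |a_{n-1}|} c_n (a_0, …, a_{n-1}) a_n`. -/
def mulPart (m : ℤ) (c : Fam M) : Fam M
  | 0 => 0
  | n + 1 => leftTerm M m (c n) + ∑ i : Fin n, sg (i + 1) • mulAt M i (c n)
      + sg (n + 1) • rightTerm M (c n)

/-- The part of the Hochschild differential that comes from the differentials of `F` and `M`, on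
families of degree `m`: its component with `n` arguments is
`(-1)^m d (c_n (a_0, …, a_{n-1}))
  + ∑_{i < n} (-1)^{i + |a_0| + ⋯ + |a_{i-1}|} c_n (a_0, …, d a_i, …, a_{n-1})`. -/
def internalPart (m : ℤ) (c : Fam M) : Fam M := fun n =>
  sg m • M.d.compMultilinearMap (c n) + ∑ i : Fin n, sg i • dAt M i (c n)

/-! ### The square of the differential -/

def opI (m : ℤ) : Fam M →ₗ[K] Fam M where
  toFun c n := sg m • M.d.compMultilinearMap (c n)
  map_add' c c' := by funext n; ext a; simp
  map_smul' r c := by funext n; ext a; simp [smul_comm r]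

def opD : Fam M →ₗ[K] Fam M where
  toFun c n := ∑ i : Fin n, sg i • dAt M i (c n)
  map_add' c c' := by
    funext n; ext a; simp [dAt, Finset.sum_add_distrib]
  map_smul' r c := by
    funext n; ext a; simp [dAt, Finset.smul_sum, smul_comm r]

def opL (m : ℤ) : Fam M →ₗ[K] Fam M where
  toFun c n := match n with
    | 0 => 0
    | n + 1 => leftTerm M m (c n)
  map_add' c c' := by funext n; cases n <;> ext a <;> simp [leftTerm]
  map_smul' r c := by funext n; cases n <;> ext a <;> simp [leftTerm]

def opR : Fam M →ₗ[K] Fam M where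
  toFun c n := match n with
    | 0 => 0
    | n + 1 => sg (n + 1) • rightTerm M (c n)
  map_add' c c' := by funext n; cases n <;> ext a <;> simp [rightTerm]
  map_smul' r c := by funext n; cases n <;> ext a <;> simp [rightTerm, smul_comm r]

def opB : Fam M →ₗ[K] Fam M where
  toFun c n := match n with
    | 0 => 0
    | n + 1 => ∑ i : Fin n, sg (i + 1) • mulAt M i (c n)
  map_add' c c' := by
    funext n; cases n <;> ext a <;>
      simp [mulAt, Finset.sum_add_distrib]
  map_smul' r c := by
    funext n; cases n <;> ext a <;>
      simp [mulAt, Finset.smul_sum, smul_comm r]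

lemma parts_eq (m : ℤ) (c : Fam M) : mulPart M m c + internalPart M m c
    = (opI M m + opD M + opL M m + opB M + opR M) c := by
  funext n
  cases n <;> simp [mulPart, internalPart, opI, opD, opL, opB, opR]; abel

/-- The Hochschild differential on families of degree `m`: the sum of the part that comes from the
products and the part that comes from the differentials. -/
def delta (m : ℤ) : Fam M →ₗ[K] Fam M where
  toFun c := mulPart M m c + internalPart M m c
  map_add' c c' := by simp only [parts_eq, map_add]
  map_smul' r c := by simp only [parts_eq, map_smul, RingHom.id_apply]

lemma delta_eq (m : ℤ) : delta M m = opI M m + opD M + opL M m + opB M + opR M :=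
  LinearMap.ext fun c => parts_eq M m c

def lc (x : F) : Fam M →ₗ[K] Fam M where
  toFun c n := (c (n + 1)).curryLeft x
  map_add' c c' := by funext n; ext a; simp
  map_smul' r c := by funext n; ext a; simp

lemma lc_apply (x : F) (c : Fam M) (n : ℕ) (a : Fin n → F) :
    lc M x c n a = c (n + 1) (Fin.cons x a) := rfl

lemma fam_add_apply (c c' : Fam M) (n : ℕ) (a : Fin n → F) : (c + c') n a = c n a + c' n a := rfl
lemma fam_sub_apply (c c' : Fam M) (n : ℕ) (a : Fin n → F) : (c - c') n a = c n a - c' n a := rfl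
lemma fam_neg_apply (c : Fam M) (n : ℕ) (a : Fin n → F) : (-c) n a = -c n a := rfl

lemma lc_add (x y : F) (c : Fam M) : lc M (x + y) c = lc M x c + lc M y c := by
  funext n; ext a; simp [lc]

lemma lc_neg (x : F) (c : Fam M) : lc M (-x) c = -lc M x c := by
  funext n; ext a; simp [lc]

lemma lc_zero (c : Fam M) : lc M 0 c = 0 := by
  funext n; ext a; simp [lc]

lemma fam_ext {c c' : Fam M} (h0 : c 0 = c' 0) (h : ∀ x, lc M x c = lc M x c') : c = c' := by
  funext n
  cases n with
  | zero => exact h0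
  | succ n =>
    ext a
    have := congrArg (fun e : Fam M => e n (Fin.tail a)) (h (a 0))
    simpa [lc_apply] using this

/-- multiplication of the first argument by `z` -/
def mm (z : F) (c : Fam M) : Fam M := fun n => match n with
  | 0 => 0
  | n + 1 => ((c (n + 1)).curryLeft ∘ₗ LinearMap.mulLeft K z).uncurryLeft

lemma lc_mm (y z : F) (c : Fam M) : lc M y (mm M z c) = lc M (z * y) c := by
  funext n; ext a; simp [lc, mm]

lemma mm_zero (z : F) (c : Fam M) : mm M z c 0 = 0 := rfl

lemma opD_apply (c : Fam M) (n : ℕ) (a : Fin n → F) : opD M c n a = ∑ i : Fin n, sg i •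
    c n (fun j => if j < i then F.eps (a j) else if j = i then F.d (a j) else a j) := by
  simp only [opD, dAt, LinearMap.coe_mk, AddHom.coe_mk, sum_apply, smul_apply,
    MultilinearMap.compLinearMap_apply]
  refine Finset.sum_congr rfl fun i _ => ?_
  congr 2
  funext j
  split_ifs <;> rfl

lemma opB_apply (c : Fam M) (n : ℕ) (a : Fin (n + 1) → F) : opB M c (n + 1) a =
    ∑ i : Fin n, sg (i + 1) • c n (contract i a) := by
  simp [opB, mulAt]

lemma lc_opD (x : F) (c : Fam M) :
    lc M x (opD M c) = lc M (F.d x) c - opD M (lc M (F.eps x) c) := by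
  funext n; ext a
  rw [fam_sub_apply]
  simp only [lc_apply, opD_apply, Fin.sum_univ_succ, sub_eq_add_neg, ← Finset.sum_neg_distrib]
  congr 1
  · simp only [Fin.val_zero, Nat.cast_zero, sg_zero, one_smul]
    congr 1
    funext j
    refine Fin.cases ?_ (fun j => ?_) j <;> simp
  · refine Finset.sum_congr rfl fun i _ => ?_
    simp only [Fin.val_succ, Nat.cast_succ, sg_succ, neg_smul]
    congr 3
    funext j
    refine Fin.cases ?_ (fun j => ?_) j <;> simp

lemma lc_opB (x : F) (c : Fam M) :
    lc M x (opB M c) = -opB M (lc M (F.eps x) c) - mm M (F.eps x) c := by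
  funext n; ext a
  cases n with
  | zero => simp [lc_apply, opB_apply, mm_zero]; simp [opB]
  | succ n =>
    rw [fam_sub_apply, fam_neg_apply]
    simp only [lc_apply, opB_apply, Fin.sum_univ_succ, sub_eq_add_neg,
      ← Finset.sum_neg_distrib]
    rw [add_comm]
    congr 1
    · refine Finset.sum_congr rfl fun i _ => ?_
      simp only [Fin.val_succ, Nat.cast_succ, sg_succ _, neg_smul, neg_neg]
      congr 3
      funext j
      refine Fin.cases ?_ (fun j => ?_) j
      · simp [contract]
      · simp [contract]
    · simp only [Fin.val_zero, Nat.cast_zero, zero_add, sg_one, neg_smul, one_smul]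
      congr 1
      simp only [mm, LinearMap.uncurryLeft_apply, LinearMap.comp_apply,
        MultilinearMap.curryLeft_apply, LinearMap.mulLeft_apply]
      congr 1
      funext j
      refine Fin.cases ?_ (fun j => ?_) j
      · simp [contract]
      · simp [contract, Fin.tail]

lemma opD_zero (c : Fam M) : opD M c 0 = 0 := by ext a; simp [opD_apply]
lemma opB_zero (c : Fam M) : opB M c 0 = 0 := rfl

def opP : Fam M →ₗ[K] Fam M := opD M + opB M

lemma opP_zero (c : Fam M) : opP M c 0 = 0 := by simp [opP, opD_zero, opB_zero]

lemma lc_opP (x : F) (c : Fam M) :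
    lc M x (opP M c) = lc M (F.d x) c - opP M (lc M (F.eps x) c) - mm M (F.eps x) c := by
  simp only [opP, LinearMap.add_apply, map_add, lc_opD, lc_opB]; abel

lemma opP_mm (x : F) (c : Fam M) :
    opP M (mm M x c) = mm M (F.eps x) (opP M c) + mm M (F.eps (F.d x)) c := by
  refine fam_ext M ?_ fun y => ?_
  · simp [opP_zero, mm_zero]
  · have h : mm M (F.eps y) (mm M x c) = mm M (F.eps (F.eps x * y)) c := by
      refine fam_ext M (by simp [mm_zero]) fun z => ?_
      simp [lc_mm, F.eps_mul, mul_assoc]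
    simp only [map_add, lc_opP, lc_mm, h, F.d_mul, F.eps_d, F.eps_mul, F.eps_eps, lc_add, neg_mul,
      lc_neg]
    abel

lemma opP_opP (c : Fam M) : opP M (opP M c) = 0 := by
  have key : ∀ n : ℕ, ∀ c : Fam M, opP M (opP M c) n = 0 := by
    intro n
    induction n with
    | zero => intro c; simp [opP_zero]
    | succ n ih =>
      intro c
      ext a
      have h : lc M (a 0) (opP M (opP M c)) = opP M (opP M (lc M (a 0) c)) := by
        simp only [lc_opP, map_sub, F.d_d, lc_zero, F.eps_eps, opP_mm, F.eps_d, lc_neg, map_neg]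
        abel
      have h' := congrArg (fun e : Fam M => e n (Fin.tail a)) h
      simp only [ih] at h'
      simpa [lc_apply] using h'
  funext n
  exact key n c

def post (f : M →ₗ[K] M) : Fam M →ₗ[K] Fam M where
  toFun c n := f.compMultilinearMap (c n)
  map_add' c c' := by funext n; ext a; simp
  map_smul' r c := by funext n; ext a; simp

lemma post_apply (f : M →ₗ[K] M) (c : Fam M) (n : ℕ) (a : Fin n → F) :
    post M f c n a = f (c n a) := rfl

lemma opP_post (f : M →ₗ[K] M) (c : Fam M) : opP M (post M f c) = post M f (opP M c) := by
  funext n; ext a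
  cases n with
  | zero => simp [post_apply, opP_zero]
  | succ n =>
    simp only [opP, LinearMap.add_apply, fam_add_apply, opD_apply, opB_apply, post_apply, map_add,
      map_sum, map_zsmul]

lemma opI_eq (m : ℤ) (c : Fam M) : opI M m c = sg m • post M M.d c := rfl

lemma opI_opI (m : ℤ) (c : Fam M) : opI M (m + 1) (opI M m c) = 0 := by
  funext n; ext a
  simp [opI, M.d_d]

lemma opI_opP (m : ℤ) (c : Fam M) : opI M (m + 1) (opP M c) + opP M (opI M m c) = 0 := by
  simp only [opI_eq, map_zsmul, opP_post, sg_succ, neg_smul, neg_add_cancel]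

lemma opL_zero (m : ℤ) (c : Fam M) : opL M m c 0 = 0 := rfl
lemma opR_zero (c : Fam M) : opR M c 0 = 0 := rfl

lemma opL_apply (m : ℤ) (c : Fam M) (n : ℕ) (a : Fin (n + 1) → F) :
    opL M m c (n + 1) a = M.lact (F.sgn m (a 0)) (c n (Fin.tail a)) := rfl

lemma lc_opL (m : ℤ) (x : F) (c : Fam M) :
    lc M x (opL M m c) = post M (M.lact (F.sgn m x)) c := rfl

lemma mm_opL (m : ℤ) (z : F) (c : Fam M) :
    mm M z (opL M m c) = post M (M.lact (F.sgn m z)) (opL M m c) := by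
  refine fam_ext M ?_ fun y => ?_
  · ext a; simp [mm_zero, post_apply, opL_zero]
  · rw [lc_mm, lc_opL]
    funext n; ext a
    simp [lc_apply, post_apply, opL_apply, F.sgn_mul, M.mul_lact]

lemma left_identity (m : ℤ) (c : Fam M) :
    opI M (m + 1) (opL M m c) + opL M (m + 1) (opI M m c) + opP M (opL M m c)
      + opL M (m + 1) (opP M c) + opL M (m + 1) (opL M m c) = 0 := by
  refine fam_ext M ?_ fun x => ?_
  · ext a; simp [opI, opL_zero, opP_zero]
  · simp only [map_add, lc_opP, lc_opL, mm_opL, map_zero, opP_post, F.sgn_succ, opI_eq, map_zsmul]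
    have h : lc M x (post M M.d (opL M m c)) =
        post M (M.lact (F.d (F.sgn m x))) c + post M (M.lact (F.sgn m (F.eps x))) (post M M.d c) := by
      funext n; ext a
      simp [lc_apply, post_apply, opL_apply, M.d_lact, F.eps_sgn]
    have h2 : post M (M.lact (F.sgn m (F.d x))) c =
        sg m • post M (M.lact (F.d (F.sgn m x))) c := by
      funext n; ext a
      simp only [post_apply, F.sgn_d, map_zsmul, LinearMap.smul_apply]
      rfl
    rw [h, h2, sg_succ, neg_smul, smul_add]
    abel

lemma opR_apply (c : Fam M) (n : ℕ) (a : Fin (n + 1) → F) :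
    opR M c (n + 1) a =
      sg (n + 1) • M.ract (c n (fun j => F.eps (a j.castSucc))) (a (Fin.last n)) := rfl

lemma opL_opR (m : ℤ) (c : Fam M) :
    opL M (m + 1) (opR M c) + opR M (opL M m c) = 0 := by
  funext n; ext a
  rcases n with _ | _ | n
  · simp [opL_zero, opR_zero]
  · simp [opL_apply, opR_apply, opL_zero, opR_zero]
  · rw [fam_add_apply, opL_apply, opR_apply, opR_apply, opL_apply, M.lact_ract, map_zsmul,
      F.sgn_succ]
    simp only [Nat.cast_add, Nat.cast_one, sg_succ, neg_smul, neg_neg]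
    exact neg_add_cancel _

def opT : Fam M →ₗ[K] Fam M where
  toFun c n := (c n).compLinearMap fun _ => F.eps
  map_add' c c' := by funext n; ext a; simp
  map_smul' r c := by funext n; ext a; simp

lemma opT_apply (c : Fam M) (n : ℕ) (a : Fin n → F) : opT M c n a = c n (fun j => F.eps (a j)) :=
  rfl

lemma lc_opT (x : F) (c : Fam M) : lc M x (opT M c) = opT M (lc M (F.eps x) c) := by
  funext n; ext a
  simp only [lc_apply, opT_apply]
  congr 1
  funext j
  refine Fin.cases ?_ (fun j => ?_) j <;> simp

lemma opD_opT (c : Fam M) : opD M (opT M c) = -opT M (opD M c) := by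
  have key : ∀ n : ℕ, ∀ c : Fam M, opD M (opT M c) n = -opT M (opD M c) n := by
    intro n
    induction n with
    | zero => intro c; ext a; simp [opD_zero, opT_apply]
    | succ n ih =>
      intro c
      ext a
      have h : lc M (a 0) (opD M (opT M c)) + lc M (a 0) (opT M (opD M c)) =
          -(opD M (opT M (lc M (a 0) c)) + opT M (opD M (lc M (a 0) c))) := by
        simp only [lc_opD, lc_opT, map_sub, F.eps_d, F.eps_eps, lc_neg, map_neg]
        abel
      have h' := congrArg (fun e : Fam M => e n (Fin.tail a)) h
      simp only [fam_add_apply, fam_neg_apply, ih] at h'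
      simp only [lc_apply, Fin.cons_self_tail] at h'
      have h3 : (-(opT M (opD M ((lc M (a 0)) c)) n)) (Fin.tail a)
        = -(opT M (opD M ((lc M (a 0)) c)) n (Fin.tail a)) := rfl
      rw [h3, neg_add_cancel, neg_zero] at h'
      exact eq_neg_of_add_eq_zero_left h'
  funext n
  exact key n c

lemma mm_opT (x : F) (c : Fam M) : mm M (F.eps x) (opT M c) = opT M (mm M x c) := by
  refine fam_ext M ?_ fun y => ?_
  · ext a; simp [mm_zero, opT_apply]
  · simp [lc_mm, lc_opT, F.eps_mul]

lemma opB_opT (c : Fam M) : opB M (opT M c) = opT M (opB M c) := by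
  have key : ∀ n : ℕ, ∀ c : Fam M, opB M (opT M c) n = opT M (opB M c) n := by
    intro n
    induction n with
    | zero => intro c; ext a; simp [opB_zero, opT_apply]
    | succ n ih =>
      intro c
      ext a
      have h : lc M (a 0) (opB M (opT M c)) - lc M (a 0) (opT M (opB M c)) =
          opT M (opB M (lc M (a 0) c)) - opB M (opT M (lc M (a 0) c)) := by
        simp only [lc_opB, lc_opT, map_sub, F.eps_eps, map_neg, mm_opT]
        abel
      have h' := congrArg (fun e : Fam M => e n (Fin.tail a)) h
      simp only [fam_sub_apply, ih, sub_self] at h'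
      simp only [lc_apply, Fin.cons_self_tail] at h'
      exact sub_eq_zero.mp h'
  funext n
  exact key n c

/-- The space of Hochschild cochains of degree `m` of `F` with coefficients in `M`, that is the
degree `m` part of `∏_{n ≥ 0} Hom(F[1]^{⊗ n}, M)`: families of multilinear maps `c_n : F^n → M` such
that `c_n` maps elements of degrees `p_0, …, p_{n-1}` in `F` (hence `p_i - 1` in `F[1]`) to an
element of degree `∑ (p_i - 1) + m`. -/
def cochains (m : ℤ) : Submodule K (Fam M) where
  carrier := {c | ∀ (n : ℕ) (p : Fin n → ℤ) (a : Fin n → F), (∀ i, a i ∈ F.gr (p i)) →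
    c n a ∈ M.gr (∑ i, (p i - 1) + m)}
  add_mem' := fun h h' n p a ha => add_mem (h n p a ha) (h' n p a ha)
  zero_mem' := fun _ _ _ _ => zero_mem _
  smul_mem' := fun r _ h n p a ha => Submodule.smul_mem _ r (h n p a ha)

/-- Two multilinear maps that agree on homogeneous elements are equal. -/
lemma multilinear_ext {W : Type*} [AddCommGroup W] [Module K W] {n : ℕ}
    {f g : MultilinearMap K (fun _ : Fin n => (F : Type v)) W}
    (h : ∀ (p : Fin n → ℤ) (a : Fin n → F), (∀ i, a i ∈ F.gr (p i)) → f a = g a) : f = g := by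
  induction n with
  | zero => ext a; exact h 0 a (fun i => i.elim0)
  | succ n ih =>
    have key : ∀ x, f.curryLeft x = g.curryLeft x := by
      refine ext_of_homogeneous F.gr fun i x hx => ih fun p a ha => ?_
      refine h (Fin.cons i p) (Fin.cons x a) fun j => ?_
      refine Fin.cases ?_ (fun j => ?_) j
      · simpa using hx
      · simpa using ha j
    ext a
    have := congrArg (fun e => e (Fin.tail a)) (key (a 0))
    simpa using this

variable {M}

lemma lc_mem {m i : ℤ} {x : F} {c : Fam M} (hx : x ∈ F.gr i) (hc : c ∈ cochains M m) :
    lc M x c ∈ cochains M (m + i - 1) := by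
  intro n p a ha
  have := hc (n + 1) (Fin.cons i p) (Fin.cons x a) (fun j => by
    refine Fin.cases ?_ (fun j => ?_) j
    · simpa using hx
    · simpa using ha j)
  rw [Fin.sum_univ_succ] at this
  simp only [Fin.cons_zero, Fin.cons_succ] at this
  rw [lc_apply]
  convert this using 2
  ring

lemma eps_cochain {m : ℤ} {c : Fam M} (hc : c ∈ cochains M m) (n : ℕ) (a : Fin n → F) :
    M.eps (c n a) = sg (m + n) • c n (fun j => F.eps (a j)) := by
  have : M.eps.compMultilinearMap (c n) = sg (m + n) • opT M c n := by
    refine multilinear_ext fun p a ha => ?_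
    have h1 : (fun j => F.eps (a j)) = fun j => (sg (p j) : K) • a j := by
      funext j; rw [F.eps_apply (ha j), Int.cast_smul_eq_zsmul]
    have h2 : ∀ s : Finset (Fin n), sg (∑ i ∈ s, (p i - 1)) = sg s.card * ∏ i ∈ s, sg (p i) := by
      intro s
      induction s using Finset.induction_on with
      | empty => simp
      | insert i s hi ih =>
        simp only [Finset.sum_insert hi, Finset.prod_insert hi, Finset.card_insert_of_notMem hi,
          sg_add, sg_sub, ih, Nat.cast_add, Nat.cast_one]
        ring
    have h3 := h2 Finset.univ
    simp only [Finset.card_univ, Fintype.card_fin] at h3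
    change M.eps (c n a) = sg (m + n) • opT M c n a
    rw [M.eps_apply (hc n p a ha), opT_apply, h1, MultilinearMap.map_smul_univ, sg_add, h3,
      ← Int.cast_prod, Int.cast_smul_eq_zsmul, smul_smul, sg_add]
    congr 1
    ring
  exact congrArg (fun e => e a) this

lemma opI_mem {m : ℤ} {c : Fam M} (hc : c ∈ cochains M m) : opI M m c ∈ cochains M (m + 1) := by
  intro n p a ha
  have := zsmul_mem (M.d_mem (hc n p a ha)) (sg m)
  rwa [add_assoc] at this

lemma opL_mem {m : ℤ} {c : Fam M} (hc : c ∈ cochains M m) : opL M m c ∈ cochains M (m + 1) := by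
  intro n p a ha
  cases n with
  | zero => simp [opL_zero]
  | succ n =>
    rw [opL_apply]
    have := M.lact_mem (F.sgn_mem m (ha 0)) (hc n (fun j => p j.succ) (Fin.tail a)
      (fun j => ha j.succ))
    convert this using 2
    rw [Fin.sum_univ_succ]; ring

lemma opR_mem {m : ℤ} {c : Fam M} (hc : c ∈ cochains M m) : opR M c ∈ cochains M (m + 1) := by
  intro n p a ha
  cases n with
  | zero => simp [opR_zero]
  | succ n =>
    rw [opR_apply]
    have := M.ract_mem (hc n (fun j => p j.castSucc) (fun j => F.eps (a j.castSucc))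
      (fun j => F.eps_mem (ha j.castSucc))) (ha (Fin.last n))
    refine zsmul_mem ?_ _
    convert this using 2
    rw [Fin.sum_univ_castSucc]; ring

lemma opP_mem {m : ℤ} {c : Fam M} (hc : c ∈ cochains M m) : opP M c ∈ cochains M (m + 1) := by
  intro n
  induction n generalizing m c with
  | zero => intro p a ha; simp [opP_zero]
  | succ n ih =>
    intro p a ha
    have h : opP M c (n + 1) a = lc M (a 0) (opP M c) n (Fin.tail a) := by simp [lc_apply]
    rw [h, lc_opP, fam_sub_apply, fam_sub_apply, Fin.sum_univ_succ]
    have ht : ∀ i, Fin.tail a i ∈ F.gr (p i.succ) := fun i => ha i.succ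
    refine sub_mem (sub_mem ?_ ?_) ?_
    · convert lc_mem (F.d_mem (ha 0)) hc n (fun i => p i.succ) (Fin.tail a) ht using 2
      ring
    · convert ih (lc_mem (F.eps_mem (ha 0)) hc) (fun i => p i.succ) (Fin.tail a) ht using 2
      ring
    · cases n with
      | zero => simp [mm_zero]
      | succ n =>
        have h' : mm M (F.eps (a 0)) c (n + 1) (Fin.tail a)
            = lc M (F.eps (a 0) * a 1) c n (Fin.tail (Fin.tail a)) := rfl
        rw [h']
        convert lc_mem (SetLike.mul_mem_graded (F.eps_mem (ha 0)) (ha 1)) hc n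
          (fun i => p i.succ.succ) (Fin.tail (Fin.tail a)) (fun i => ha i.succ.succ) using 2
        rw [Fin.sum_univ_succ, Fin.succ_zero_eq_one]
        ring

lemma delta_eq' (m : ℤ) (c : Fam M) : delta M m c = opI M m c + opP M c + opL M m c + opR M c := by
  rw [delta_eq]; simp only [opP, LinearMap.add_apply]; abel

lemma delta_mem {m : ℤ} {c : Fam M} (hc : c ∈ cochains M m) :
    delta M m c ∈ cochains M (m + 1) := by
  rw [delta_eq']
  exact add_mem (add_mem (add_mem (opI_mem hc) (opP_mem hc)) (opL_mem hc)) (opR_mem hc)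

lemma opD_opR (c : Fam M) (n : ℕ) (a : Fin (n + 1) → F) :
    opD M (opR M c) (n + 1) a =
      sg (n + 1) • M.ract (opD M (opT M c) n (Fin.init a)) (a (Fin.last n))
        - M.ract (c n (Fin.init a)) (F.d (a (Fin.last n))) := by
  rw [opD_apply, Fin.sum_univ_castSucc, opD_apply, map_sum, LinearMap.sum_apply, Finset.smul_sum,
    sub_eq_add_neg]
  congr 1
  · refine Finset.sum_congr rfl fun i _ => ?_
    rw [opR_apply, map_zsmul, LinearMap.smul_apply, smul_comm]
    simp only [opT_apply, Fin.val_castSucc, Fin.castSucc_lt_castSucc_iff, Fin.castSucc_inj]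
    simp [Fin.init, (Fin.castSucc_lt_last i).not_gt, (Fin.castSucc_lt_last i).ne']
  · rw [opR_apply]
    simp [Fin.castSucc_lt_last, smul_smul, sg_succ, sg_mul_self]
    rfl

lemma opB_opR (c : Fam M) (n : ℕ) (a : Fin (n + 2) → F) :
    opB M (opR M c) (n + 2) a =
      sg (n + 1) • M.ract (opB M (opT M c) (n + 1) (Fin.init a)) (a (Fin.last (n + 1)))
        + M.ract (c n (Fin.init (Fin.init a)))
            (F.eps (a (Fin.last n).castSucc) * a (Fin.last (n + 1))) := by
  rw [opB_apply, Fin.sum_univ_castSucc, opB_apply, map_sum, LinearMap.sum_apply, Finset.smul_sum]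
  congr 1
  · refine Finset.sum_congr rfl fun i _ => ?_
    rw [opR_apply, map_zsmul, LinearMap.smul_apply, smul_comm]
    simp only [opT_apply, Fin.val_castSucc]
    congr 3
    · congr 2
      funext j
      simp [contract, Fin.init]
    · simp [contract, (Fin.castSucc_lt_last i).not_gt, (Fin.castSucc_lt_last i).ne']
  · rw [opR_apply]
    simp only [Fin.val_last, smul_smul, sg_mul_self, one_smul]
    simp [contract, Fin.castSucc_lt_last]
    rfl

lemma right_identity {m : ℤ} {c : Fam M} (hc : c ∈ cochains M m) :
    opI M (m + 1) (opR M c) + opR M (opI M m c) + opP M (opR M c)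
      + opR M (opP M c) + opR M (opR M c) = 0 := by
  funext n; ext a
  cases n with
  | zero => simp [opI, opR_zero, opP_zero]
  | succ n =>
    have hI : opI M (m + 1) (opR M c) (n + 1) a + opR M (opI M m c) (n + 1) a
        = M.ract (c n (Fin.init a)) (F.d (a (Fin.last n))) := by
      have h1 : opI M (m + 1) (opR M c) (n + 1) a = sg (m + 1) • M.d (opR M c (n + 1) a) := rfl
      have h2 : opI M m c n (fun j => F.eps (a j.castSucc))
        = sg m • M.d (c n (fun j => F.eps (a j.castSucc))) := rfl
      rw [h1, opR_apply, opR_apply, h2, map_zsmul, M.d_ract, eps_cochain hc]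
      simp only [F.eps_eps, map_zsmul, LinearMap.smul_apply, smul_add, smul_smul]
      have h3 : sg (m + 1) * (sg (n + 1) * sg (m + n)) = 1 := by
        have := sg_mul_self m
        have := sg_mul_self n
        simp only [sg_add, sg_one]
        linear_combination (sg m * sg m) * sg_mul_self n + sg_mul_self m
      have h4 : sg (n + 1) * sg m = - (sg (m + 1) * sg (n + 1)) := by
        simp only [sg_add, sg_one]; ring
      rw [h3, h4, neg_smul, one_smul]
      have hi : Fin.init a = fun j => a j.castSucc := rfl
      rw [hi]
      abel
    have hD : opD M (opR M c) (n + 1) a + opR M (opD M c) (n + 1) a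
        = - M.ract (c n (Fin.init a)) (F.d (a (Fin.last n))) := by
      rw [opD_opR, opD_opT, opR_apply]
      simp only [fam_neg_apply, opT_apply, map_neg, LinearMap.neg_apply, smul_neg, Fin.init]
      abel
    have hB : opB M (opR M c) (n + 1) a + opR M (opB M c) (n + 1) a
        + opR M (opR M c) (n + 1) a = 0 := by
      cases n with
      | zero => rw [opB_apply, opR_apply, opR_apply]; simp [opB_zero, opR_zero]
      | succ n =>
        rw [opB_opR, opB_opT, opR_apply, opR_apply, opR_apply]
        simp only [F.eps_eps, map_zsmul, LinearMap.smul_apply, smul_smul, Nat.cast_add,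
          Nat.cast_one, sg_succ (n + 1), neg_smul, neg_mul, sg_mul_self, one_smul, opT_apply,
          M.ract_mul]
        have hi : Fin.init (Fin.init a) = fun j => a j.castSucc.castSucc := rfl
        have hi' : Fin.init a = fun j => a j.castSucc := rfl
        rw [hi, hi']
        abel
    have e : opP M = opD M + opB M := rfl
    rw [e]
    simp only [LinearMap.add_apply, fam_add_apply, map_add]
    rw [Pi.zero_apply, zero_apply]
    have hs := congrArg₂ (· + ·) (congrArg₂ (· + ·) hI hD) hB
    simp only [add_neg_cancel, add_zero] at hs
    rw [← hs]
    abel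

lemma delta_delta {m : ℤ} {c : Fam M} (hc : c ∈ cochains M m) :
    delta M (m + 1) (delta M m c) = 0 := by
  have h1 := opI_opI M m c
  have h2 := opI_opP M m c
  have h3 := opP_opP M c
  have h4 := left_identity M m c
  have h5 := opL_opR M m c
  have h6 := right_identity hc
  have h7 : opI M (m + 1) (opI M m c) + (opI M (m + 1) (opP M c) + opP M (opI M m c))
    + opP M (opP M c) + (opI M (m + 1) (opL M m c) + opL M (m + 1) (opI M m c) + opP M (opL M m c)
      + opL M (m + 1) (opP M c) + opL M (m + 1) (opL M m c))
    + (opL M (m + 1) (opR M c) + opR M (opL M m c))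
    + (opI M (m + 1) (opR M c) + opR M (opI M m c) + opP M (opR M c)
      + opR M (opP M c) + opR M (opR M c)) = 0 := by
    rw [h1, h2, h3, h4, h5, h6]; simp
  rw [← h7]
  simp only [delta_eq', map_add]
  abel

/-! ### The Hochschild cochain complex and its functoriality -/

variable (M)

/-- The Hochschild differential on cochains of degree `m`. -/
def cochainsD (m : ℤ) : cochains M m →ₗ[K] cochains M (m + 1) :=
  (delta M m).restrict fun _ h => delta_mem h

/-- The Hochschild cochain complex `C^•(F, M)`. -/
def hochschildComplex : CochainComplex (ModuleCat.{v} K) ℤ :=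
  CochainComplex.of (fun m => ModuleCat.of K (cochains M m))
    (fun m => ModuleCat.ofHom (cochainsD M m))
    (fun _ => ModuleCat.hom_ext (LinearMap.ext fun c => Subtype.ext (delta_delta c.2)))

variable {M}

/-- Composition of families of multilinear maps with a bimodule homomorphism `M → N`. -/
def coeffFam {N : DGBimodule F} (f : M.Hom N) : Fam M →ₗ[K] Fam N where
  toFun c n := f.toLinearMap.compMultilinearMap (c n)
  map_add' c c' := by funext n; ext a; simp
  map_smul' r c := by funext n; ext a; simp

lemma coeffFam_apply {N : DGBimodule F} (f : M.Hom N) (c : Fam M) (n : ℕ) (a : Fin n → F) :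
    coeffFam f c n a = f.toLinearMap (c n a) := rfl

lemma coeffFam_mem {N : DGBimodule F} (f : M.Hom N) {m : ℤ} {c : Fam M}
    (hc : c ∈ cochains M m) : coeffFam f c ∈ cochains N m := fun n p a ha => f.map_mem (hc n p a ha)

lemma coeffFam_delta {N : DGBimodule F} (f : M.Hom N) (m : ℤ) (c : Fam M) :
    delta N m (coeffFam f c) = coeffFam f (delta M m c) := by
  funext n; ext a
  rw [coeffFam_apply, delta_eq', delta_eq']
  have hI : ∀ n (a : Fin n → F), opI N m (coeffFam f c) n a = f.toLinearMap (opI M m c n a) := by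
    intro n a
    simp only [opI_eq]
    change sg m • N.d (f.toLinearMap (c n a)) = f.toLinearMap (sg m • M.d (c n a))
    rw [map_zsmul, f.map_d]
  cases n with
  | zero => simp only [fam_add_apply, hI, opP_zero, opL_zero, opR_zero, map_add]; simp
  | succ n =>
    simp only [fam_add_apply, hI, map_add, opP, LinearMap.add_apply, opD_apply, opB_apply,
      opL_apply, opR_apply, coeffFam_apply, map_sum, map_zsmul, f.map_lact, f.map_ract]

/-- The chain map `C^•(F, M) → C^•(F, N)` induced by a homomorphism `M → N` of bimodules. -/
def coeffMap {N : DGBimodule F} (f : M.Hom N) : hochschildComplex M ⟶ hochschildComplex N :=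
  CochainComplex.ofHom
    (fun m => ModuleCat.ofHom ((coeffFam f).restrict (p := cochains M m) (q := cochains N m)
      fun _ h => coeffFam_mem f h))
    (fun m => by
      simp only [hochschildComplex, CochainComplex.of_d]
      exact ModuleCat.hom_ext (LinearMap.ext fun c => Subtype.ext (coeffFam_delta f m c)))

/-- Composition of families of multilinear maps on `G` with a homomorphism `F → G` in each
argument. -/
def restrictFam {G : DGAlgebra.{u, v} K} (φ : F.Hom G) (N : DGBimodule G) :
    Fam N →ₗ[K] Fam (DGBimodule.restrict φ N) where
  toFun c n := (c n).compLinearMap fun _ => φ.toAlgHom.toLinearMap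
  map_add' c c' := by funext n; ext a; simp
  map_smul' r c := by funext n; ext a; simp

lemma restrictFam_apply {G : DGAlgebra.{u, v} K} (φ : F.Hom G) (N : DGBimodule G) (c : Fam N)
    (n : ℕ) (a : Fin n → F) :
    restrictFam φ N c n a = c n (fun i => φ.toAlgHom (a i)) := rfl

lemma restrictFam_mem {G : DGAlgebra.{u, v} K} (φ : F.Hom G) (N : DGBimodule G) {m : ℤ}
    {c : Fam N} (hc : c ∈ cochains N m) :
    restrictFam φ N c ∈ cochains (DGBimodule.restrict φ N) m :=
  fun n p _ ha => hc n p _ fun i => φ.map_mem (ha i)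

lemma restrictFam_delta {G : DGAlgebra.{u, v} K} (φ : F.Hom G) (N : DGBimodule G) (m : ℤ)
    (c : Fam N) : delta (DGBimodule.restrict φ N) m (restrictFam φ N c)
      = restrictFam φ N (delta N m c) := by
  have he : ∀ a : F, φ.toAlgHom (F.eps a) = G.eps (φ.toAlgHom a) := φ.map_sgn 1
  funext n; ext a
  rw [restrictFam_apply, delta_eq', delta_eq']
  have hI : ∀ n (a : Fin n → F), opI (DGBimodule.restrict φ N) m (restrictFam φ N c) n a
      = opI N m c n (fun i => φ.toAlgHom (a i)) := fun n a => rfl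
  have hD : ∀ n (a : Fin n → F), opD (DGBimodule.restrict φ N) (restrictFam φ N c) n a
      = opD N c n (fun i => φ.toAlgHom (a i)) := by
    intro n a
    simp only [opD_apply]
    refine Finset.sum_congr rfl fun i _ => congrArg (fun y : N => sg i • y) ?_
    refine congrArg (c n) (funext fun j => ?_)
    dsimp only
    split_ifs <;> simp [he, φ.map_d]
  cases n with
  | zero =>
    simp only [fam_add_apply, hI, hD, opP, LinearMap.add_apply, opB_zero, opL_zero, opR_zero]
    rfl
  | succ n =>
    have hB : opB (DGBimodule.restrict φ N) (restrictFam φ N c) (n + 1) a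
        = opB N c (n + 1) (fun i => φ.toAlgHom (a i)) := by
      simp only [opB_apply]
      refine Finset.sum_congr rfl fun i _ => congrArg (fun y : N => sg (i + 1) • y) ?_
      refine congrArg (c n) (funext fun j => ?_)
      simp only [contract]
      split_ifs <;> simp [he]
    have hL : opL (DGBimodule.restrict φ N) m (restrictFam φ N c) (n + 1) a
        = opL N m c (n + 1) (fun i => φ.toAlgHom (a i)) := by
      rw [opL_apply, opL_apply, ← φ.map_sgn]
      rfl
    have hR : opR (DGBimodule.restrict φ N) (restrictFam φ N c) (n + 1) a
        = opR N c (n + 1) (fun i => φ.toAlgHom (a i)) := by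
      rw [opR_apply, opR_apply]
      simp only [← he]
      rfl
    simp only [fam_add_apply, hI, hD, opP, LinearMap.add_apply, hB, hL, hR]

/-- The chain map `C^•(G, N) → C^•(F, N)` induced by a homomorphism `F → G`. -/
def restrictMap {G : DGAlgebra.{u, v} K} (φ : F.Hom G) (N : DGBimodule G) :
    hochschildComplex N ⟶ hochschildComplex (DGBimodule.restrict φ N) :=
  CochainComplex.ofHom
    (fun m => ModuleCat.ofHom ((restrictFam φ N).restrict (p := cochains N m)
      (q := cochains (DGBimodule.restrict φ N) m) fun _ h => restrictFam_mem φ N h))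
    (fun m => by
      simp only [hochschildComplex, CochainComplex.of_d]
      exact ModuleCat.hom_ext (LinearMap.ext fun c => Subtype.ext (restrictFam_delta φ N m c)))

/-! ### The Hodge decomposition -/

/-- The number of descents `σ(i) > σ(i + 1)` of a permutation. -/
def descents {n : ℕ} (σ : Equiv.Perm (Fin n)) : ℕ :=
  (Finset.univ.filter fun i : Fin n => ∃ h : (i : ℕ) + 1 < n, σ ⟨i + 1, h⟩ < σ i).card

variable (K) in
/-- The coefficient of `x ^ k` in `(1 / n!) (x - d) (x - d + 1) ⋯ (x - d + n - 1)`. The Eulerian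
idempotent `e_n(k)` is the sum over all permutations `σ` of `sgn(σ) σ` with this coefficient, where
`d` is the number of descents of `σ`. -/
def eulerianCoeff (n k d : ℕ) : K :=
  (Polynomial.C (n.factorial : K)⁻¹ * ∏ j ∈ Finset.range n,
    (Polynomial.X - Polynomial.C (d : K) + Polynomial.C (j : K))).coeff k

/-- The Koszul sign of the permutation `σ` of `n` elements of `F` of degrees `p_i`, regarded as
elements of `F[1]` of degrees `p_i - 1`: the product of `(-1)^{(p_i - 1) (p_j - 1)}` over all
inversions `i < j`, `σ(i) > σ(j)`. It is `sgn(σ)` if all `p_i` are `0`. -/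
def koszulSign {n : ℕ} (σ : Equiv.Perm (Fin n)) (p : Fin n → ℤ) : ℤ :=
  ∏ ij : Fin n × Fin n with ij.1 < ij.2 ∧ σ ij.2 < σ ij.1, sg ((p ij.1 - 1) * (p ij.2 - 1))

variable (M)

/-- The `k`-th Hodge component of the space of Hochschild cochains of degree `m`: the cochains `c`
with `c_n ∘ e_n(k) = c_n` for all `n`. The Eulerian idempotent `e_n(k)` acts on `F[1]^{⊗ n}` through
the graded action of the symmetric group, where `σ` moves the `i`-th factor to the place `σ(i)`,
with the Koszul sign. -/
def hodge (k : ℕ) (m : ℤ) : Submodule K (Fam M) where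
  carrier := {c | c ∈ cochains M m ∧
    ∀ (n : ℕ) (p : Fin n → ℤ) (a : Fin n → F), (∀ i, a i ∈ F.gr (p i)) →
      ∑ σ : Equiv.Perm (Fin n), eulerianCoeff K n k (descents σ) •
        koszulSign σ p • c n (fun j => a (σ.symm j)) = c n a}
  add_mem' := by
    rintro c c' ⟨h1, h2⟩ ⟨h1', h2'⟩
    refine ⟨add_mem h1 h1', fun n p a ha => ?_⟩
    simp only [fam_add_apply, smul_add, Finset.sum_add_distrib, h2 n p a ha, h2' n p a ha]
  zero_mem' := ⟨zero_mem _, fun n p a _ => by simp⟩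
  smul_mem' := by
    rintro r c ⟨h1, h2⟩
    refine ⟨Submodule.smul_mem _ r h1, fun n p a ha => ?_⟩
    have e : ∀ b, (r • c) n b = r • c n b := fun _ => rfl
    simp only [e, smul_comm _ r, ← Finset.smul_sum, h2 n p a ha]

/-- The Hodge components form a decomposition of the Hochschild complex: each of them is a
subcomplex, and every cochain `c` is in a unique way a sum of components (`C^• = ∏_k C^•_{(k)}`;
only the components with `k ≤ n` contribute to `c_n`). -/
def HasHodgeDecomposition : Prop :=
  (∀ (k : ℕ) (m : ℤ) (c : Fam M), c ∈ hodge M k m → delta M m c ∈ hodge M k (m + 1)) ∧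
  ∀ (m : ℤ) (c : Fam M), c ∈ cochains M m →
    ∃! f : ℕ → Fam M, (∀ k, f k ∈ hodge M k m) ∧
      ∀ n, ∑ k ∈ Finset.range (n + 1), f k n = c n

variable {M}

/-- The `k`-th Hodge component of the Hochschild complex, as a complex (for `k = 1`, the Harrison
complex). -/
def hodgeComplex (h : HasHodgeDecomposition M) (k : ℕ) : CochainComplex (ModuleCat.{v} K) ℤ :=
  CochainComplex.of (fun m => ModuleCat.of K (hodge M k m))
    (fun m => ModuleCat.ofHom ((delta M m).restrict (p := hodge M k m) (q := hodge M k (m + 1))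
      fun c hc => h.1 k m c hc))
    (fun _ => ModuleCat.hom_ext (LinearMap.ext fun c => Subtype.ext (delta_delta c.2.1)))

lemma coeffFam_hodge {N : DGBimodule F} (f : M.Hom N) {k : ℕ} {m : ℤ} {c : Fam M}
    (hc : c ∈ hodge M k m) : coeffFam f c ∈ hodge N k m := by
  refine ⟨coeffFam_mem f hc.1, fun n p a ha => ?_⟩
  simp only [coeffFam_apply, ← hc.2 n p a ha, map_sum, map_smul, map_zsmul]

lemma restrictFam_hodge {G : DGAlgebra.{u, v} K} (φ : F.Hom G) (N : DGBimodule G) {k : ℕ}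
    {m : ℤ} {c : Fam N} (hc : c ∈ hodge N k m) :
    restrictFam φ N c ∈ hodge (DGBimodule.restrict φ N) k m :=
  ⟨restrictFam_mem φ N hc.1, fun n p a ha =>
    hc.2 n p (fun i => φ.toAlgHom (a i)) fun i => φ.map_mem (ha i)⟩

/-- The restriction of `coeffMap f` to the `k`-th Hodge components. -/
def hodgeCoeffMap {N : DGBimodule F} (f : M.Hom N) (hM : HasHodgeDecomposition M)
    (hN : HasHodgeDecomposition N) (k : ℕ) : hodgeComplex hM k ⟶ hodgeComplex hN k :=
  CochainComplex.ofHom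
    (fun m => ModuleCat.ofHom ((coeffFam f).restrict (p := hodge M k m) (q := hodge N k m)
      fun _ h => coeffFam_hodge f h))
    (fun m => by
      simp only [hodgeComplex, CochainComplex.of_d]
      exact ModuleCat.hom_ext (LinearMap.ext fun c => Subtype.ext (coeffFam_delta f m c)))

/-- The restriction of `restrictMap φ N` to the `k`-th Hodge components. -/
def hodgeRestrictMap {G : DGAlgebra.{u, v} K} (φ : F.Hom G) (N : DGBimodule G)
    (hN : HasHodgeDecomposition N) (hN' : HasHodgeDecomposition (DGBimodule.restrict φ N))
    (k : ℕ) : hodgeComplex hN k ⟶ hodgeComplex hN' k :=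
  CochainComplex.ofHom
    (fun m => ModuleCat.ofHom ((restrictFam φ N).restrict (p := hodge N k m)
      (q := hodge (DGBimodule.restrict φ N) k m) fun _ h => restrictFam_hodge φ N h))
    (fun m => by
      simp only [hodgeComplex, CochainComplex.of_d]
      exact ModuleCat.hom_ext (LinearMap.ext fun c => Subtype.ext (restrictFam_delta φ N m c)))

end Cochains

end DGHochschild

end

/-! Part (1). Filter the Hochschild complex by the number n of arguments. The terms of the
differential that involve products raise n by one, while those that come from the differentials of
the algebra and of the module preserve n. The filtration is complete because a cochain is an
arbitrary sequence of components, so cone cocycles can be made exact column by column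
(`exists_preimage_of_approximation`, `cone_exact_of_columns`) and only the internal differentials
matter. In a column no products are left. Over a field the mapping cone of φ is contractible, hence
φ has a homotopy inverse as a map of complexes (`Hom.IsQuasiIso.nonempty_homotopyInverse`); the
inverse need not be multiplicative, but for the columns it does not have to be. Composing it in the
values, or in all arguments at once with the tensor-power homotopy `opH`, makes each column a
homotopy equivalence.

Part (2). For a set of N labels let ψ^N be the sum, over all labellings of the n places, of the
signed permutation that sorts the labels. Counting labellings by the descents of the sorting
permutation gives ψ^N = ∑ N^k e_n(k) (`adams_eq_sum_eulerian`). Lexicographic sorting gives ψ^N ψ^N'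
= ψ^(NN') (`adams_mul`), and comparing coefficients in N and N' shows that the e_n(k) are orthogonal
idempotents with sum 1 (`eulerian_mul`, `sum_eulerian`). In characteristic 0 the image of e_n(k) is
therefore the 2^k-eigenspace of ψ², with an eigenvalue that does not depend on n.

It remains to see that ψ² commutes with the differential (`delta_adamsFam`). On words in F[1], ψ² is
deconcatenation followed by the shuffle product. The bar differential is a coderivation for the
first and, for a supercommutative algebra, a derivation for the second (`bar_cut`, `shuffle_bar`).
In the outer terms, which use a symmetric bimodule, the contributions at the cut cancel
(`right_cut`, `total_psi`). The two chain maps commute with the Hodge projections, so projecting the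
solutions found in part (1) proves exactness of the cones of the Hodge components
(`cone_exact_hodge`). -/

noncomputable section

namespace DGHochschild

/-! ### Quasi-isomorphisms as exactness of the mapping cone, elementwise -/

section QuasiIso

variable {R : Type u} [Ring R] {A B : CochainComplex (ModuleCat.{v} R) ℤ}

/-- The elementwise form of the exactness of the mapping cone of `f`. -/
def ConeExact (f : A ⟶ B) : Prop :=
  ∀ (i : ℤ) (a : A.X (i + 1 + 1)) (b : B.X (i + 1)), A.d (i + 1 + 1) (i + 1 + 1 + 1) a = 0 →
    f.f (i + 1 + 1) a = B.d (i + 1) (i + 1 + 1) b →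
    ∃ (a' : A.X (i + 1)) (b' : B.X i), A.d (i + 1) (i + 1 + 1) a' = a ∧
      f.f (i + 1) a' - b = B.d i (i + 1) b'

lemma ConeExact.mono_homologyMap {f : A ⟶ B} (h : ConeExact f) (i : ℤ) :
    Mono (HomologicalComplex.homologyMap f (i + 1 + 1)) := by
  rw [HomologicalComplex.mono_homologyMap_iff_up_to_refinements f (i + 1) (i + 1 + 1) (i + 1 + 1 + 1)
    (by simp) (by simp)]
  intro T x hx y hxy
  -- The module of all primitives over T. It is a refinement of T because cone exactness makes its
  -- projection to T surjective, so no linear choice of primitives is needed.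
  let S : Submodule R (T × A.X (i + 1)) :=
    LinearMap.eqLocus (x.hom ∘ₗ LinearMap.fst R _ _)
      ((A.d (i + 1) (i + 1 + 1)).hom ∘ₗ LinearMap.snd R _ _)
  refine ⟨ModuleCat.of R S, ModuleCat.ofHom (LinearMap.fst R _ _ ∘ₗ S.subtype), ?_,
    ModuleCat.ofHom (LinearMap.snd R _ _ ∘ₗ S.subtype), ?_⟩
  · rw [ModuleCat.epi_iff_surjective]
    intro t
    obtain ⟨a', _, ha', _⟩ := h i (x t) (y t) (congr($hx t)) (congr($hxy t))
    exact ⟨⟨(t, a'), ha'.symm⟩, rfl⟩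
  · ext s
    exact s.2

/-- Cone exactness for the pair (0, y) yields a cocycle a' with f a' - y a coboundary, that is, a
preimage of the class of y. -/
lemma ConeExact.epi_homologyMap {f : A ⟶ B} (h : ConeExact f) (i : ℤ) :
    Epi (HomologicalComplex.homologyMap f (i + 1)) := by
  rw [HomologicalComplex.epi_homologyMap_iff_up_to_refinements f i (i + 1) (i + 1 + 1)
    (by simp) (by simp)]
  intro T y hy
  let S : Submodule R (T × A.X (i + 1) × B.X i) :=
    LinearMap.eqLocus (y.hom ∘ₗ LinearMap.fst R _ _)
      ((f.f (i + 1)).hom ∘ₗ LinearMap.fst R _ _ ∘ₗ LinearMap.snd R _ _ +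
        (B.d i (i + 1)).hom ∘ₗ LinearMap.snd R _ _ ∘ₗ LinearMap.snd R _ _) ⊓
    LinearMap.ker ((A.d (i + 1) (i + 1 + 1)).hom ∘ₗ LinearMap.fst R _ _ ∘ₗ LinearMap.snd R _ _)
  refine ⟨ModuleCat.of R S, ModuleCat.ofHom (LinearMap.fst R _ _ ∘ₗ S.subtype), ?_,
    ModuleCat.ofHom (LinearMap.fst R _ _ ∘ₗ LinearMap.snd R _ _ ∘ₗ S.subtype), ?_,
    ModuleCat.ofHom (LinearMap.snd R _ _ ∘ₗ LinearMap.snd R _ _ ∘ₗ S.subtype), ?_⟩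
  · rw [ModuleCat.epi_iff_surjective]
    intro t
    obtain ⟨a', b', ha', hb'⟩ := h i 0 (y t) (map_zero _) (by
      rw [map_zero]; exact (congr($hy t)).symm)
    refine ⟨⟨(t, a', -b'), ?_, ha'⟩, rfl⟩
    change y t = f.f (i + 1) a' + B.d i (i + 1) (-b')
    rw [map_neg, ← hb']
    abel
  · ext s
    exact s.2.2
  · ext s
    exact s.2.1

lemma ConeExact.quasiIso {f : A ⟶ B} (h : ConeExact f) : QuasiIso f := by
  refine ⟨fun i => ?_⟩
  rw [quasiIsoAt_iff_isIso_homologyMap]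
  obtain ⟨i, rfl⟩ : ∃ j, i = j + 1 + 1 := ⟨i - 1 - 1, by simp⟩
  have h1 := h.mono_homologyMap i
  have h2 := h.epi_homologyMap (i + 1)
  exact isIso_of_mono_of_epi _

/-- Injectivity on cohomology gives x with d x = a. Then f x - b is a cocycle, and surjectivity one
degree lower provides a cocycle z whose image represents its class; x - z is the required element.
Both properties are applied to universal test modules, of all cone cocycles and of all cocycles, and
then evaluated at a lift of the given element. -/
lemma coneExact_of_quasiIso (f : A ⟶ B) [QuasiIso f] : ConeExact f := by
  intro i a b ha hab
  have hm : Mono (HomologicalComplex.homologyMap f (i + 1 + 1)) := inferInstance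
  have he : Epi (HomologicalComplex.homologyMap f (i + 1)) := inferInstance
  rw [HomologicalComplex.mono_homologyMap_iff_up_to_refinements f (i + 1) (i + 1 + 1) (i + 1 + 1 + 1)
    (by simp) (by simp)] at hm
  rw [HomologicalComplex.epi_homologyMap_iff_up_to_refinements f i (i + 1) (i + 1 + 1)
    (by simp) (by simp)] at he
  let S : Submodule R (A.X (i + 1 + 1) × B.X (i + 1)) :=
    LinearMap.eqLocus ((f.f (i + 1 + 1)).hom ∘ₗ LinearMap.fst R _ _)
      ((B.d (i + 1) (i + 1 + 1)).hom ∘ₗ LinearMap.snd R _ _) ⊓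
    LinearMap.ker ((A.d (i + 1 + 1) (i + 1 + 1 + 1)).hom ∘ₗ LinearMap.fst R _ _)
  obtain ⟨T, π, hπ, x, hx⟩ := hm (A := ModuleCat.of R S)
    (ModuleCat.ofHom (LinearMap.fst R _ _ ∘ₗ S.subtype)) (by ext s; exact s.2.2)
    (ModuleCat.ofHom (LinearMap.snd R _ _ ∘ₗ S.subtype)) (by ext s; exact s.2.1)
  rw [ModuleCat.epi_iff_surjective] at hπ
  obtain ⟨t, ht⟩ := hπ ⟨(a, b), hab, ha⟩
  have h1 : A.d (i + 1) (i + 1 + 1) (x t) = a := by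
    have := congr($hx t)
    refine this.symm.trans ?_
    change (π t).1.1 = a
    rw [ht]
  obtain ⟨T', π', hπ', z, hz, w, hw⟩ := he
    (A := ModuleCat.of R (LinearMap.ker (B.d (i + 1) (i + 1 + 1)).hom))
    (ModuleCat.ofHom (Submodule.subtype _)) (by ext s; exact s.2)
  rw [ModuleCat.epi_iff_surjective] at hπ'
  obtain ⟨t', ht'⟩ := hπ' ⟨f.f (i + 1) (x t) - b, by
    rw [LinearMap.mem_ker, map_sub, sub_eq_zero]
    refine Eq.trans ?_ hab
    rw [← h1]
    exact congr($(f.comm (i + 1) (i + 1 + 1)) (x t))⟩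
  have h2 : f.f (i + 1) (x t) - b = f.f (i + 1) (z t') + B.d i (i + 1) (w t') := by
    have := congr($hw t')
    refine Eq.trans ?_ this
    change _ = (π' t').1
    rw [ht']
  refine ⟨x t - z t', w t', ?_, ?_⟩
  · rw [map_sub, h1]
    have : A.d (i + 1) (i + 1 + 1) (z t') = 0 := congr($hz t')
    rw [this, sub_zero]
  · rw [map_sub, sub_right_comm, h2]
    abel

end QuasiIso

section Graded

variable {K : Type u} [Field K] {V W : Type v} [AddCommGroup V] [Module K V] [AddCommGroup W]
  [Module K W]

/-- The morphism given by `g` between complexes of submodules `S`, `T` of fixed spaces `V`, `W`. -/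
lemma quasiIso_ofHom_restrict_iff (S : ℤ → Submodule K V) (T : ℤ → Submodule K W)
    (dS : ℤ → V →ₗ[K] V) (dT : ℤ → W →ₗ[K] W) (g : V →ₗ[K] W)
    (hS : ∀ i, ∀ x ∈ S i, dS i x ∈ S (i + 1)) (hT : ∀ i, ∀ x ∈ T i, dT i x ∈ T (i + 1))
    (hg : ∀ i, ∀ x ∈ S i, g x ∈ T i) (hSS hTT)
    (f : CochainComplex.of (fun i => ModuleCat.of K (S i))
        (fun i => ModuleCat.ofHom ((dS i).restrict (hS i))) hSS ⟶
      CochainComplex.of (fun i => ModuleCat.of K (T i))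
        (fun i => ModuleCat.ofHom ((dT i).restrict (hT i))) hTT)
    (hf : ∀ i, f.f i = ModuleCat.ofHom (g.restrict (hg i))) :
    QuasiIso f ↔ ∀ i, ∀ a ∈ S (i + 1 + 1), ∀ b ∈ T (i + 1), dS (i + 1 + 1) a = 0 → g a = dT (i + 1) b →
      ∃ a' ∈ S (i + 1), ∃ b' ∈ T i, dS (i + 1) a' = a ∧ g a' - b = dT i b' := by
  -- The differential of `CochainComplex.of` equals the given one only through
  -- `CochainComplex.of_d`; it is put in elementwise form once and for all.
  have eS : ∀ i (x : S i), (((CochainComplex.of (fun i => ModuleCat.of K (S i))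
      (fun i => ModuleCat.ofHom ((dS i).restrict (hS i))) hSS).d i (i + 1)).hom x : S (i + 1)) =
      ⟨dS i x, hS i x x.2⟩ :=
    fun i x => congr(ModuleCat.Hom.hom $(CochainComplex.of_d (fun i => ModuleCat.of K (S i))
      (fun i => ModuleCat.ofHom ((dS i).restrict (hS i))) i) x)
  have eT : ∀ i (x : T i), (((CochainComplex.of (fun i => ModuleCat.of K (T i))
      (fun i => ModuleCat.ofHom ((dT i).restrict (hT i))) hTT).d i (i + 1)).hom x : T (i + 1)) =
      ⟨dT i x, hT i x x.2⟩ :=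
    fun i x => congr(ModuleCat.Hom.hom $(CochainComplex.of_d (fun i => ModuleCat.of K (T i))
      (fun i => ModuleCat.ofHom ((dT i).restrict (hT i))) i) x)
  have ef : ∀ i (x : S i), ((f.f i).hom x : T i) = ⟨g x, hg i x x.2⟩ := fun i x => by
    rw [hf]; rfl
  have key : ConeExact f ↔ ∀ i, ∀ a ∈ S (i + 1 + 1), ∀ b ∈ T (i + 1), dS (i + 1 + 1) a = 0 →
      g a = dT (i + 1) b → ∃ a' ∈ S (i + 1), ∃ b' ∈ T i, dS (i + 1) a' = a ∧
        g a' - b = dT i b' := by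
    constructor
    · intro h i a ha b hb h1 h2
      obtain ⟨a', b', h3, h4⟩ := h i (⟨a, ha⟩ : S (i + 1 + 1)) (⟨b, hb⟩ : T (i + 1))
        ((eS _ _).trans (Subtype.ext h1))
        ((ef _ _).trans ((Subtype.ext h2).trans (eT _ _).symm))
      refine ⟨(a' : S (i + 1)).1, (a' : S (i + 1)).2, (b' : T i).1, (b' : T i).2, ?_, ?_⟩
      · exact congrArg Subtype.val ((eS _ _).symm.trans h3)
      · have h5 := h4.trans (eT _ _)
        erw [ef] at h5
        exact congrArg Subtype.val h5
    · intro h i a b h1 h2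
      have h1' := congrArg Subtype.val ((eS _ a).symm.trans h1)
      have h2' := congrArg Subtype.val ((ef _ a).symm.trans (h2.trans (eT _ b)))
      obtain ⟨a', ha', b', hb', h3, h4⟩ := h i (a : S (i + 1 + 1)).1 (a : S (i + 1 + 1)).2
        (b : T (i + 1)).1 (b : T (i + 1)).2 h1' h2'
      refine ⟨(⟨a', ha'⟩ : S (i + 1)), (⟨b', hb'⟩ : T i), ?_, ?_⟩
      · exact (eS _ _).trans (Subtype.ext h3)
      · refine Eq.trans ?_ (eT _ _).symm
        erw [ef]
        exact Subtype.ext h4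
  rw [← key]
  exact ⟨fun _ => coneExact_of_quasiIso f, fun h => h.quasiIso⟩

end Graded

end DGHochschild

end

/-! ### Contractions of exact complexes and homotopy inverses of quasi-isomorphisms -/

noncomputable section

namespace DGHochschild

section Contraction

variable {K : Type u} [Field K] {V : Type v} [AddCommGroup V] [Module K V]

/-- An exact complex of vector spaces is contractible. -/
lemma exists_contraction (C : ℤ → Submodule K V) (D : V →ₗ[K] V)
    (hD : ∀ i, ∀ x ∈ C i, D x ∈ C (i + 1)) (hDD : ∀ x, D (D x) = 0)
    (hex : ∀ i, ∀ x ∈ C (i + 1), D x = 0 → ∃ y ∈ C i, D y = x) :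
    ∃ h : ℤ → V →ₗ[K] V, (∀ i, ∀ x ∈ C i, h i x ∈ C (i - 1)) ∧
      ∀ i, ∀ x ∈ C i, D (h i x) + h (i + 1) (D x) = x := by
  -- By exactness D maps onto the cocycles, and over a field this surjection splits. The section is
  -- extended to all of V arbitrarily; only its values on cocycles in `C i` are used.
  have hS : ∀ i, ∃ S : V →ₗ[K] V, ∀ x ∈ C i, D x = 0 → S x ∈ C (i - 1) ∧ D (S x) = x := by
    intro i
    obtain ⟨i, rfl⟩ : ∃ j, i = j + 1 := ⟨i - 1, by simp⟩
    let Z : Submodule K V := C (i + 1) ⊓ LinearMap.ker D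
    let g : C i →ₗ[K] Z := D.restrict fun x hx => ⟨hD i x hx, hDD x⟩
    have hg : Function.Surjective g := by
      rintro ⟨x, hx, hx'⟩
      obtain ⟨y, hy, hyx⟩ := hex i x hx hx'
      exact ⟨⟨y, hy⟩, Subtype.ext hyx⟩
    obtain ⟨r, hr⟩ := g.exists_rightInverse_of_surjective (LinearMap.range_eq_top.2 hg)
    obtain ⟨S, hS⟩ := LinearMap.exists_extend ((C i).subtype ∘ₗ r)
    refine ⟨S, fun x hx hx' => ?_⟩
    have h1 : S x = r ⟨x, hx, hx'⟩ := congr($hS ⟨x, hx, hx'⟩)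
    rw [h1, add_sub_cancel_right]
    exact ⟨(r _).2, congrArg Subtype.val (congr($hr ⟨x, hx, hx'⟩))⟩
  choose S hS using hS
  have h0 : ∀ i, ∀ x ∈ C i, x - S (i + 1) (D x) ∈ C i ∧ D (x - S (i + 1) (D x)) = 0 := by
    intro i x hx
    have := hS (i + 1) (D x) (hD i x hx) (hDD x)
    rw [add_sub_cancel_right] at this
    exact ⟨sub_mem hx this.1, by rw [map_sub, this.2, sub_self]⟩
  -- With h = S (1 - S D), the element x - S D x is a cocycle, so D h x = x - S D x; and h D x = S D
  -- x because D D = 0.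
  refine ⟨fun i => S i ∘ₗ (LinearMap.id - S (i + 1) ∘ₗ D), fun i x hx => ?_, fun i x hx => ?_⟩
  · exact (hS i _ (h0 i x hx).1 (h0 i x hx).2).1
  · have := (hS i _ (h0 i x hx).1 (h0 i x hx).2).2
    simp only [LinearMap.comp_apply, LinearMap.sub_apply, LinearMap.id_apply, hDD, map_zero,
      sub_zero]
    rw [this, sub_add_cancel]

variable {W : Type*} [AddCommGroup W] [Module K W]
  (𝒱 : ℤ → Submodule K V) [DirectSum.Decomposition 𝒱]

/-- The linear map that is given by `f i` on the homogeneous elements of degree `i`. -/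
def piecewiseLinear (f : ℤ → V →ₗ[K] W) : V →ₗ[K] W :=
  (DirectSum.toModule K ℤ W fun i => f i ∘ₗ (𝒱 i).subtype) ∘ₗ
    (DirectSum.decomposeLinearEquiv 𝒱).toLinearMap

lemma piecewiseLinear_apply (f : ℤ → V →ₗ[K] W) {i : ℤ} {a : V} (ha : a ∈ 𝒱 i) :
    piecewiseLinear 𝒱 f a = f i a := by
  have := DirectSum.decomposeLinearEquiv_apply_coe 𝒱 i ⟨a, ha⟩
  simp only at this
  simp [piecewiseLinear, this, DirectSum.toModule_lof]

end Contraction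

namespace DGAlgebra

variable {K : Type u} [Field K] {F G : DGAlgebra.{u, v} K}

lemma Hom.isQuasiIso_iff (φ : F.Hom G) : φ.IsQuasiIso ↔
    ∀ i, ∀ a ∈ F.gr (i + 1 + 1), ∀ b ∈ G.gr (i + 1), F.d a = 0 → φ.toAlgHom a = G.d b →
      ∃ a' ∈ F.gr (i + 1), ∃ b' ∈ G.gr i, F.d a' = a ∧ φ.toAlgHom a' - b = G.d b' :=
  quasiIso_ofHom_restrict_iff F.gr G.gr (fun _ => F.d) (fun _ => G.d) φ.toAlgHom.toLinearMap
    (fun _ _ h => F.d_mem h) (fun _ _ h => G.d_mem h) (fun _ _ h => φ.map_mem h)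
    (fun _ => by ext x; exact F.d_d x) (fun _ => by ext x; exact G.d_d x) φ.toComplexHom (fun _ => rfl)

/-- A homotopy inverse, with homotopies, of the chain map underlying a homomorphism of differential
graded algebras. -/
structure HomotopyInverse (φ : F.Hom G) where
  inv : G →ₗ[K] F
  /-- the homotopy on the source -/
  hs : F →ₗ[K] F
  /-- the homotopy on the target -/
  ht : G →ₗ[K] G
  inv_mem : ∀ {i a}, a ∈ G.gr i → inv a ∈ F.gr i
  hs_mem : ∀ {i a}, a ∈ F.gr i → hs a ∈ F.gr (i - 1)
  ht_mem : ∀ {i a}, a ∈ G.gr i → ht a ∈ G.gr (i - 1)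
  inv_d : ∀ a, inv (G.d a) = F.d (inv a)
  inv_map : ∀ a, inv (φ.toAlgHom a) = a - (F.d (hs a) + hs (F.d a))
  map_inv : ∀ a, φ.toAlgHom (inv a) = a - (G.d (ht a) + ht (G.d a))

/-- The mapping cone of φ is exact, hence contractible. Three of the four matrix entries of a
contraction are the inverse and the two homotopies, and the needed identities are components of the
contraction identity. -/
lemma Hom.IsQuasiIso.nonempty_homotopyInverse {φ : F.Hom G} (hφ : φ.IsQuasiIso) :
    Nonempty (HomotopyInverse φ) := by
  rw [φ.isQuasiIso_iff] at hφ
  -- The mapping cone: F is shifted by one and carries the differential -d.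
  let C : ℤ → Submodule K (F × G) := fun i => (F.gr (i + 1)).prod (G.gr i)
  let D : F × G →ₗ[K] F × G := LinearMap.prod (-F.d ∘ₗ LinearMap.fst K F G)
    (φ.toAlgHom.toLinearMap ∘ₗ LinearMap.fst K F G + G.d ∘ₗ LinearMap.snd K F G)
  have hDx : ∀ x y, D (x, y) = (-F.d x, φ.toAlgHom x + G.d y) := fun x y => rfl
  obtain ⟨h, hm, hh⟩ := exists_contraction C D
    (fun i x hx => ⟨neg_mem (F.d_mem hx.1), add_mem (φ.map_mem hx.1) (G.d_mem hx.2)⟩)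
    (fun x => by
      obtain ⟨x, y⟩ := x
      simp [hDx, F.d_d, G.d_d, φ.map_d])
    (fun i x hx h0 => by
      obtain ⟨x, y⟩ := x
      have h1 : F.d x = 0 := by simpa [hDx] using congrArg Prod.fst h0
      have h2 : φ.toAlgHom x + G.d y = 0 := congrArg Prod.snd h0
      obtain ⟨a, ha, b, hb, h3, h4⟩ := hφ i x hx.1 (-y) (neg_mem hx.2) h1
        (by rw [map_neg]; exact eq_neg_of_add_eq_zero_left h2)
      refine ⟨(-a, b), ⟨neg_mem ha, hb⟩, ?_⟩
      rw [hDx, map_neg, map_neg, h3, ← h4]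
      simp)
  have hmF : ∀ {i a}, a ∈ F.gr i → (a, (0 : G)) ∈ C (i - 1) := fun {i a} ha =>
    ⟨by simpa using ha, zero_mem _⟩
  have hmG : ∀ {i a}, a ∈ G.gr i → ((0 : F), a) ∈ C i := fun {i a} ha => ⟨zero_mem _, ha⟩
  let ψ := piecewiseLinear G.gr fun i => LinearMap.fst K F G ∘ₗ h i ∘ₗ LinearMap.inr K F G
  let t := piecewiseLinear G.gr fun i => LinearMap.snd K F G ∘ₗ h i ∘ₗ LinearMap.inr K F G
  -- An element of degree i of F has degree i - 1 in the cone; the minus sign compensates for the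
  -- differential -d there.
  let s := piecewiseLinear F.gr fun i => -LinearMap.fst K F G ∘ₗ h (i - 1) ∘ₗ LinearMap.inl K F G
  have hψ : ∀ {i a}, a ∈ G.gr i → ψ a = (h i (0, a)).1 :=
    fun ha => piecewiseLinear_apply G.gr _ ha
  have ht : ∀ {i a}, a ∈ G.gr i → t a = (h i (0, a)).2 :=
    fun ha => piecewiseLinear_apply G.gr _ ha
  have hs : ∀ {i a}, a ∈ F.gr i → s a = -(h (i - 1) (a, 0)).1 :=
    fun ha => piecewiseLinear_apply F.gr _ ha
  have hG : ∀ {i a}, a ∈ G.gr i → D (h i (0, a)) + h (i + 1) (0, G.d a) = (0, a) := by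
    intro i a ha
    have := hh i _ (hmG ha)
    rwa [hDx 0, map_zero, map_zero, neg_zero, zero_add] at this
  refine ⟨⟨ψ, s, t, fun {i a} ha => ?_, fun {i a} ha => ?_, fun {i a} ha => ?_, fun a => ?_,
    fun a => ?_, fun a => ?_⟩⟩
  · rw [hψ ha]
    simpa using (hm i _ (hmG ha)).1
  · rw [hs ha]
    simpa using (hm (i - 1) _ (hmF ha)).1
  · rw [ht ha]
    exact (hm i _ (hmG ha)).2
  · refine ext_of_homogeneous G.gr (f := ψ ∘ₗ G.d) (g := F.d ∘ₗ ψ) (fun i a ha => ?_) a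
    have := congrArg Prod.fst (hG ha)
    rw [LinearMap.comp_apply, LinearMap.comp_apply, hψ ha, hψ (G.d_mem ha)]
    exact (neg_add_eq_zero.1 this).symm
  · refine ext_of_homogeneous F.gr (f := ψ ∘ₗ φ.toAlgHom.toLinearMap)
      (g := LinearMap.id - (F.d ∘ₗ s + s ∘ₗ F.d)) (fun i a ha => ?_) a
    have h1 := hh (i - 1) _ (hmF ha)
    rw [hDx a 0, map_zero, add_zero, sub_add_cancel] at h1
    have h2 : h i (-F.d a, φ.toAlgHom a) = h i (0, φ.toAlgHom a) - h i (F.d a, 0) := by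
      rw [← map_sub]; simp
    have h3 := congrArg Prod.fst h1
    rw [h2] at h3
    change -F.d (h (i - 1) (a, 0)).1 + ((h i (0, φ.toAlgHom a)).1 - (h i (F.d a, 0)).1) = a at h3
    change ψ (φ.toAlgHom a) = a - (F.d (s a) + s (F.d a))
    rw [hψ (φ.map_mem ha), hs ha, hs (F.d_mem ha), add_sub_cancel_right, map_neg]
    nth_rw 2 [← h3]
    abel
  · refine ext_of_homogeneous G.gr (f := φ.toAlgHom.toLinearMap ∘ₗ ψ)
      (g := LinearMap.id - (G.d ∘ₗ t + t ∘ₗ G.d)) (fun i a ha => ?_) a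
    have h3 := congrArg Prod.snd (hG ha)
    change φ.toAlgHom (h i (0, a)).1 + G.d (h i (0, a)).2 + (h (i + 1) (0, G.d a)).2 = a at h3
    change φ.toAlgHom (ψ a) = a - (G.d (t a) + t (G.d a))
    rw [hψ ha, ht ha, ht (G.d_mem ha)]
    nth_rw 2 [← h3]
    abel

end DGAlgebra

end DGHochschild

end

/-! ### Complete filtrations and the reduction to columns -/

noncomputable section

namespace DGHochschild

section Filtered

/-- Successive approximation: an additive map between products that respects the filtrations by the
index is onto `Q` if it is so up to terms of higher filtration. -/
lemma exists_preimage_of_approximation {X Y : ℕ → Type*} [∀ n, AddCommGroup (X n)]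
    [∀ n, AddCommGroup (Y n)] (P : AddSubgroup (∀ n, X n)) (Q : Set (∀ n, Y n))
    (D : (∀ n, X n) →+ ∀ n, Y n)
    (hP : ∀ x : ∀ n, X n, (∀ n, ∃ x' ∈ P, x' n = x n) → x ∈ P)
    (hD : ∀ x n, (∀ i ≤ n, x i = 0) → D x n = 0)
    (step : ∀ p, ∀ y ∈ Q, (∀ i < p, y i = 0) →
      ∃ x ∈ P, (∀ i < p, x i = 0) ∧ y - D x ∈ Q ∧ ∀ i < p + 1, (y - D x) i = 0)
    {y : ∀ n, Y n} (hy : y ∈ Q) : ∃ x ∈ P, D x = y := by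
  choose! g hgP hg0 hgQ hg using step
  -- What is left of y after p corrections; it vanishes below index p.
  let s : ℕ → ∀ n, Y n := fun p => Nat.rec y (fun p z => z - D (g p z)) p
  have hs : ∀ p, s (p + 1) = s p - D (g p (s p)) := fun p => rfl
  have hsQ : ∀ p, s p ∈ Q ∧ ∀ i < p, s p i = 0 := by
    intro p
    induction p with
    | zero => exact ⟨hy, fun i hi => absurd hi (Nat.not_lt_zero i)⟩
    | succ p ih => exact ⟨hgQ p _ ih.1 ih.2, hg p _ ih.1 ih.2⟩
  let x : ℕ → ∀ n, X n := fun p => g p (s p)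
  have hx0 : ∀ p i, i < p → x p i = 0 := fun p i hi => hg0 p _ (hsQ p).1 (hsQ p).2 i hi
  have hsum : ∀ p, s p = y - D (∑ q ∈ Finset.range p, x q) := by
    intro p
    induction p with
    | zero => simp [s]
    | succ p ih => rw [hs, Finset.sum_range_succ, map_add, ih]; simp only [x, ih]; abel
  -- The infinite sum of all corrections. It is finite in every component, since the q-th correction
  -- vanishes below index q.
  let t : ∀ n, X n := fun n => (∑ q ∈ Finset.range (n + 1), x q) n
  have ht : ∀ n i, i ≤ n → t i = (∑ q ∈ Finset.range (n + 1), x q) i := by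
    intro n i hi
    simp only [t, Finset.sum_apply]
    refine Finset.sum_subset (Finset.range_mono (by omega)) fun q _ hq => hx0 q i ?_
    simp only [Finset.mem_range] at hq
    omega
  refine ⟨t, hP t fun n => ⟨∑ q ∈ Finset.range (n + 1), x q,
    sum_mem fun q _ => hgP q _ (hsQ q).1 (hsQ q).2, rfl⟩, funext fun n => ?_⟩
  have h1 := (hsQ (n + 1)).2 n n.lt_succ_self
  rw [show s (n + 1) n = _ from congrFun (hsum (n + 1)) n, Pi.sub_apply, sub_eq_zero] at h1
  rw [h1, ← sub_eq_zero, ← Pi.sub_apply, ← map_sub]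
  exact hD _ n fun i hi => by rw [Pi.sub_apply, ht n i hi, sub_self]

end Filtered

variable {K : Type u} [Field K]

section Columns

variable {F : DGAlgebra.{u, v} K} (M : DGBimodule F)

/-- The part of the Hochschild differential that preserves the number of arguments. -/
def columnD (m : ℤ) : Fam M →ₗ[K] Fam M := opI M m + opD M

lemma columnD_apply_eq_zero (m : ℤ) {c : Fam M} {n : ℕ} (h : c n = 0) : columnD M m c n = 0 := by
  ext a
  change opI M m c n a + opD M c n a = 0
  rw [opD_apply, h]
  simp [opI, h]

lemma delta_eq_columnD (m : ℤ) (c : Fam M) :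
    delta M m c = columnD M m c + (opL M m c + opB M c + opR M c) := by
  rw [delta_eq]; simp only [columnD, LinearMap.add_apply]; abel

/-- The terms with products have n arguments only if they come from the component with n - 1
arguments, so the lowest component sees the internal differential alone. -/
lemma delta_apply_eq_columnD (m : ℤ) {c : Fam M} {n : ℕ} (h : ∀ i < n, c i = 0) :
    delta M m c n = columnD M m c n := by
  rw [delta_eq_columnD]
  cases n with
  | zero => change _ + ((0 : MultilinearMap K _ M) + 0 + 0) = _; simp
  | succ n =>
    have h0 := h n n.lt_succ_self
    ext a
    change _ + (opL M m c (n + 1) a + opB M c (n + 1) a + opR M c (n + 1) a) = _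
    rw [opL_apply, opB_apply, opR_apply, h0]
    simp

lemma delta_apply_eq_zero (m : ℤ) {c : Fam M} {n : ℕ} (h : ∀ i ≤ n, c i = 0) :
    delta M m c n = 0 := by
  rw [delta_apply_eq_columnD M m fun i hi => h i hi.le, columnD_apply_eq_zero M m (h n le_rfl)]

/-- The family with the same component as `c` at `p`, and zero components elsewhere. -/
def component (p : ℕ) (c : Fam M) : Fam M := fun n => if n = p then c n else 0

lemma component_self (p : ℕ) (c : Fam M) : component M p c p = c p := if_pos rfl
lemma component_of_ne {p n : ℕ} (h : n ≠ p) (c : Fam M) : component M p c n = 0 := if_neg h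

lemma mem_cochains_of_forall {m : ℤ} {c : Fam M} (h : ∀ n, ∃ c' ∈ cochains M m, c' n = c n) :
    c ∈ cochains M m := by
  intro n
  obtain ⟨c', hc', h'⟩ := h n
  rw [← h']
  exact hc' n

lemma component_mem {m : ℤ} {c : Fam M} (hc : c ∈ cochains M m) (p : ℕ) :
    component M p c ∈ cochains M m := by
  refine mem_cochains_of_forall M fun n => ?_
  by_cases h : n = p
  · exact ⟨c, hc, by rw [component, if_pos h]⟩
  · exact ⟨0, zero_mem _, by rw [component_of_ne M h]; rfl⟩

lemma columnD_congr (m : ℤ) {c c' : Fam M} {n : ℕ} (h : c n = c' n) :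
    columnD M m c n = columnD M m c' n := by
  rw [← sub_eq_zero, ← Pi.sub_apply, ← map_sub]
  exact columnD_apply_eq_zero M m (by rw [Pi.sub_apply, h, sub_self])

lemma columnD_component (m : ℤ) (p : ℕ) (c : Fam M) :
    columnD M m (component M p c) = component M p (columnD M m c) := by
  funext n
  by_cases h : n = p
  · subst h
    rw [component_self]
    exact columnD_congr M m (component_self M n c)
  · rw [component_of_ne M h]
    exact columnD_apply_eq_zero M m (component_of_ne M h c)

variable {M}

/-- If a map of Hochschild complexes that preserves the number of arguments has exact mapping cone
for the internal differentials, then it has exact mapping cone. -/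
lemma cone_exact_of_columns {G : DGAlgebra.{u, v} K} {N : DGBimodule G} (f : Fam M →ₗ[K] Fam N)
    (hfm : ∀ m, ∀ c ∈ cochains M m, f c ∈ cochains N m)
    (hfd : ∀ m c, delta N m (f c) = f (delta M m c))
    (hf : ∀ c n, c n = 0 → f c n = 0)
    (H : ∀ m, ∀ c ∈ cochains M (m + 1 + 1), ∀ e ∈ cochains N (m + 1),
      columnD M (m + 1 + 1) c = 0 → f c = columnD N (m + 1) e →
      ∃ c' ∈ cochains M (m + 1), ∃ e' ∈ cochains N m,
        columnD M (m + 1) c' = c ∧ f c' - e = columnD N m e')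
    (m : ℤ) (c : Fam M) (hc : c ∈ cochains M (m + 1 + 1)) (e : Fam N)
    (he : e ∈ cochains N (m + 1)) (h1 : delta M (m + 1 + 1) c = 0)
    (h2 : f c = delta N (m + 1) e) :
    ∃ c' ∈ cochains M (m + 1), ∃ e' ∈ cochains N m,
      delta M (m + 1) c' = c ∧ f c' - e = delta N m e' := by
  have hfcomp : ∀ p c, f (component M p c) = component N p (f c) := by
    intro p c
    funext n
    by_cases h : n = p
    · subst h
      rw [component_self, ← sub_eq_zero, ← Pi.sub_apply, ← map_sub]
      exact hf _ _ (by rw [Pi.sub_apply, component_self, sub_self])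
    · rw [component_of_ne N h]
      exact hf _ _ (component_of_ne M h c)
  -- The cone as a product over the number of arguments: `P` consists of the possible primitives,
  -- `Q` of the cone cocycles, and `D` is the cone differential, up to signs.
  let X : ℕ → Type v := fun n => MultilinearMap K (fun _ : Fin n => (F : Type v)) M ×
    MultilinearMap K (fun _ : Fin n => (G : Type v)) N
  let P : AddSubgroup (∀ n, X n) :=
    { carrier := {x | (fun n => (x n).1) ∈ cochains M (m + 1) ∧ (fun n => (x n).2) ∈ cochains N m}
      add_mem' := fun h h' => ⟨add_mem h.1 h'.1, add_mem h.2 h'.2⟩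
      zero_mem' := ⟨zero_mem _, zero_mem _⟩
      neg_mem' := fun h => ⟨neg_mem h.1, neg_mem h.2⟩ }
  let Q : Set (∀ n, X n) := {y | (fun n => (y n).1) ∈ cochains M (m + 1 + 1) ∧
    (fun n => (y n).2) ∈ cochains N (m + 1) ∧ delta M (m + 1 + 1) (fun n => (y n).1) = 0 ∧
    f (fun n => (y n).1) = delta N (m + 1) (fun n => (y n).2)}
  let D : (∀ n, X n) →+ ∀ n, X n := AddMonoidHom.mk' (fun x n => (delta M (m + 1) (fun n => (x n).1) n,
      f (fun n => (x n).1) n - delta N m (fun n => (x n).2) n)) (by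
    intro x y
    funext n
    change (delta M (m + 1) ((fun n => (x n).1 : Fam M) + (fun n => (y n).1 : Fam M)) n,
      f ((fun n => (x n).1 : Fam M) + (fun n => (y n).1 : Fam M)) n -
        delta N m ((fun n => (x n).2 : Fam N) + (fun n => (y n).2 : Fam N)) n) = (_ + _, _ + _)
    rw [map_add, map_add, map_add]
    refine Prod.ext rfl ?_
    simp only [Pi.add_apply]
    abel)
  obtain ⟨x, hx, hxy⟩ := exists_preimage_of_approximation P Q D
    (fun x h => ⟨mem_cochains_of_forall M fun n => by
        obtain ⟨x', h', e⟩ := h n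
        exact ⟨_, h'.1, congrArg Prod.fst e⟩,
      mem_cochains_of_forall N fun n => by
        obtain ⟨x', h', e⟩ := h n
        exact ⟨_, h'.2, congrArg Prod.snd e⟩⟩)
    (fun x n h => by
      have e1 := delta_apply_eq_zero M (m + 1) (c := fun n => (x n).1)
        (fun i hi => congrArg Prod.fst (h i hi))
      have e2 := delta_apply_eq_zero N m (c := fun n => (x n).2)
        (fun i hi => congrArg Prod.snd (h i hi))
      have e3 := hf (fun n => (x n).1) n (congrArg Prod.fst (h n le_rfl))
      change (_, _ - _) = _
      rw [e1, e2, e3, sub_zero]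
      rfl)
    (fun p y hy h0 => by
      obtain ⟨hy1, hy2, hy3, hy4⟩ := hy
      set c : Fam M := fun n => (y n).1 with hcdef
      set e : Fam N := fun n => (y n).2 with hedef
      have hc0 : ∀ i < p, c i = 0 := fun i hi => congrArg Prod.fst (h0 i hi)
      have he0 : ∀ i < p, e i = 0 := fun i hi => congrArg Prod.snd (h0 i hi)
      -- The lowest component of a cone cocycle is a cocycle for the internal differentials, hence
      -- bounds in its column. Subtracting the full coboundary of this column solution clears column
      -- p and gives a cone cocycle again, because the full differential squares to zero.
      obtain ⟨c', hc', e', he', h5, h6⟩ := H m (component M p c) (component_mem M hy1 p)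
        (component N p e) (component_mem N hy2 p) (by
          rw [columnD_component]
          funext n
          by_cases hn : n = p
          · subst hn
            rw [component_self, ← delta_apply_eq_columnD M _ hc0, hy3]
          · rw [component_of_ne M hn]; rfl) (by
          rw [columnD_component, hfcomp]
          funext n
          by_cases hn : n = p
          · subst hn
            rw [component_self, component_self, ← delta_apply_eq_columnD N _ he0, hy4]
          · rw [component_of_ne N hn, component_of_ne N hn])
      refine ⟨fun n => (component M p c' n, component N p e' n),
        ⟨component_mem M hc' p, component_mem N he' p⟩, fun i hi => ?_, ?_, fun i hi => ?_⟩
      · change (component M p c' i, component N p e' i) = (0, 0)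
        rw [component_of_ne M hi.ne, component_of_ne N hi.ne]
      · have m1 := component_mem M hc' p
        have m2 := component_mem N he' p
        refine ⟨sub_mem hy1 (delta_mem m1),
          sub_mem hy2 (sub_mem (hfm _ _ m1) (delta_mem m2)), ?_, ?_⟩
        · change delta M (m + 1 + 1) (c - delta M (m + 1) (component M p c')) = 0
          rw [map_sub, hy3, delta_delta m1, sub_zero]
        · change f (c - delta M (m + 1) (component M p c')) =
            delta N (m + 1) (e - (f (component M p c') - delta N m (component N p e')))
          rw [map_sub, map_sub, map_sub, delta_delta m2, hfd, hy4, sub_zero]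
      · change (c i - delta M (m + 1) (component M p c') i,
          e i - (f (component M p c') i - delta N m (component N p e') i)) = (0, 0)
        have hlt : ∀ j < i, component M p c' j = 0 :=
          fun j hj => component_of_ne M (by omega) c'
        have hlt' : ∀ j < i, component N p e' j = 0 :=
          fun j hj => component_of_ne N (by omega) e'
        rw [delta_apply_eq_columnD M _ hlt, delta_apply_eq_columnD N _ hlt', columnD_component,
          columnD_component, hfcomp, h5, ← h6]
        rcases (Nat.lt_succ_iff.1 hi).lt_or_eq with hi | rfl
        · rw [component_of_ne M hi.ne, component_of_ne N hi.ne, component_of_ne N hi.ne, hc0 i hi,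
            he0 i hi]
          simp
        · rw [component_self, component_self, component_self N i (f c' - component N i e),
            Pi.sub_apply, component_self, component_self]
          simp)
    (y := fun n => (c n, e n)) ⟨hc, he, h1, h2⟩
  refine ⟨fun n => (x n).1, hx.1, fun n => (x n).2, hx.2, ?_, ?_⟩
  · funext n
    exact congrArg (fun y => (y n).1) hxy
  · funext n
    have : f (fun n => (x n).1) n - delta N m (fun n => (x n).2) n = e n :=
      congrArg (fun y => (y n).2) hxy
    rw [Pi.sub_apply, sub_eq_iff_eq_add, ← this]
    abel

/-- A homotopy equivalence has exact mapping cone. -/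
lemma cone_exact_columnD_of_homotopy {G : DGAlgebra.{u, v} K} {N : DGBimodule G}
    (f : Fam M →ₗ[K] Fam N) (g : Fam N →ₗ[K] Fam M) (hM : ℤ → Fam M →ₗ[K] Fam M)
    (hN : ℤ → Fam N →ₗ[K] Fam N)
    (hfm : ∀ m, ∀ c ∈ cochains M m, f c ∈ cochains N m)
    (hgm : ∀ m, ∀ c ∈ cochains N m, g c ∈ cochains M m)
    (hMm : ∀ m, ∀ c ∈ cochains M (m + 1), hM m c ∈ cochains M m)
    (hNm : ∀ m, ∀ c ∈ cochains N (m + 1), hN m c ∈ cochains N m)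
    (hf : ∀ m c, columnD N m (f c) = f (columnD M m c))
    (hg : ∀ m c, columnD M m (g c) = g (columnD N m c))
    (hgf : ∀ m c, g (f c) = c - (columnD M m (hM m c) + hM (m + 1) (columnD M (m + 1) c)))
    (hfg : ∀ m c, f (g c) = c - (columnD N m (hN m c) + hN (m + 1) (columnD N (m + 1) c)))
    (m : ℤ) (c : Fam M) (hc : c ∈ cochains M (m + 1 + 1)) (e : Fam N)
    (he : e ∈ cochains N (m + 1)) (h1 : columnD M (m + 1 + 1) c = 0)
    (h2 : f c = columnD N (m + 1) e) :
    ∃ c' ∈ cochains M (m + 1), ∃ e' ∈ cochains N m,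
      columnD M (m + 1) c' = c ∧ f c' - e = columnD N m e' := by
  have h3 := hgf (m + 1) c
  rw [h1, map_zero, add_zero, h2, ← hg] at h3
  have hc1 : columnD M (m + 1) (g e + hM (m + 1) c) = c := by rw [map_add, h3]; abel
  have hc1m : g e + hM (m + 1) c ∈ cochains M (m + 1) := add_mem (hgm _ _ he) (hMm _ _ hc)
  generalize g e + hM (m + 1) c = c1 at hc1 hc1m
  have hz : columnD N (m + 1) (f c1 - e) = 0 := by rw [map_sub, hf, hc1, h2, sub_self]
  have hzm : f c1 - e ∈ cochains N (m + 1) := sub_mem (hfm _ _ hc1m) he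
  have h4 := hfg m (f c1 - e)
  rw [hz, map_zero, add_zero] at h4
  -- The defect f c1 - e is a cocycle that need not bound. Subtracting its image under g does not
  -- change the differential of c1, and replaces the defect z by z - f g z, which the homotopy on
  -- the target bounds.
  refine ⟨c1 - g (f c1 - e), sub_mem hc1m (hgm _ _ hzm), hN m (f c1 - e), hNm _ _ hzm, ?_, ?_⟩
  · rw [map_sub, hg, hz, map_zero, sub_zero, hc1]
  · rw [map_sub, h4]
    abel

end Columns

end DGHochschild

end

/-! ### Homotopies of columns, in the values and in the arguments -/

noncomputable section

namespace DGHochschild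

variable {K : Type u} [Field K]

section SignMap

variable {V W : Type v} [AddCommGroup V] [Module K V] [AddCommGroup W] [Module K W]
  (𝒱 : ℤ → Submodule K V) [DirectSum.Decomposition 𝒱] (𝒲 : ℤ → Submodule K W)
  [DirectSum.Decomposition 𝒲]

lemma signMap_comp_of_degree {f : V →ₗ[K] W} (r : ℤ) (hf : ∀ {i a}, a ∈ 𝒱 i → f a ∈ 𝒲 (i + r))
    (m : ℤ) (a : V) : signMap 𝒲 m (f a) = sg (m * r) • f (signMap 𝒱 m a) := by
  refine ext_of_homogeneous 𝒱 (f := signMap 𝒲 m ∘ₗ f)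
    (g := sg (m * r) • f ∘ₗ signMap 𝒱 m) (fun i a ha => ?_) a
  simp [signMap_apply 𝒱 _ ha, signMap_apply 𝒲 _ (hf ha), mul_add, sg_add, mul_smul,
    smul_comm (sg (m * i))]

end SignMap

section Transport

variable {F G : DGAlgebra.{u, v} K} (M : DGBimodule F) (N : DGBimodule G)

/-- Composition with a linear map in the values and with a linear map in the arguments. -/
def transport (w : M →ₗ[K] N) (u : G →ₗ[K] F) : Fam M →ₗ[K] Fam N where
  toFun c n := w.compMultilinearMap ((c n).compLinearMap fun _ => u)
  map_add' c c' := by funext n; ext a; simp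
  map_smul' r c := by funext n; ext a; simp

lemma transport_apply (w : M →ₗ[K] N) (u : G →ₗ[K] F) (c : Fam M) (n : ℕ) (a : Fin n → G) :
    transport M N w u c n a = w (c n fun i => u (a i)) := rfl

variable {M N} in
lemma transport_mem {w : M →ₗ[K] N} {u : G →ₗ[K] F} (r : ℤ)
    (hw : ∀ {i x}, x ∈ M.gr i → w x ∈ N.gr (i + r)) (hu : ∀ {i a}, a ∈ G.gr i → u a ∈ F.gr i)
    {m : ℤ} {c : Fam M} (hc : c ∈ cochains M m) :
    transport M N w u c ∈ cochains N (m + r) := fun n p a ha => by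
  have := hw (hc n p (fun i => u (a i)) fun i => hu (ha i))
  rwa [add_assoc] at this

lemma opD_transport (w : M →ₗ[K] N) (u : G →ₗ[K] F) (hud : ∀ a, u (G.d a) = F.d (u a))
    (hue : ∀ a, u (G.eps a) = F.eps (u a)) (c : Fam M) :
    opD N (transport M N w u c) = transport M N w u (opD M c) := by
  funext n; ext a
  rw [transport_apply, opD_apply, opD_apply, map_sum]
  refine Finset.sum_congr rfl fun i _ => ?_
  rw [map_zsmul, transport_apply]
  congr 3
  funext j
  simp only [← hud, ← hue]
  split_ifs <;> rfl

lemma opI_transport (w : M →ₗ[K] N) (u : G →ₗ[K] F) (hw : ∀ x, w (M.d x) = N.d (w x)) (m : ℤ)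
    (c : Fam M) : opI N m (transport M N w u c) = transport M N w u (opI M m c) := by
  funext n; ext a
  simp [opI, transport, hw]

lemma columnD_transport (w : M →ₗ[K] N) (u : G →ₗ[K] F) (hw : ∀ x, w (M.d x) = N.d (w x))
    (hud : ∀ a, u (G.d a) = F.d (u a)) (hue : ∀ a, u (G.eps a) = F.eps (u a)) (m : ℤ)
    (c : Fam M) : columnD N m (transport M N w u c) = transport M N w u (columnD M m c) := by
  simp only [columnD, LinearMap.add_apply, map_add, opD_transport M N w u hud hue,
    opI_transport M N w u hw]

end Transport

section ArgumentHomotopy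

variable {F : DGAlgebra.{u, v} K} (M : DGBimodule F)

/-- The map induced on multilinear maps by
`∑ i, e ⊗ ⋯ ⊗ e ⊗ t ⊗ 1 ⊗ ⋯ ⊗ 1` (with `t` at the `i`-th place), where `t` is a map of odd
degree. -/
def opH (e t : F →ₗ[K] F) : Fam M →ₗ[K] Fam M where
  toFun c n := ∑ i : Fin n, sg i • (c n).compLinearMap fun j =>
    if j < i then e ∘ₗ F.eps else if j = i then t else LinearMap.id
  map_add' c c' := by
    funext n; ext a; simp [Finset.sum_add_distrib]
  map_smul' r c := by
    funext n; ext a; simp [Finset.smul_sum, smul_comm r]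

variable (e t : F →ₗ[K] F)

lemma opH_apply (c : Fam M) (n : ℕ) (a : Fin n → F) : opH M e t c n a = ∑ i : Fin n, sg i •
    c n (fun j => if j < i then e (F.eps (a j)) else if j = i then t (a j) else a j) := by
  simp only [opH, LinearMap.coe_mk, AddHom.coe_mk, sum_apply, smul_apply,
    MultilinearMap.compLinearMap_apply]
  refine Finset.sum_congr rfl fun i _ => ?_
  congr 2
  funext j
  split_ifs <;> rfl

lemma opH_zero (c : Fam M) : opH M e t c 0 = 0 := by ext a; simp [opH_apply]

/-- The recursion behind the induction on the number of arguments: the summand i = 0 has t at the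
first place, all others have e ε there, and lowering i by one changes the sign. -/
lemma lc_opH (x : F) (c : Fam M) :
    lc M x (opH M e t c) = lc M (t x) c - opH M e t (lc M (e (F.eps x)) c) := by
  funext n; ext a
  rw [fam_sub_apply]
  simp only [lc_apply, opH_apply, Fin.sum_univ_succ, sub_eq_add_neg, ← Finset.sum_neg_distrib]
  congr 1
  · simp only [Fin.val_zero, Nat.cast_zero, sg_zero, one_smul]
    congr 1
    funext j
    refine Fin.cases ?_ (fun j => ?_) j <;> simp
  · refine Finset.sum_congr rfl fun i _ => ?_
    simp only [Fin.val_succ, Nat.cast_succ, sg_succ, neg_smul]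
    congr 3
    funext j
    refine Fin.cases ?_ (fun j => ?_) j <;> simp

variable {M e t}

lemma opH_mem (he : ∀ {i a}, a ∈ F.gr i → e a ∈ F.gr i)
    (ht : ∀ {i a}, a ∈ F.gr i → t a ∈ F.gr (i - 1)) {m : ℤ} {c : Fam M}
    (hc : c ∈ cochains M (m + 1)) : opH M e t c ∈ cochains M m := by
  intro n
  induction n generalizing m c with
  | zero => intro p a ha; simp [opH_zero]
  | succ n ih =>
    intro p a ha
    have h : opH M e t c (n + 1) a = lc M (a 0) (opH M e t c) n (Fin.tail a) := by simp [lc_apply]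
    rw [h, lc_opH, fam_sub_apply, Fin.sum_univ_succ]
    have hta : ∀ i, Fin.tail a i ∈ F.gr (p i.succ) := fun i => ha i.succ
    refine sub_mem ?_ ?_
    · convert lc_mem (ht (ha 0)) hc n (fun i => p i.succ) (Fin.tail a) hta using 2
      ring
    · have h1 : lc M (e (F.eps (a 0))) c ∈ cochains M (m + p 0 - 1 + 1) := by
        convert lc_mem (he (F.eps_mem (ha 0))) hc using 2
        ring
      convert ih h1 (fun i => p i.succ) (Fin.tail a) hta using 2
      ring

/-- The difference 1 - e ⊗ ⋯ ⊗ e telescopes into the sum of e ⊗ ⋯ ⊗ e ⊗ (1 - e) ⊗ 1 ⊗ ⋯ ⊗ 1, where 1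
- e = d t + t d. The terms in which d and t stand at different places cancel, since t is odd and e
commutes with d. -/
lemma opD_opH (hed : ∀ a, e (F.d a) = F.d (e a)) (hee : ∀ a, e (F.eps a) = F.eps (e a))
    (hte : ∀ a, t (F.eps a) = -F.eps (t a)) (het : ∀ a, e a = a - (F.d (t a) + t (F.d a)))
    (c : Fam M) : opD M (opH M e t c) + opH M e t (opD M c) = c - transport M M LinearMap.id e c := by
  have key : ∀ n : ℕ, ∀ c : Fam M, opD M (opH M e t c) n + opH M e t (opD M c) n =
      c n - transport M M LinearMap.id e c n := by
    intro n
    induction n with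
    | zero =>
      intro c
      have h : transport M M LinearMap.id e c 0 = c 0 := by
        ext a
        exact congrArg (c 0) (Subsingleton.elim _ _)
      rw [h, opD_zero, opH_zero, sub_self, add_zero]
    | succ n ih =>
      intro c
      ext a
      have h : lc M (a 0) (opD M (opH M e t c)) + lc M (a 0) (opH M e t (opD M c)) =
          lc M (a 0 - e (a 0)) c +
            (opD M (opH M e t (lc M (e (a 0)) c)) + opH M e t (opD M (lc M (e (a 0)) c))) := by
        have h1 : a 0 - e (a 0) = F.d (t (a 0)) + t (F.d (a 0)) := by rw [het]; abel
        rw [h1]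
        simp only [lc_opD, lc_opH, map_sub, F.eps_d, ← hee, hed, hte, F.eps_eps, lc_neg, lc_add,
          map_neg]
        abel
      have h' := congrArg (fun e : Fam M => e n (Fin.tail a)) h
      have h2 : ∀ c c' : Fam M, (c + c') n = c n + c' n := fun _ _ => rfl
      simp only [h2, ih] at h'
      rw [sub_eq_add_neg, lc_add, lc_neg] at h'
      simp only [add_apply, sub_apply, fam_add_apply, fam_neg_apply,
        transport_apply, lc_apply, Fin.cons_self_tail, LinearMap.id_apply] at h'
      refine h'.trans ?_
      have h3 : (Fin.cons (e (a 0)) fun i => e (Fin.tail a i) : Fin (n + 1) → F) =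
          fun i => e (a i) := by
        funext j
        refine Fin.cases ?_ (fun j => ?_) j <;> rfl
      rw [h3]
      change _ = c (n + 1) a - c (n + 1) fun i => e (a i)
      abel
  funext n
  exact key n c

/-- The differential of the values contributes nothing: it acts with the signs (-1)^m and (-1)^(m +
1) before and after the homotopy. -/
lemma columnD_opH (hed : ∀ a, e (F.d a) = F.d (e a)) (hee : ∀ a, e (F.eps a) = F.eps (e a))
    (hte : ∀ a, t (F.eps a) = -F.eps (t a)) (het : ∀ a, e a = a - (F.d (t a) + t (F.d a)))
    (m : ℤ) (c : Fam M) : transport M M LinearMap.id e c =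
      c - (columnD M m (opH M e t c) + opH M e t (columnD M (m + 1) c)) := by
  have h1 : opI M m (opH M e t c) + opH M e t (opI M (m + 1) c) = 0 := by
    funext n; ext a
    change sg m • M.d (opH M e t c n a) + opH M e t (opI M (m + 1) c) n a = 0
    have : ∀ n a, opI M (m + 1) c n a = sg (m + 1) • M.d (c n a) := fun _ _ => rfl
    rw [opH_apply, opH_apply]
    simp only [this, map_sum, map_zsmul, Finset.smul_sum, ← Finset.sum_add_distrib]
    refine Finset.sum_eq_zero fun i _ => ?_
    rw [smul_comm (sg m), sg_succ, neg_smul, smul_neg, add_neg_cancel]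
  have h2 := opD_opH hed hee hte het c
  have h3 : columnD M m (opH M e t c) + opH M e t (columnD M (m + 1) c) =
      (opI M m (opH M e t c) + opH M e t (opI M (m + 1) c)) +
        (opD M (opH M e t c) + opH M e t (opD M c)) := by
    simp only [columnD, LinearMap.add_apply, map_add]; abel
  rw [h3, h1, h2]
  abel

end ArgumentHomotopy

/-! ### Invariance of the Hochschild complex under quasi-isomorphisms -/

section Invariance

variable {F G : DGAlgebra.{u, v} K} {φ : F.Hom G}

lemma DGAlgebra.HomotopyInverse.inv_eps (I : DGAlgebra.HomotopyInverse φ) (a : G) :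
    I.inv (G.eps a) = F.eps (I.inv a) := by
  have := signMap_comp_of_degree G.gr F.gr (f := I.inv) 0
    (fun ha => by simpa using I.inv_mem ha) 1 a
  simpa [DGAlgebra.eps, DGAlgebra.sgn] using this.symm

lemma DGAlgebra.HomotopyInverse.hs_eps (I : DGAlgebra.HomotopyInverse φ) (a : F) :
    I.hs (F.eps a) = -F.eps (I.hs a) := by
  have := signMap_comp_of_degree F.gr F.gr (f := I.hs) (-1) (fun ha => I.hs_mem ha) 1 a
  rw [DGAlgebra.eps, DGAlgebra.sgn, this]
  simp [sg]

lemma DGAlgebra.HomotopyInverse.ht_eps (I : DGAlgebra.HomotopyInverse φ) (a : G) :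
    I.ht (G.eps a) = -G.eps (I.ht a) := by
  have := signMap_comp_of_degree G.gr G.gr (f := I.ht) (-1) (fun ha => I.ht_mem ha) 1 a
  rw [DGAlgebra.eps, DGAlgebra.sgn, this]
  simp [sg]

lemma DGAlgebra.Hom.map_eps (φ : F.Hom G) (a : F) :
    φ.toAlgHom (F.eps a) = G.eps (φ.toAlgHom a) := φ.map_sgn 1 a

open DGBimodule

/-- The elementwise form of exactness of the mapping cone of `coeffMap`. -/
lemma cone_exact_coeffFam (I : DGAlgebra.HomotopyInverse φ) (m : ℤ) (c : Fam (regular F))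
    (hc : c ∈ cochains (regular F) (m + 1 + 1)) (e : Fam (restrict φ (regular G)))
    (he : e ∈ cochains (restrict φ (regular G)) (m + 1))
    (h1 : delta (regular F) (m + 1 + 1) c = 0)
    (h2 : coeffFam (homOfAlgHom φ) c = delta (restrict φ (regular G)) (m + 1) e) :
    ∃ c' ∈ cochains (regular F) (m + 1), ∃ e' ∈ cochains (restrict φ (regular G)) m,
      delta (regular F) (m + 1) c' = c ∧
        coeffFam (homOfAlgHom φ) c' - e = delta (restrict φ (regular G)) m e' := by
  refine cone_exact_of_columns (coeffFam (homOfAlgHom φ)) (fun m c h => coeffFam_mem _ h)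
    (fun m c => coeffFam_delta _ m c) (fun c n h => ?_) ?_ m c hc e he h1 h2
  · ext a
    rw [coeffFam_apply, h]
    simp
  -- A homotopy s of the coefficients, with the sign (-1)^i that matches the one of the differential
  -- of the values, is a homotopy of columns; the terms with d in an argument cancel because
  -- consecutive signs are opposite.
  · have hid : ∀ (N : DGBimodule F) (s : N →ₗ[K] N) (i : ℤ) (c : Fam N),
        c - (columnD N i (sg i • transport N N s LinearMap.id c) +
          sg (i + 1) • transport N N s LinearMap.id (columnD N (i + 1) c)) =
        transport N N (LinearMap.id - (N.d ∘ₗ s + s ∘ₗ N.d)) LinearMap.id c := by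
      intro N s i c
      have h1 := opD_transport N N s LinearMap.id (fun _ => rfl) (fun _ => rfl) c
      simp only [columnD, LinearMap.add_apply, map_add, map_zsmul, h1]
      funext n; ext a
      have e1 : ∀ i c a, opI N i c n a = sg i • N.d (c n a) := fun _ _ _ => rfl
      have e2 : ∀ (r : ℤ) (c : Fam N) a, (r • c) n a = r • c n a := fun _ _ _ => rfl
      simp only [fam_sub_apply, fam_add_apply, fam_neg_apply, e1, e2, transport_apply, sg_succ, map_neg, map_zsmul,
        smul_smul, smul_add, neg_smul, smul_neg, sg_mul_self, one_smul,
        LinearMap.sub_apply, LinearMap.add_apply, LinearMap.comp_apply, LinearMap.id_apply]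
      abel
    refine cone_exact_columnD_of_homotopy _
      (transport (restrict φ (regular G)) (regular F) I.inv LinearMap.id)
      (fun i => sg i • transport (regular F) (regular F) I.hs LinearMap.id)
      (fun i => sg i • transport (restrict φ (regular G)) (restrict φ (regular G)) I.ht
        LinearMap.id)
      (fun m c h => coeffFam_mem _ h) (fun m c h => ?_) (fun m c h => ?_) (fun m c h => ?_)
      (fun m c => ?_) (fun m c => ?_) (fun m c => ?_) (fun m c => ?_)
    · simpa using transport_mem 0 (fun hx => by simpa using I.inv_mem hx) (fun ha => ha) h
    · refine zsmul_mem ?_ _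
      simpa using transport_mem (-1) (fun hx => I.hs_mem hx) (fun ha => ha) h
    · refine zsmul_mem ?_ _
      simpa using transport_mem (-1) (fun hx => I.ht_mem hx) (fun ha => ha) h
    · exact columnD_transport (regular F) (restrict φ (regular G)) φ.toAlgHom.toLinearMap
        LinearMap.id φ.map_d (fun _ => rfl) (fun _ => rfl) m c
    · exact columnD_transport (restrict φ (regular G)) (regular F) I.inv LinearMap.id I.inv_d
        (fun _ => rfl) (fun _ => rfl) m c
    · refine Eq.trans ?_ (hid (regular F) I.hs m c).symm
      funext n; ext a
      exact I.inv_map _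
    · refine Eq.trans ?_ (hid (restrict φ (regular G)) I.ht m c).symm
      funext n; ext a
      exact I.map_inv _

/-- The elementwise form of exactness of the mapping cone of `restrictMap`. -/
lemma cone_exact_restrictFam (I : DGAlgebra.HomotopyInverse φ) (N : DGBimodule G) (m : ℤ)
    (c : Fam N) (hc : c ∈ cochains N (m + 1 + 1)) (e : Fam (restrict φ N))
    (he : e ∈ cochains (restrict φ N) (m + 1)) (h1 : delta N (m + 1 + 1) c = 0)
    (h2 : restrictFam φ N c = delta (restrict φ N) (m + 1) e) :
    ∃ c' ∈ cochains N (m + 1), ∃ e' ∈ cochains (restrict φ N) m,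
      delta N (m + 1) c' = c ∧ restrictFam φ N c' - e = delta (restrict φ N) m e' := by
  refine cone_exact_of_columns (restrictFam φ N) (fun m c h => restrictFam_mem _ _ h)
    (fun m c => restrictFam_delta _ _ m c) (fun c n h => ?_) ?_ m c hc e he h1 h2
  · ext a
    rw [restrictFam_apply, h]
    rfl
  -- Precomposition with φ is inverted by precomposition with `I.inv`. The composite on families
  -- over G is precomposition with φ ∘ inv, so the homotopy there is built from `I.ht`, and the one
  -- over F from `I.hs`.
  · refine cone_exact_columnD_of_homotopy _
      (transport (restrict φ N) N LinearMap.id I.inv)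
      (fun i => opH N (φ.toAlgHom.toLinearMap ∘ₗ I.inv) I.ht)
      (fun i => opH (restrict φ N) (I.inv ∘ₗ φ.toAlgHom.toLinearMap) I.hs)
      (fun m c h => restrictFam_mem _ _ h) (fun m c h => ?_) (fun m c h => ?_) (fun m c h => ?_)
      (fun m c => ?_) (fun m c => ?_) (fun m c => ?_) (fun m c => ?_)
    · have := transport_mem (M := restrict φ N) (N := N) (w := LinearMap.id) 0
        (fun hx => by simpa using hx) I.inv_mem h
      simpa using this
    · exact opH_mem (fun ha => φ.map_mem (I.inv_mem ha)) I.ht_mem h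
    · exact opH_mem (fun ha => I.inv_mem (φ.map_mem ha)) I.hs_mem h
    · exact columnD_transport N (restrict φ N) LinearMap.id φ.toAlgHom.toLinearMap
        (fun _ => rfl) φ.map_d φ.map_eps m c
    · exact columnD_transport (restrict φ N) N LinearMap.id I.inv (fun _ => rfl) I.inv_d
        I.inv_eps m c
    · exact columnD_opH (e := φ.toAlgHom.toLinearMap ∘ₗ I.inv)
        (fun a => by simp [I.inv_d, φ.map_d]) (fun a => by simp [I.inv_eps, φ.map_eps]) I.ht_eps I.map_inv m c
    · exact columnD_opH (M := restrict φ N) (e := I.inv ∘ₗ φ.toAlgHom.toLinearMap)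
        (fun a => by simp [I.inv_d, φ.map_d]) (fun a => by simp [I.inv_eps, φ.map_eps]) I.hs_eps I.inv_map m c

theorem quasiIso_coeffMap_homOfAlgHom (hφ : φ.IsQuasiIso) :
    QuasiIso (coeffMap (homOfAlgHom φ)) := by
  obtain ⟨I⟩ := hφ.nonempty_homotopyInverse
  exact (quasiIso_ofHom_restrict_iff (cochains (regular F)) (cochains (restrict φ (regular G)))
    (delta (regular F)) (delta (restrict φ (regular G))) (coeffFam (homOfAlgHom φ))
    (fun _ _ h => delta_mem h) (fun _ _ h => delta_mem h) (fun _ _ h => coeffFam_mem _ h)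
    (fun _ => ModuleCat.hom_ext (LinearMap.ext fun c => Subtype.ext (delta_delta c.2)))
    (fun _ => ModuleCat.hom_ext (LinearMap.ext fun c => Subtype.ext (delta_delta c.2)))
    (coeffMap (homOfAlgHom φ)) (fun _ => rfl)).2 (cone_exact_coeffFam I)

theorem quasiIso_restrictMap (hφ : φ.IsQuasiIso) (N : DGBimodule G) :
    QuasiIso (restrictMap φ N) := by
  obtain ⟨I⟩ := hφ.nonempty_homotopyInverse
  exact (quasiIso_ofHom_restrict_iff (cochains N) (cochains (restrict φ N))
    (delta N) (delta (restrict φ N)) (restrictFam φ N)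
    (fun _ _ h => delta_mem h) (fun _ _ h => delta_mem h) (fun _ _ h => restrictFam_mem _ _ h)
    (fun _ => ModuleCat.hom_ext (LinearMap.ext fun c => Subtype.ext (delta_delta c.2)))
    (fun _ => ModuleCat.hom_ext (LinearMap.ext fun c => Subtype.ext (delta_delta c.2)))
    (restrictMap φ N) (fun _ => rfl)).2 (cone_exact_restrictFam I N)

end Invariance

end DGHochschild

end

/-! ### Counting labellings by the descents of the sorting permutation -/

noncomputable section

namespace DGHochschild

section Counting

lemma strictMono_fin_iff {α : Type*} [Preorder α] {n : ℕ} {f : Fin n → α} :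
    StrictMono f ↔ ∀ (i : ℕ) (h : i + 1 < n), f ⟨i, by omega⟩ < f ⟨i + 1, h⟩ := by
  cases n with
  | zero => exact ⟨fun _ i h => absurd h (by omega), fun _ i => i.elim0⟩
  | succ n =>
    rw [Fin.strictMono_iff_lt_succ]
    exact ⟨fun h i hi => h ⟨i, by omega⟩, fun h i => h i (by omega)⟩

lemma eq_sort_iff_strictMono {α : Type*} [LinearOrder α] {n : ℕ} {g : Fin n → α}
    {σ : Equiv.Perm (Fin n)} :
    Tuple.sort g = σ ↔ StrictMono fun i => toLex (g (σ i), σ i) := by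
  rw [eq_comm, Tuple.eq_sort_iff']
  rfl

lemma card_strictMono (n m : ℕ) :
    (Finset.univ.filter fun h : Fin n → Fin m => StrictMono h).card = m.choose n := by
  have h0 : m.choose n = (Finset.powersetCard n (Finset.univ : Finset (Fin m))).card := by simp
  rw [h0]
  refine Finset.card_bij (fun h _ => Finset.univ.image h) (fun h hh => ?_)
    (fun h hh h' hh' e => ?_) (fun s hs => ?_)
  · rw [Finset.mem_powersetCard]
    refine ⟨Finset.subset_univ _, ?_⟩
    rw [Finset.card_image_of_injective _ (Finset.mem_filter.1 hh).2.injective]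
    simp
  · refine (StrictMono.range_inj (Finset.mem_filter.1 hh).2 (Finset.mem_filter.1 hh').2).1 ?_
    simpa using congrArg (fun s : Finset (Fin m) => (s : Set (Fin m))) e
  · rw [Finset.mem_powersetCard] at hs
    refine ⟨s.orderEmbOfFin hs.2, by simpa using (s.orderEmbOfFin hs.2).strictMono, ?_⟩
    rw [← Finset.coe_inj]
    simp

/-- The number of `g : Fin n → Fin N` that are sorted by `σ`. -/
lemma card_sort_eq {n : ℕ} (N : ℕ) (σ : Equiv.Perm (Fin n)) :
    (Finset.univ.filter fun g : Fin n → Fin N => Tuple.sort g = σ).card =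
      (N + n - 1 - descents σ).choose n := by
  classical
  let desc : ℕ → Prop := fun l => ∃ h : l + 1 < n, σ ⟨l + 1, h⟩ < σ ⟨l, by omega⟩
  -- The number of descents before i. A labelling sorted by σ increases weakly along σ, and strictly
  -- at the descents, so that g (σ i) + i - D i is strictly increasing; this is the bijection below.
  let D : ℕ → ℕ := fun i => ((Finset.range i).filter desc).card
  have hD0 : D 0 = 0 := rfl
  have hD1 : ∀ i, desc i → D (i + 1) = D i + 1 := by
    intro i hi
    simp only [D]
    rw [Finset.range_add_one, Finset.filter_insert, if_pos hi, Finset.card_insert_of_notMem]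
    simp
  have hD2 : ∀ i, ¬ desc i → D (i + 1) = D i := by
    intro i hi
    simp only [D]
    rw [Finset.range_add_one, Finset.filter_insert, if_neg hi]
  have hd : descents σ = D n := by
    refine Finset.card_bij (fun i _ => (i : ℕ)) (fun i hi => ?_) (fun i _ j _ h => Fin.ext h)
      (fun i hi => ?_)
    · rw [Finset.mem_filter, Finset.mem_range]
      exact ⟨i.2, (Finset.mem_filter.1 hi).2⟩
    · rw [Finset.mem_filter, Finset.mem_range] at hi
      exact ⟨⟨i, hi.1⟩, Finset.mem_filter.2 ⟨Finset.mem_univ _, hi.2⟩, rfl⟩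
  have hstep : ∀ i, D (i + 1) = D i ∨ D (i + 1) = D i + 1 := by
    intro i
    by_cases h : desc i
    · exact Or.inr (hD1 i h)
    · exact Or.inl (hD2 i h)
  have hle : ∀ i, D i ≤ i := by
    intro i
    induction i with
    | zero => simp [hD0]
    | succ i ih => rcases hstep i with h | h <;> omega
  have hmono : ∀ i k, D i ≤ D (i + k) ∧ D (i + k) ≤ D i + k := by
    intro i k
    induction k with
    | zero => simp
    | succ k ih => rcases hstep (i + k) with h | h <;> rw [← add_assoc] <;> omega
  -- The last index n - 1 is never a descent, whence i - D i ≤ n - 1 - D n. This bounds the new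
  -- values by N + n - 1 - D n.
  have hlast : ∀ i, i < n → D i ≤ D n ∧ D n + i + 1 ≤ D i + n := by
    intro i hi
    have h1 := hD2 (n - 1) (by rintro ⟨h, _⟩; omega)
    have h2 := hmono i (n - 1 - i)
    rw [show i + (n - 1 - i) = n - 1 by omega] at h2
    rw [show n - 1 + 1 = n by omega] at h1
    omega
  -- At a descent i and D i both grow by one, so w increases strictly exactly if u does; elsewhere
  -- only i grows, so w increases strictly exactly if u increases weakly.
  have key : ∀ (u : ℕ → ℕ) (w : ℕ → ℕ), (∀ i < n, w i + D i = u i + i) →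
      ((∀ (i : ℕ) (h : i + 1 < n), toLex (u i, σ ⟨i, by omega⟩) < toLex (u (i + 1), σ ⟨i + 1, h⟩)) ↔
        ∀ i, i + 1 < n → w i < w (i + 1)) := by
    intro u w huw
    refine forall_congr' fun i => forall_congr' fun h => ?_
    have h1 := huw i (by omega)
    have h2 := huw (i + 1) h
    have hne : σ ⟨i, by omega⟩ ≠ σ ⟨i + 1, h⟩ := fun hc => by
      have := congrArg Fin.val (σ.injective hc)
      simp at this
    rw [Prod.Lex.toLex_lt_toLex]
    by_cases hi : desc i
    · have h3 := hD1 i hi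
      have h4 : ¬ σ ⟨i, by omega⟩ < σ ⟨i + 1, h⟩ := not_lt.2 hi.2.le
      simp only [h4, and_false, or_false]
      omega
    · have h3 := hD2 i hi
      have h4 : σ ⟨i, by omega⟩ < σ ⟨i + 1, h⟩ :=
        lt_of_le_of_ne (not_lt.1 fun hc => hi ⟨h, hc⟩) hne
      simp only [h4, and_true]
      omega
  have hsort : ∀ g : Fin n → Fin N, Tuple.sort g = σ ↔ ∀ (i : ℕ) (h : i + 1 < n),
      toLex ((g (σ ⟨i, by omega⟩) : ℕ), σ ⟨i, by omega⟩) <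
        toLex ((g (σ ⟨i + 1, h⟩) : ℕ), σ ⟨i + 1, h⟩) := by
    intro g
    rw [eq_sort_iff_strictMono, strictMono_fin_iff]
    refine forall_congr' fun i => forall_congr' fun h => ?_
    rw [Prod.Lex.toLex_lt_toLex, Prod.Lex.toLex_lt_toLex]
    simp only [Fin.lt_def, Fin.ext_iff]
  rw [hd, ← card_strictMono]
  -- The lower bound keeps the truncated subtraction in the inverse map genuine, and the upper bound
  -- keeps its values below N.
  have hub : ∀ (m : ℕ) (h : Fin n → Fin m), StrictMono h → ∀ i : Fin n,
      (i : ℕ) ≤ h i ∧ (h i : ℕ) + (n - 1 - i) < m := by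
    intro m h hh
    have hh' := strictMono_fin_iff.1 hh
    have up : ∀ (k i : ℕ) (hi : i + k < n),
        (h ⟨i, by omega⟩ : ℕ) + k ≤ h ⟨i + k, hi⟩ := by
      intro k i
      induction k with
      | zero => intro hi; exact le_rfl
      | succ k ih =>
        intro hi
        have h1 := ih (by omega)
        have h2 := hh' (i + k) hi
        rw [Fin.lt_def] at h2
        have h3 : (h ⟨i + (k + 1), hi⟩ : ℕ) = h ⟨i + k + 1, hi⟩ := rfl
        omega
    intro i
    have h1 := up i 0 (by omega)
    have h2 := up (n - 1 - i) i (by omega)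
    have h3 : (⟨0 + i, by omega⟩ : Fin n) = i := Fin.ext (zero_add _)
    rw [h3] at h1
    have h4 := (h ⟨i + (n - 1 - i), by omega⟩).2
    change (h i : ℕ) + _ ≤ _ at h2
    omega
  have hn : ∀ i : Fin n, D i ≤ i ∧ D i ≤ D n ∧ D n + i + 1 ≤ D i + n :=
    fun i => ⟨hle i, hlast i i.2⟩
  refine Finset.card_bij'
    (fun g _ i => ⟨g (σ i) + i - D i, by
      have := hn i; have := (g (σ i)).2; omega⟩)
    (fun h hh x => ⟨h (σ.symm x) + D (σ.symm x) - σ.symm x, by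
      have := hn (σ.symm x)
      have := hub _ h (Finset.mem_filter.1 hh).2 (σ.symm x)
      omega⟩)
    (fun g hg => ?_) (fun h hh => ?_) (fun g hg => ?_) (fun h hh => ?_)
  · rw [Finset.mem_filter] at hg ⊢
    refine ⟨Finset.mem_univ _, strictMono_fin_iff.2 ?_⟩
    have h1 := (key (fun i => if h : i < n then (g (σ ⟨i, h⟩) : ℕ) else 0)
      (fun i => (if h : i < n then (g (σ ⟨i, h⟩) : ℕ) else 0) + i - D i)
      (fun i hi => by have := hle i; omega)).1 (fun i h => by
        have := (hsort g).1 hg.2 i h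
        simpa [h, (by omega : i < n)] using this)
    intro i h
    have := h1 i h
    simp only [h, (by omega : i < n), dite_true] at this
    exact this
  · rw [Finset.mem_filter] at hh ⊢
    refine ⟨Finset.mem_univ _, (hsort _).2 ?_⟩
    have h1 := (key (fun i => (if hi : i < n then (h ⟨i, hi⟩ : ℕ) else 0) + D i - i)
      (fun i => if hi : i < n then (h ⟨i, hi⟩ : ℕ) else 0)
      (fun i hi => by
        have := (hub _ h hh.2 ⟨i, hi⟩).1
        simp only [hi, dite_true] at this ⊢
        omega)).2 (fun i hi => by
          have := strictMono_fin_iff.1 hh.2 i hi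
          simpa [hi, (by omega : i < n)] using this)
    intro i hi
    have := h1 i hi
    simp only [hi, (by omega : i < n), dite_true] at this
    simpa using this
  · funext x
    have := hn (σ.symm x)
    apply Fin.ext
    simp only [Equiv.apply_symm_apply]
    omega
  · funext i
    have h1 := hub _ h (Finset.mem_filter.1 hh).2 i
    apply Fin.ext
    simp only [Equiv.symm_apply_apply]
    omega

lemma descents_lt {n : ℕ} (σ : Equiv.Perm (Fin (n + 1))) : descents σ < n + 1 := by
  refine lt_of_lt_of_eq (Finset.card_lt_card (Finset.filter_ssubset.2
    ⟨Fin.last n, Finset.mem_univ _, ?_⟩)) (by simp)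
  rintro ⟨h, _⟩
  simp at h

variable (K : Type u) [Field K]

lemma eulerianCoeff_eq_zero {n k : ℕ} (h : n < k) (d : ℕ) : eulerianCoeff K n k d = 0 := by
  refine Polynomial.coeff_eq_zero_of_natDegree_lt (lt_of_le_of_lt ?_ h)
  refine (Polynomial.natDegree_C_mul_le _ _).trans ((Polynomial.natDegree_prod_le _ _).trans ?_)
  refine (Finset.sum_le_card_nsmul _ _ 1 fun j _ => ?_).trans (by simp)
  rw [sub_add, ← map_sub]
  exact Polynomial.natDegree_X_sub_C_le _

/-- The left side is the defining polynomial at x = N, a rising product of n factors from N - d to N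
- d + n - 1, divided by n!. For n > 0 the subtraction on the right is genuine because d < n. -/
lemma sum_eulerianCoeff [CharZero K] {n : ℕ} (N : ℕ) (σ : Equiv.Perm (Fin n)) :
    ∑ k ∈ Finset.range (n + 1), (N : K) ^ k * eulerianCoeff K n k (descents σ) =
      ((N + n - 1 - descents σ).choose n : K) := by
  have h1 : ∑ k ∈ Finset.range (n + 1), (N : K) ^ k * eulerianCoeff K n k (descents σ) =
      (Polynomial.C (n.factorial : K)⁻¹ * ∏ j ∈ Finset.range n,
        (Polynomial.X - Polynomial.C (descents σ : K) + Polynomial.C (j : K))).eval (N : K) := by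
    rw [Polynomial.eval_eq_sum_range' (n := n + 1)]
    · exact Finset.sum_congr rfl fun k _ => mul_comm _ _
    · refine Nat.lt_succ_iff.2 ?_
      rw [Polynomial.natDegree_le_iff_coeff_eq_zero]
      exact fun k hk => eulerianCoeff_eq_zero K hk _
  have h2 : (n.factorial : K) ≠ 0 := Nat.cast_ne_zero.2 n.factorial_ne_zero
  rw [h1, Polynomial.eval_mul, Polynomial.eval_C, Polynomial.eval_prod, inv_mul_eq_iff_eq_mul₀ h2,
    ← Nat.cast_mul, ← Nat.descFactorial_eq_factorial_mul_choose]
  cases n with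
  | zero => simp
  | succ n =>
    have hd := descents_lt σ
    generalize descents σ = d at hd
    rw [← descPochhammer_eval_eq_descFactorial, descPochhammer_eval_eq_prod_range,
      ← Finset.prod_range_reflect]
    refine Finset.prod_congr rfl fun j hj => ?_
    rw [Finset.mem_range] at hj
    rw [show N + (n + 1) - 1 - d = N + n - d by omega, Nat.cast_sub (by omega : d ≤ N + n),
      show n + 1 - 1 - j = n - j by omega, Nat.cast_sub (by omega : j ≤ n)]
    simp only [Polynomial.eval_add, Polynomial.eval_sub, Polynomial.eval_X, Polynomial.eval_C]
    push_cast
    ring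

end Counting

end DGHochschild

end

/-! ### Koszul signs, Adams operations and Eulerian idempotents -/

noncomputable section

namespace DGHochschild

section Koszul

/-- A symmetric function of two places is a function on two-element subsets, and τ permutes these.
-/
lemma prod_pairs_comp_perm {A : Type*} [CommMonoid A] {n : ℕ} (τ : Equiv.Perm (Fin n))
    (f : Fin n → Fin n → A) (hf : ∀ i j, f i j = f j i) :
    ∏ ij : Fin n × Fin n with ij.1 < ij.2, f (τ ij.1) (τ ij.2) =
      ∏ ij : Fin n × Fin n with ij.1 < ij.2, f ij.1 ij.2 := by
  have hne : ∀ (ρ : Equiv.Perm (Fin n)) {i j}, i < j → ρ i ≠ ρ j :=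
    fun ρ i j h e => h.ne (ρ.injective e)
  let r : Equiv.Perm (Fin n) → Fin n × Fin n → Fin n × Fin n := fun ρ ij =>
    if ρ ij.1 < ρ ij.2 then (ρ ij.1, ρ ij.2) else (ρ ij.2, ρ ij.1)
  have hr : ∀ ρ ij, ij.1 < ij.2 → (r ρ ij).1 < (r ρ ij).2 := by
    intro ρ ij h
    simp only [r]
    split_ifs with h1
    · exact h1
    · exact lt_of_le_of_ne (not_lt.1 h1) (hne ρ h).symm
  have hrr : ∀ (ρ ρ' : Equiv.Perm (Fin n)) ij, (∀ x, ρ' (ρ x) = x) → ij.1 < ij.2 →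
      r ρ' (r ρ ij) = ij := by
    intro ρ ρ' ij hρ h
    simp only [r]
    by_cases h1 : ρ ij.1 < ρ ij.2
    · simp [h1, hρ, h]
    · simp [h1, hρ, h.not_gt]
  refine Finset.prod_bij' (fun ij _ => r τ ij) (fun ij _ => r τ.symm ij)
    (fun ij h => by simpa using hr _ _ (by simpa using h))
    (fun ij h => by simpa using hr _ _ (by simpa using h))
    (fun ij h => hrr _ _ _ (by simp) (by simpa using h))
    (fun ij h => hrr _ _ _ (by simp) (by simpa using h)) (fun ij h => ?_)
  simp only [r]
  split_ifs
  · rfl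
  · exact hf _ _

lemma koszulSign_eq_prod_ite {n : ℕ} (σ : Equiv.Perm (Fin n)) (p : Fin n → ℤ) :
    koszulSign σ p = ∏ ij : Fin n × Fin n with ij.1 < ij.2,
      if σ ij.2 < σ ij.1 then sg ((p ij.1 - 1) * (p ij.2 - 1)) else 1 := by
  rw [koszulSign, ← Finset.prod_filter, Finset.filter_filter]

lemma koszulSign_one {n : ℕ} (p : Fin n → ℤ) : koszulSign 1 p = 1 := by
  rw [koszulSign_eq_prod_ite]
  refine Finset.prod_eq_one fun ij h => ?_
  rw [Finset.mem_filter] at h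
  rw [if_neg]
  exact h.2.not_gt

/-- A pair is inverted by σ τ exactly if one, and only one, of the following holds: τ inverts the
pair, or σ inverts its image under τ. If both hold, the sign occurs squared. -/
lemma koszulSign_mul {n : ℕ} (σ τ : Equiv.Perm (Fin n)) (p : Fin n → ℤ) :
    koszulSign (σ * τ) p = koszulSign τ p * koszulSign σ (fun i => p (τ.symm i)) := by
  -- The condition says that σ inverts the pair, in whichever order it is given; this makes f
  -- symmetric, so that its product can be reindexed by τ.
  let f : Fin n → Fin n → ℤ := fun i j =>
    if i ≠ j ∧ (i < j ↔ σ j < σ i) then sg ((p (τ.symm i) - 1) * (p (τ.symm j) - 1)) else 1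
  have hf : ∀ i j, f i j = f j i := by
    intro i j
    rcases eq_or_ne i j with rfl | hij
    · rfl
    · have h1 : σ i ≠ σ j := fun h => hij (σ.injective h)
      have h2 : (i < j ↔ σ j < σ i) ↔ (j < i ↔ σ i < σ j) := by
        rcases lt_or_gt_of_ne hij with h | h <;> rcases lt_or_gt_of_ne h1 with h' | h' <;>
          simp [h, h', h.not_gt, h'.not_gt]
      simp only [f, h2, ne_comm (a := i), mul_comm (p (τ.symm i) - 1)]
  have h1 : koszulSign σ (fun i => p (τ.symm i)) =
      ∏ ij : Fin n × Fin n with ij.1 < ij.2, f ij.1 ij.2 := by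
    rw [koszulSign_eq_prod_ite]
    refine Finset.prod_congr rfl fun ij h => ?_
    rw [Finset.mem_filter] at h
    simp [f, h.2, h.2.ne]
  rw [h1, ← prod_pairs_comp_perm τ f hf, koszulSign_eq_prod_ite, koszulSign_eq_prod_ite,
    ← Finset.prod_mul_distrib]
  refine Finset.prod_congr rfl fun ij h => ?_
  rw [Finset.mem_filter] at h
  have h2 : τ ij.1 ≠ τ ij.2 := fun e => h.2.ne (τ.injective e)
  have h3 : σ (τ ij.1) ≠ σ (τ ij.2) := fun e => h2 (σ.injective e)
  simp only [f, Equiv.Perm.mul_apply, Equiv.symm_apply_apply]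
  rcases lt_or_gt_of_ne h2 with h' | h' <;> rcases lt_or_gt_of_ne h3 with h'' | h'' <;>
    simp [h', h'', h'.not_gt, h''.not_gt, h2, sg_mul_self]

end Koszul

variable {K : Type u} [Field K]

section Action

variable {F : DGAlgebra.{u, v} K} (M : DGBimodule F)

/-- Multilinear maps `F^n → M`. -/
abbrev Multi (n : ℕ) : Type v := MultilinearMap K (fun _ : Fin n => (F : Type v)) M

/-- The multilinear map that agrees with `s p • c` on elements of degrees `p_0, …, p_{n-1}`. -/
def twist {n : ℕ} (s : (Fin n → ℤ) → ℤ) (c : Multi M n) : Multi M n :=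
  (MultilinearMap.fromDirectSumEquiv (R := K) (κ := fun _ : Fin n => ℤ)
    (M := fun _ i => F.gr i) (M' := M) fun p => s p • c.compLinearMap fun i => (F.gr (p i)).subtype)
    |>.compLinearMap fun _ => (DirectSum.decomposeLinearEquiv F.gr).toLinearMap

lemma twist_apply {n : ℕ} (s : (Fin n → ℤ) → ℤ) (c : Multi M n) {p : Fin n → ℤ} {a : Fin n → F}
    (ha : ∀ i, a i ∈ F.gr (p i)) : twist M s c a = s p • c a := by
  have h : ∀ i, DirectSum.decomposeLinearEquiv F.gr (a i) =
      DirectSum.lof K ℤ (fun i => F.gr i) (p i) ⟨a i, ha i⟩ :=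
    fun i => DirectSum.decomposeLinearEquiv_apply_coe F.gr (p i) ⟨a i, ha i⟩
  rw [twist, MultilinearMap.compLinearMap_apply]
  have h' : (fun i => (DirectSum.decomposeLinearEquiv F.gr).toLinearMap (a i)) = fun i =>
      DirectSum.lof K ℤ (fun i => F.gr i) (p i) ⟨a i, ha i⟩ := funext h
  rw [h', MultilinearMap.fromDirectSumEquiv_lof]
  rfl

/-- The graded action of a permutation on multilinear maps. -/
def permAct {n : ℕ} (σ : Equiv.Perm (Fin n)) : Module.End K (Multi M n) where
  toFun c := twist M (koszulSign σ) (c.domDomCongr σ.symm)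
  map_add' c c' := multilinear_ext fun p a ha => by
    rw [add_apply, twist_apply M _ _ ha, twist_apply M _ _ ha, twist_apply M _ _ ha]
    simp
  map_smul' r c := multilinear_ext fun p a ha => by
    rw [smul_apply, twist_apply M _ _ ha, twist_apply M _ _ ha]
    simp [smul_comm r]

lemma permAct_apply {n : ℕ} (σ : Equiv.Perm (Fin n)) (c : Multi M n) {p : Fin n → ℤ}
    {a : Fin n → F} (ha : ∀ i, a i ∈ F.gr (p i)) :
    permAct M σ c a = koszulSign σ p • c fun j => a (σ.symm j) :=
  twist_apply M _ _ ha

lemma permAct_one {n : ℕ} : permAct M (1 : Equiv.Perm (Fin n)) = 1 := by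
  ext1 c
  refine multilinear_ext fun p a ha => ?_
  rw [permAct_apply M _ _ ha, koszulSign_one, one_smul]
  rfl

/-- Precomposition turns the left action on tensors into a right action on functionals, hence the
reversed order. -/
lemma permAct_mul {n : ℕ} (σ τ : Equiv.Perm (Fin n)) :
    permAct M τ * permAct M σ = permAct M (σ * τ) := by
  ext1 c
  refine multilinear_ext fun p a ha => ?_
  rw [Module.End.mul_apply, permAct_apply M _ _ ha, permAct_apply M _ _ ha,
    permAct_apply M _ _ (fun i => ha (τ.symm i)), koszulSign_mul, mul_smul]
  rfl

/-- The action of the Eulerian idempotent `e_n(k)` on multilinear maps. -/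
def eulerian (n k : ℕ) : Module.End K (Multi M n) :=
  ∑ σ : Equiv.Perm (Fin n), eulerianCoeff K n k (descents σ) • permAct M σ

/-- The sum over all labellings of `n` letters by elements of `α` of the permutations that sort
them. -/
def adams (n : ℕ) (α : Type) [Fintype α] [LinearOrder α] : Module.End K (Multi M n) :=
  ∑ g : Fin n → α, permAct M (Tuple.sort g)

lemma sort_orderIso_comp {α β : Type*} [LinearOrder α] [LinearOrder β] (e : α ≃o β) {n : ℕ}
    (g : Fin n → α) : Tuple.sort (e ∘ g) = Tuple.sort g := by
  rw [eq_comm, Tuple.eq_sort_iff]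
  obtain ⟨h1, h2⟩ := Tuple.eq_sort_iff.1 (rfl : Tuple.sort g = Tuple.sort g)
  exact ⟨e.monotone.comp h1, fun i j hij h => h2 i j hij (e.injective h)⟩

lemma adams_congr (n : ℕ) {α β : Type} [Fintype α] [LinearOrder α] [Fintype β] [LinearOrder β]
    (e : α ≃o β) : adams M n α = adams M n β :=
  Fintype.sum_equiv (Equiv.arrowCongr (Equiv.refl (Fin n)) e.toEquiv) _ _ fun g =>
    congrArg (permAct M) (sort_orderIso_comp e g).symm

/-- Radix sort: sorting by the label in β and then, stably, by the label in α is sorting by the pair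
in lexicographic order. -/
lemma adams_mul (n : ℕ) (α β : Type) [Fintype α] [LinearOrder α] [Fintype β] [LinearOrder β] :
    adams M n α * adams M n β = adams M n (α ×ₗ β) := by
  simp only [adams, Finset.sum_mul_sum, permAct_mul]
  rw [Finset.sum_comm, ← Finset.sum_product']
  refine Finset.sum_bij'
    -- The labels in α belong to the places after the first sorting, so they are carried back to the
    -- original places.
    (fun gh _ i => toLex (gh.2 ((Tuple.sort gh.1).symm i), gh.1 i))
    (fun k _ => (fun i => (ofLex (k i)).2,
      fun i => (ofLex (k (Tuple.sort (fun i => (ofLex (k i)).2) i))).1))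
    (fun _ _ => Finset.mem_univ _) (fun _ _ => Finset.mem_univ _) (fun gh _ => ?_) (fun k _ => ?_)
    (fun gh _ => ?_)
  · refine Prod.ext rfl (funext fun i => ?_)
    simp
  · funext i
    simp
  · obtain ⟨g, h⟩ := gh
    congr 1
    rw [Tuple.eq_sort_iff]
    obtain ⟨hg1, hg2⟩ := Tuple.eq_sort_iff.1 (rfl : Tuple.sort g = Tuple.sort g)
    obtain ⟨hh1, hh2⟩ := Tuple.eq_sort_iff.1 (rfl : Tuple.sort h = Tuple.sort h)
    refine ⟨fun i j hij => ?_, fun i j hij e => ?_⟩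
    · rcases hij.eq_or_lt with rfl | hij
      · rfl
      · refine Prod.Lex.toLex_le_toLex.2 ?_
        simp only [Equiv.Perm.mul_apply, Equiv.symm_apply_apply]
        rcases (hh1 hij.le).lt_or_eq with h1 | h1
        · exact Or.inl h1
        · exact Or.inr ⟨h1, hg1 (hh2 i j hij h1).le⟩
    · have e' := Prod.ext_iff.1 (toLex_inj.1 e)
      simp only [Equiv.Perm.mul_apply, Equiv.symm_apply_apply] at e' ⊢
      exact hg2 _ _ (hh2 i j hij e'.1) e'.2

lemma adams_one (n : ℕ) : adams M n (Fin 1) = 1 := by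
  rw [adams, Fintype.sum_unique, ← permAct_one]
  congr 1
  rw [eq_comm, Tuple.eq_sort_iff]
  exact ⟨fun _ _ _ => (Subsingleton.elim _ _).le, fun i j h _ => h⟩

lemma eulerian_eq_zero {n k : ℕ} (h : n < k) : eulerian M n k = 0 :=
  Finset.sum_eq_zero fun σ _ => by rw [eulerianCoeff_eq_zero K h, zero_smul]

variable [CharZero K]

/-- Labellings are grouped by their sorting permutation. The size of a group, a binomial
coefficient, is the value at N of the polynomial whose coefficients define the Eulerian idempotents.
-/
lemma adams_eq_sum_eulerian (n N : ℕ) :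
    adams M n (Fin N) = ∑ k ∈ Finset.range (n + 1), (N : K) ^ k • eulerian M n k := by
  have h1 : adams M n (Fin N) = ∑ σ : Equiv.Perm (Fin n),
      ((N + n - 1 - descents σ).choose n : K) • permAct M σ := by
    rw [adams, ← Finset.sum_fiberwise Finset.univ (fun g : Fin n → Fin N => Tuple.sort g)]
    refine Finset.sum_congr rfl fun σ _ => ?_
    rw [← card_sort_eq N σ, Finset.sum_congr rfl (g := fun _ => permAct M σ)
      (fun g hg => by rw [(Finset.mem_filter.1 hg).2]), Finset.sum_const, Nat.cast_smul_eq_nsmul]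
  rw [h1]
  simp only [eulerian, Finset.smul_sum, smul_smul]
  rw [Finset.sum_comm]
  refine Finset.sum_congr rfl fun σ _ => ?_
  rw [← Finset.sum_smul, sum_eulerianCoeff]

lemma sum_eulerian (n : ℕ) : ∑ k ∈ Finset.range (n + 1), eulerian M n k = 1 := by
  have := adams_eq_sum_eulerian M n 1
  rw [adams_one] at this
  simpa using this.symm

/-- A polynomial with vector coefficients that vanishes at all natural numbers is zero. -/
lemma eq_of_sum_pow_smul_eq {V : Type*} [AddCommGroup V] [Module K V] {n : ℕ} {x y : ℕ → V}
    (h : ∀ N : ℕ, ∑ k ∈ Finset.range n, (N : K) ^ k • x k =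
      ∑ k ∈ Finset.range n, (N : K) ^ k • y k) {k : ℕ} (hk : k < n) : x k = y k := by
  rw [← sub_eq_zero, ← Module.forall_dual_apply_eq_zero_iff K]
  intro f
  let P : Polynomial K := ∑ k ∈ Finset.range n, Polynomial.monomial k (f (x k - y k))
  have hP : P = 0 := by
    refine Polynomial.eq_zero_of_infinite_isRoot P
      ((Set.infinite_range_of_injective (Nat.cast_injective (R := K))).mono ?_)
    rintro _ ⟨N, rfl⟩
    have := congrArg f (h N)
    rw [← sub_eq_zero, ← map_sub, ← Finset.sum_sub_distrib, map_sum] at this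
    simp only [← smul_sub, map_smul] at this
    simp only [P, Set.mem_ofPred_eq, Polynomial.IsRoot, Polynomial.eval_finsetSum,
      Polynomial.eval_monomial]
    rw [← this]
    exact Finset.sum_congr rfl fun k _ => mul_comm _ _
  have := congrArg (fun P => Polynomial.coeff P k) hP
  simpa [P, Polynomial.coeff_monomial, hk] using this

/-- Multiplicativity of the Adams operations reads ∑ N^i N'^j e_i e_j = ∑ (N N')^k e_k. It holds for
all natural N and N', so in characteristic 0 coefficients may be compared, first in N' and then in
N. -/
lemma eulerian_mul (n i j : ℕ) :
    eulerian M n i * eulerian M n j = if i = j then eulerian M n i else 0 := by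
  rcases lt_or_ge n i with hi | hi
  · simp [eulerian_eq_zero M hi]
  rcases lt_or_ge n j with hj | hj
  · rw [eulerian_eq_zero M hj, mul_zero, if_neg (by omega)]
  have hprod : ∀ N N' : ℕ, adams M n (Fin N) * adams M n (Fin N') = adams M n (Fin (N * N')) := by
    intro N N'
    rw [adams_mul]
    exact adams_congr M n (Fintype.orderIsoFinOfCardEq _ (by simp [Lex, Fintype.card_prod])).symm
  have h1 : ∀ N : ℕ, eulerian M n i * adams M n (Fin N) = (N : K) ^ i • eulerian M n i := by
    intro N
    refine eq_of_sum_pow_smul_eq (K := K) (n := n + 1)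
      (x := fun k => eulerian M n k * adams M n (Fin N))
      (y := fun k => (N : K) ^ k • eulerian M n k) (fun N' => ?_) (Nat.lt_succ_iff.2 hi)
    have := hprod N' N
    rw [adams_eq_sum_eulerian M n N', adams_eq_sum_eulerian M n (N' * N), Finset.sum_mul] at this
    simpa only [smul_mul_assoc, Nat.cast_mul, mul_pow, mul_smul] using this
  refine eq_of_sum_pow_smul_eq (K := K) (n := n + 1)
    (x := fun k => eulerian M n i * eulerian M n k)
    (y := fun k => if i = k then eulerian M n i else 0) (fun N => ?_) (Nat.lt_succ_iff.2 hj)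
  have := h1 N
  rw [adams_eq_sum_eulerian, Finset.mul_sum] at this
  simp only [mul_smul_comm] at this
  rw [this]
  simp only [smul_ite, smul_zero, Finset.sum_ite_eq, Finset.mem_range, Nat.lt_succ_iff, hi,
    if_true]

/-- The action of an Eulerian idempotent is the projection to an eigenspace of the second Adams
operation. -/
lemma eulerian_apply_eq_self_iff {n k : ℕ} (hk : k ≤ n) (c : Multi M n) :
    eulerian M n k c = c ↔ adams M n (Fin 2) c = (2 : K) ^ k • c := by
  rw [adams_eq_sum_eulerian]
  simp only [LinearMap.sum_apply, LinearMap.smul_apply, Nat.cast_ofNat]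
  have hij : ∀ i j, eulerian M n i (eulerian M n j c) = if i = j then eulerian M n i c else 0 := by
    intro i j
    rw [← Module.End.mul_apply, eulerian_mul]
    split_ifs <;> rfl
  constructor
  · intro h
    rw [← h]
    simp only [hij]
    simp [Finset.sum_ite_eq', Nat.lt_succ_iff.2 hk]
  · intro h
    -- Applying e_j to the eigenvalue equation gives (2^j - 2^k) e_j c = 0, and the powers of 2 are
    -- distinct in characteristic 0.
    have h1 : ∀ j ∈ Finset.range (n + 1), j ≠ k → eulerian M n j c = 0 := by
      intro j hj hjk
      have h2 := congrArg (eulerian M n j) h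
      rw [map_sum] at h2
      simp only [map_smul, hij, smul_ite, smul_zero] at h2
      rw [Finset.sum_ite_eq, if_pos hj, ← sub_eq_zero, ← sub_smul, smul_eq_zero] at h2
      refine h2.resolve_left (sub_ne_zero.2 fun h3 => hjk ?_)
      exact Nat.pow_right_injective le_rfl (by exact_mod_cast h3)
    have h2 := congrArg (fun f : Module.End K (Multi M n) => f c) (sum_eulerian M n)
    simp only [LinearMap.sum_apply, Module.End.one_apply] at h2
    rwa [Finset.sum_eq_single_of_mem k (Finset.mem_range.2 (Nat.lt_succ_iff.2 hk)) h1] at h2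

end Action

end DGHochschild

end

/-! ### Words, signed shuffles and the bar differential -/

noncomputable section

set_option linter.unusedSimpArgs false

namespace DGHochschild

lemma sg_eq_sg {a b : ℤ} (h : (a : ZMod 2) = (b : ZMod 2)) : sg a = sg b := by
  obtain ⟨c, hc⟩ := (ZMod.intCast_eq_intCast_iff_dvd_sub a b 2).1 h
  have : b = a + (2 : ℕ) * c := by omega
  rw [this, sg_add]
  simp [sg, Int.negOnePow_two_mul]

lemma sg_smul_sg_smul {A : Type*} [AddCommGroup A] (a b : ℤ) (x : A) :
    sg a • sg b • x = sg (a + b) • x := by rw [smul_smul, sg_add]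

lemma sg_smul_self {A : Type*} [AddCommGroup A] (a : ℤ) (x : A) : sg a • sg a • x = x := by
  rw [smul_smul, sg_mul_self, one_smul]

lemma sg_smul_left_comm {A : Type*} [AddCommGroup A] (a b : ℤ) (x : A) :
    sg a • sg b • x = sg b • sg a • x := smul_comm _ _ _

/-- Letters with an integral degree, a product and a differential of degree `1`. -/
structure GradedLetters (X : Type*) where
  deg : X → ℤ
  mul : X → X → X
  d : X → X
  deg_mul : ∀ x y, deg (mul x y) = deg x + deg y + 1
  deg_d : ∀ x, deg (d x) = deg x + 1

namespace GradedLetters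

variable {X : Type*} (S : GradedLetters X) {A : Type*} [AddCommGroup A]

/-- The degree of a word. -/
def wdeg (u : List X) : ℤ := (u.map S.deg).sum

@[simp] lemma wdeg_nil : S.wdeg [] = 0 := rfl
@[simp] lemma wdeg_cons (x : X) (u : List X) : S.wdeg (x :: u) = S.deg x + S.wdeg u := rfl

/-- The value of the functional `f` on the signed shuffle product of two words. -/
def shuffle : (List X → A) → List X → List X → A
  | f, [], v => f v
  | f, x :: u, [] => f (x :: u)
  | f, x :: u, y :: v => shuffle (fun w => f (x :: w)) u (y :: v) +
      sg (S.deg y * (S.deg x + S.wdeg u)) • shuffle (fun w => f (y :: w)) (x :: u) v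
  termination_by _ u v => u.length + v.length

@[simp] lemma shuffle_nil_left (f : List X → A) (v : List X) : S.shuffle f [] v = f v := by
  rw [shuffle]

@[simp] lemma shuffle_nil_right (f : List X → A) (u : List X) : S.shuffle f u [] = f u := by
  cases u <;> rw [shuffle]

lemma shuffle_cons_cons (f : List X → A) (x y : X) (u v : List X) :
    S.shuffle f (x :: u) (y :: v) = S.shuffle (fun w => f (x :: w)) u (y :: v) +
      sg (S.deg y * (S.deg x + S.wdeg u)) • S.shuffle (fun w => f (y :: w)) (x :: u) v := by
  rw [shuffle]

/-- Induction on the total length of two words. -/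
lemma words_induction {P : List X → List X → Prop} (nil_left : ∀ v, P [] v)
    (nil_right : ∀ x u, P (x :: u) [])
    (cons_cons : ∀ x u y v, P u (y :: v) → P (x :: u) v → P (x :: u) (y :: v)) (u v : List X) :
    P u v := by
  induction u generalizing v with
  | nil => exact nil_left v
  | cons x u ih =>
    induction v with
    | nil => exact nil_right x u
    | cons y v ih' => exact cons_cons x u y v (ih _) ih'

lemma shuffle_map {B : Type*} [AddCommGroup B] (h : A →+ B) (f : List X → A) (u v : List X) :
    S.shuffle (fun w => h (f w)) u v = h (S.shuffle f u v) := by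
  induction u, v using words_induction generalizing f with
  | nil_left v => simp
  | nil_right x u => simp
  | cons_cons x u y v h1 h2 =>
    rw [shuffle_cons_cons, shuffle_cons_cons, map_add, map_zsmul, h1 fun w => f (x :: w),
      h2 fun w => f (y :: w)]

lemma shuffle_add (f g : List X → A) (u v : List X) :
    S.shuffle (fun w => f w + g w) u v = S.shuffle f u v + S.shuffle g u v := by
  induction u, v using words_induction generalizing f g with
  | nil_left v => simp
  | nil_right x u => simp
  | cons_cons x u y v h1 h2 =>
    rw [shuffle_cons_cons, shuffle_cons_cons, shuffle_cons_cons,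
      h1 (fun w => f (x :: w)) fun w => g (x :: w), h2 (fun w => f (y :: w)) fun w => g (y :: w),
      smul_add]
    abel

lemma shuffle_zsmul (r : ℤ) (f : List X → A) (u v : List X) :
    S.shuffle (fun w => r • f w) u v = r • S.shuffle f u v :=
  S.shuffle_map (zsmulAddGroupHom r) f u v

/-- The sum of the values of `G` on all pairs of words whose concatenation is the given word. -/
def cut : (List X → List X → A) → List X → A
  | G, [] => G [] []
  | G, x :: w => G [] (x :: w) + cut (fun u v => G (x :: u) v) w

lemma cut_nil (G : List X → List X → A) : cut G [] = G [] [] := rfl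
lemma cut_cons (G : List X → List X → A) (x : X) (w : List X) :
    cut G (x :: w) = G [] (x :: w) + cut (fun u v => G (x :: u) v) w := rfl

lemma cut_add (G H : List X → List X → A) (w : List X) :
    cut (fun u v => G u v + H u v) w = cut G w + cut H w := by
  induction w generalizing G H with
  | nil => rfl
  | cons x w ih =>
    rw [cut_cons, cut_cons, cut_cons, ih (fun u v => G (x :: u) v) fun u v => H (x :: u) v]
    abel

lemma cut_map {B : Type*} [AddCommGroup B] (h : A →+ B) (G : List X → List X → A) (w : List X) :
    cut (fun u v => h (G u v)) w = h (cut G w) := by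
  induction w generalizing G with
  | nil => rfl
  | cons x w ih => rw [cut_cons, cut_cons, map_add, ih fun u v => G (x :: u) v]

lemma cut_zsmul (r : ℤ) (G : List X → List X → A) (w : List X) :
    cut (fun u v => r • G u v) w = r • cut G w :=
  cut_map (zsmulAddGroupHom r) G w

lemma cut_eq_sum (G : List X → List X → A) (w : List X) :
    cut G w = ∑ k ∈ Finset.range (w.length + 1), G (w.take k) (w.drop k) := by
  induction w generalizing G with
  | nil => simp [cut_nil]
  | cons x w ih =>
    rw [cut_cons, ih, List.length_cons, Finset.sum_range_succ' _ (w.length + 1)]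
    simp [add_comm]

/-- The part of the bar differential that involves the first letter. -/
def head (x : X) (f : List X → A) (w : List X) : A :=
  sg (S.deg x) • f (S.d x :: w) + match w with
    | [] => 0
    | z :: w => f (S.mul x z :: w)

/-- The bar differential, acting on functionals on words. -/
def bar : (List X → A) → List X → A
  | _, [] => 0
  | f, x :: w => sg (S.deg x) • (S.head x f w + bar (fun w => f (x :: w)) w)

lemma bar_nil (f : List X → A) : S.bar f [] = 0 := rfl
lemma bar_cons (f : List X → A) (x : X) (w : List X) :
    S.bar f (x :: w) = sg (S.deg x) • (S.head x f w + S.bar (fun w => f (x :: w)) w) := rfl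

lemma head_nil (x : X) (f : List X → A) : S.head x f [] = sg (S.deg x) • f [S.d x] :=
  add_zero _
lemma head_cons (x z : X) (f : List X → A) (w : List X) :
    S.head x f (z :: w) = sg (S.deg x) • f (S.d x :: z :: w) + f (S.mul x z :: w) := rfl

lemma head_add (x : X) (f g : List X → A) (w : List X) :
    S.head x (fun w => f w + g w) w = S.head x f w + S.head x g w := by
  cases w <;> simp only [head_nil, head_cons, smul_add]
  abel

lemma bar_add (f g : List X → A) (w : List X) :
    S.bar (fun w => f w + g w) w = S.bar f w + S.bar g w := by
  induction w generalizing f g with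
  | nil => simp [bar_nil]
  | cons x w ih =>
    rw [bar_cons, bar_cons, bar_cons, ih (fun w => f (x :: w)) fun w => g (x :: w), head_add,
      ← smul_add]
    congr 1
    abel

lemma head_sign (k r : ℤ) (x : X) (f : List X → A) (w : List X) :
    S.head x (fun w => sg (r + k * S.wdeg w) • f w) w =
      sg (r + k * (S.deg x + S.wdeg w + 1)) • S.head x f w := by
  cases w <;> simp only [head_nil, head_cons, smul_add, wdeg_cons, wdeg_nil, S.deg_mul, S.deg_d,
    sg_smul_sg_smul]
  · congr 2; ring
  · congr 3 <;> ring

/-- The bar differential raises the degree of a word by one, so a sign that depends on the degree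
passes through it with this shift. -/
lemma bar_sign (k r : ℤ) (f : List X → A) (w : List X) :
    S.bar (fun w => sg (r + k * S.wdeg w) • f w) w =
      sg (r + k * (S.wdeg w + 1)) • S.bar f w := by
  induction w generalizing f r with
  | nil => simp [bar_nil]
  | cons x w ih =>
    rw [bar_cons, bar_cons, head_sign]
    have h1 : (fun w => sg (r + k * S.wdeg (x :: w)) • f (x :: w)) =
        fun w => sg ((r + k * S.deg x) + k * S.wdeg w) • f (x :: w) := by
      funext w
      rw [wdeg_cons]
      congr 2
      ring
    rw [h1, ih, wdeg_cons, show r + k * S.deg x + k * (S.wdeg w + 1) =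
      r + k * (S.deg x + S.wdeg w + 1) by ring, ← smul_add, smul_comm]

/-- Functionals that are symmetric with respect to the order of the factors of a product. -/
def IsSymm (f : List X → A) : Prop :=
  ∀ u x y v, f (u ++ S.mul y x :: v) =
    sg ((S.deg x + 1) * (S.deg y + 1)) • f (u ++ S.mul x y :: v)

variable {S} in
lemma IsSymm.cons {f : List X → A} (hf : S.IsSymm f) (x : X) : S.IsSymm fun w => f (x :: w) :=
  fun u => hf (x :: u)

/-- After x the shuffle continues with a letter of u or with y. The first two terms are the
differential at the head of x :: u, without the shuffles in which y comes to the front; the last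
term is the new product x y of letters from different words. -/
lemma shuffle_head_left (f : List X → A) (x y : X) (u v : List X) :
    S.shuffle (S.head x f) u (y :: v) = S.head x (fun u => S.shuffle f u (y :: v)) u
      - sg (S.deg y * (S.deg x + S.wdeg u + 1)) •
          S.head x (fun u => S.shuffle (fun w => f (y :: w)) u v) u
      + sg (S.deg y * S.wdeg u) • S.shuffle (fun w => f (S.mul x y :: w)) u v := by
  cases u with
  | nil =>
    simp only [shuffle_nil_left, head_nil, head_cons, shuffle_cons_cons, wdeg_nil, S.deg_d,
      mul_add, add_mul, mul_one, one_mul, mul_zero, zero_mul, add_zero, sg_zero, sg_add, sg_one,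
      mul_smul, smul_add, smul_sub, neg_smul, one_smul, smul_neg, neg_neg, mul_comm, sg_smul_self, sg_smul_left_comm]
    abel
  | cons z u =>
    have h : ∀ z, (fun w => S.head x f (z :: w)) = fun w =>
      sg (S.deg x) • f (S.d x :: z :: w) + f (S.mul x z :: w) := fun _ => rfl
    simp only [shuffle_cons_cons, h, shuffle_add, shuffle_zsmul, head_cons, wdeg_cons, S.deg_d,
      S.deg_mul, mul_add, add_mul, mul_one, one_mul, mul_zero, zero_mul, add_zero, sg_zero, sg_add, sg_one,
      mul_smul, smul_add, smul_sub, neg_smul, one_smul, smul_neg, neg_neg, mul_comm, sg_smul_self, sg_smul_left_comm]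
    abel

/-- The mirror image of `shuffle_head_left`; here the product of letters from different words is y
x. -/
lemma shuffle_head_right (f : List X → A) (x y : X) (u v : List X) :
    S.shuffle (S.head y f) (x :: u) v = sg ((S.deg y + 1) * (S.deg x + S.wdeg u)) •
        (S.head y (fun v => S.shuffle f (x :: u) v) v
          - S.head y (fun v => S.shuffle (fun w => f (x :: w)) u v) v)
      + S.shuffle (fun w => f (S.mul y x :: w)) u v := by
  cases v with
  | nil =>
    simp only [shuffle_nil_right, head_nil, head_cons, shuffle_cons_cons, S.deg_d, mul_add,
      add_mul, mul_one, one_mul, mul_zero, zero_mul, add_zero, sg_zero, sg_add, sg_one,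
      mul_smul, smul_add, smul_sub, neg_smul, one_smul, smul_neg, neg_neg, mul_comm, sg_smul_self, sg_smul_left_comm]
    abel
  | cons z v =>
    have h : ∀ z, (fun w => S.head y f (z :: w)) = fun w =>
      sg (S.deg y) • f (S.d y :: z :: w) + f (S.mul y z :: w) := fun _ => rfl
    simp only [shuffle_cons_cons, h, shuffle_add, shuffle_zsmul, head_cons, S.deg_d,
      S.deg_mul, mul_add, add_mul, mul_one, one_mul, mul_zero, zero_mul, add_zero, sg_zero, sg_add, sg_one,
      mul_smul, smul_add, smul_sub, neg_smul, one_smul, smul_neg, neg_neg, mul_comm, sg_smul_self, sg_smul_left_comm]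
    abel

/-- The bar differential is a derivation of the shuffle product. -/
lemma shuffle_bar {f : List X → A} (hf : S.IsSymm f) (u v : List X) :
    S.shuffle (S.bar f) u v = S.bar (fun u => S.shuffle f u v) u +
      sg (S.wdeg u) • S.bar (fun v => S.shuffle f u v) v := by
  induction u, v using words_induction generalizing f with
  | nil_left v => simp [bar_nil]
  | nil_right x u => simp [bar_nil]
  | cons_cons x u y v h1 h2 =>
    have e : ∀ z, (fun w => S.bar f (z :: w)) = fun w =>
      sg (S.deg z) • (S.head z f w + S.bar (fun w => f (z :: w)) w) := fun _ => rfl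
    -- Commutativity enters here: the products x y and y x of letters from different words cancel.
    have hs : S.shuffle (fun w => f (S.mul y x :: w)) u v =
        sg ((S.deg x + 1) * (S.deg y + 1)) • S.shuffle (fun w => f (S.mul x y :: w)) u v := by
      rw [← shuffle_zsmul]
      exact congrArg (fun g => S.shuffle g u v) (funext fun w => hf [] x y w)
    have b1 : S.bar (fun u => S.shuffle f (x :: u) (y :: v)) u =
        S.bar (fun u => S.shuffle (fun w => f (x :: w)) u (y :: v)) u +
          sg (S.deg y * (S.deg x + S.wdeg u + 1)) •
            S.bar (fun u => S.shuffle (fun w => f (y :: w)) (x :: u) v) u := by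
      have := S.bar_sign (S.deg y) (S.deg y * S.deg x)
        (fun u => S.shuffle (fun w => f (y :: w)) (x :: u) v) u
      simp only [shuffle_cons_cons, bar_add, mul_add] at this ⊢
      rw [this]
      congr 3
      ring
    have b2 : S.bar (fun v => S.shuffle f (x :: u) (y :: v)) v =
        S.bar (fun v => S.shuffle (fun w => f (x :: w)) u (y :: v)) v +
          sg (S.deg y * (S.deg x + S.wdeg u)) •
            S.bar (fun v => S.shuffle (fun w => f (y :: w)) (x :: u) v) v := by
      have := S.bar_sign 0 (S.deg y * (S.deg x + S.wdeg u))
        (fun v => S.shuffle (fun w => f (y :: w)) (x :: u) v) v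
      simp only [zero_mul, add_zero] at this
      simp only [shuffle_cons_cons, bar_add, this]
    rw [shuffle_cons_cons, e, e, shuffle_zsmul, shuffle_zsmul, shuffle_add, shuffle_add,
      h1 (hf.cons x), h2 (hf.cons y), bar_cons, bar_cons, bar_cons, bar_cons, b1, b2]
    erw [S.shuffle_head_left f x y u v, S.shuffle_head_right f x y u v]
    rw [hs]
    simp only [wdeg_cons, mul_add, add_mul, mul_one, one_mul, mul_zero, zero_mul, add_zero, sg_zero, sg_add, sg_one,
      mul_smul, smul_add, smul_sub, neg_smul, one_smul, smul_neg, neg_neg, mul_comm, sg_smul_self, sg_smul_left_comm]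
    abel

end GradedLetters

end DGHochschild

end

/-! ### Deconcatenation, the outer terms and the second Adams operation -/

noncomputable section

namespace DGHochschild

namespace GradedLetters

variable {X : Type*} (S : GradedLetters X) {A : Type*} [AddCommGroup A]

lemma cut_head (x : X) (G : List X → List X → A) (w : List X) :
    S.head x (cut G) w = S.head x (G []) w + cut (fun u v => S.head x (fun u => G u v) u) w := by
  cases w with
  | nil => simp only [head_nil, cut_cons, cut_nil, smul_add]
  | cons z w =>
    simp only [head_nil, head_cons, cut_cons, smul_add, cut_add, cut_zsmul]
    abel

/-- The bar differential is a coderivation for deconcatenation. -/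
lemma bar_cut (G : List X → List X → A) (w : List X) :
    S.bar (cut G) w = cut (fun u v => S.bar (fun u => G u v) u +
      sg (S.wdeg u) • S.bar (fun v => G u v) v) w := by
  induction w generalizing G with
  | nil => simp [bar_nil, cut_nil]
  | cons x w ih =>
    have h : (fun w => cut G (x :: w)) = fun w => G [] (x :: w) + cut (fun u v => G (x :: u) v) w :=
      rfl
    rw [bar_cons, h, bar_add, ih, cut_head, cut_cons]
    simp only [bar_nil, bar_cons, wdeg_nil, wdeg_cons, sg_zero, one_smul, zero_add, sg_add,
      mul_smul, smul_add, cut_add, cut_zsmul]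
    abel

/-- The functional on words that is concentrated at the empty word. -/
def emp (a : A) : List X → A
  | [] => a
  | _ :: _ => 0

@[simp] lemma emp_nil (a : A) : emp a ([] : List X) = a := rfl
@[simp] lemma emp_cons (a : A) (x : X) (w : List X) : emp a (x :: w) = 0 := rfl

lemma shuffle_emp_cons (a : A) (u : List X) (y : X) (v : List X) :
    S.shuffle (emp a) u (y :: v) = 0 := by
  have h : ∀ u v : List X, S.shuffle (fun _ => (0 : A)) u v = 0 := fun u v => by
    simpa using S.shuffle_map (0 : A →+ A) (fun _ => 0) u v
  cases u <;> simp [shuffle_cons_cons, h]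

lemma shuffle_emp_cons' (a : A) (x : X) (u v : List X) :
    S.shuffle (emp a) (x :: u) v = 0 := by
  cases v <;> simp [shuffle_emp_cons]

lemma cut_emp (G : List X → A) (w : List X) : cut (fun u v => emp (G v) u) w = G w := by
  have h : ∀ w : List X, cut (fun _ _ => (0 : A)) w = 0 := fun w => by
    simpa using cut_map (0 : A →+ A) (fun _ _ => 0) w
  cases w <;> simp [cut_nil, cut_cons, h]

/-- The twist of an action by a sign. -/
def tw (k : ℤ) (l : X → A →+ A) (z : X) : A →+ A := sg (k * S.deg z) • l z

lemma tw_apply (k : ℤ) (l : X → A →+ A) (z : X) (a : A) :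
    S.tw k l z a = sg (k * S.deg z) • l z a := rfl

lemma tw_zero (l : X → A →+ A) : S.tw 0 l = l := by
  funext z; simp [tw]

lemma tw_tw (j k : ℤ) (l : X → A →+ A) : S.tw j (S.tw k l) = S.tw (j + k) l := by
  funext z; simp [tw, add_mul, sg_add, mul_smul]

/-- The action of the first letter. -/
def left (l : X → A →+ A) (f : List X → A) : List X → A
  | [] => 0
  | x :: w => l x (f w)

/-- The action of the last letter, with the sign for moving it to the front. -/
def right (l : X → A →+ A) (f : List X → A) : List X → A
  | [] => 0
  | x :: w => right (S.tw (S.deg x) l) (fun w => f (x :: w)) w - emp (l x (f [])) w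

lemma left_nil (l : X → A →+ A) (f : List X → A) : left l f [] = 0 := rfl
lemma left_cons (l : X → A →+ A) (f : List X → A) (x : X) (w : List X) :
    left l f (x :: w) = l x (f w) := rfl
lemma right_nil (l : X → A →+ A) (f : List X → A) : S.right l f [] = 0 := rfl
lemma right_cons (l : X → A →+ A) (f : List X → A) (x : X) (w : List X) :
    S.right l f (x :: w) =
      S.right (S.tw (S.deg x) l) (fun w => f (x :: w)) w - emp (l x (f [])) w := rfl

lemma emp_add (a b : A) (w : List X) : emp (a + b) w = emp a w + emp b w := by
  cases w <;> simp

lemma emp_zsmul (r : ℤ) (a : A) (w : List X) : emp (r • a) w = r • emp a w := by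
  cases w <;> simp

lemma right_add (l : X → A →+ A) (f g : List X → A) (w : List X) :
    S.right l (fun w => f w + g w) w = S.right l f w + S.right l g w := by
  induction w generalizing l f g with
  | nil => simp [right_nil]
  | cons x w ih =>
    rw [right_cons, right_cons, right_cons, ih _ (fun w => f (x :: w)) fun w => g (x :: w),
      map_add, emp_add]
    abel

lemma right_sign (k r : ℤ) (l : X → A →+ A) (f : List X → A) (w : List X) :
    S.right l (fun w => sg (r + k * S.wdeg w) • f w) w =
      sg (r + k * S.wdeg w) • S.right (S.tw k l) f w := by
  induction w generalizing l f r with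
  | nil => simp [right_nil]
  | cons x w ih =>
    rw [right_cons, right_cons]
    have h1 : (fun w => sg (r + k * S.wdeg (x :: w)) • f (x :: w)) =
        fun w => sg ((r + k * S.deg x) + k * S.wdeg w) • f (x :: w) := by
      funext w
      rw [wdeg_cons]
      congr 2
      ring
    rw [h1, ih, wdeg_cons, smul_sub, tw_tw, tw_tw, add_comm k,
      show r + k * S.deg x + k * S.wdeg w = r + k * (S.deg x + S.wdeg w) by ring]
    congr 1
    cases w with
    | nil =>
      simp only [emp_nil, wdeg_nil, tw_apply, map_zsmul, mul_zero, add_zero, sg_add, mul_smul,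
        sg_smul_self]
    | cons z w => simp

/-- A shuffle begins with the first letter of u or of v; in the second case that letter has passed
all of u, which is the twist. -/
lemma shuffle_left (l : X → A →+ A) (f : List X → A) (u v : List X) :
    S.shuffle (left l f) u v = left l (fun u => S.shuffle f u v) u +
      left (S.tw (S.wdeg u) l) (fun v => S.shuffle f u v) v := by
  cases u with
  | nil => simp [left_nil, tw_zero]
  | cons x u =>
    cases v with
    | nil => simp [left_nil]
    | cons y v =>
      rw [shuffle_cons_cons]
      simp only [left_cons, tw_apply]
      rw [S.shuffle_map (l x) f, S.shuffle_map (l y) f, wdeg_cons, mul_comm (S.deg y)]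

lemma shuffle_sub (f g : List X → A) (u v : List X) :
    S.shuffle (fun w => f w - g w) u v = S.shuffle f u v - S.shuffle g u v := by
  rw [eq_sub_iff_add_eq, ← shuffle_add]
  simp

/-- A shuffle ends with the last letter of u or of v. Moved to the front, the last letter of v
passes u as well, which is the twist; for the last letter of u the signs with v cancel. -/
lemma shuffle_right (l : X → A →+ A) (f : List X → A) (u v : List X) :
    S.shuffle (S.right l f) u v = S.right l (fun u => S.shuffle f u v) u +
      S.right (S.tw (S.wdeg u) l) (fun v => S.shuffle f u v) v := by
  induction u, v using words_induction generalizing l f with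
  | nil_left v => simp [right_nil, tw_zero]
  | nil_right x u => simp [right_nil]
  | cons_cons x u y v h1 h2 =>
    have b1 : S.right (S.tw (S.deg x) l) (fun u => S.shuffle f (x :: u) (y :: v)) u =
        S.right (S.tw (S.deg x) l) (fun u => S.shuffle (fun w => f (x :: w)) u (y :: v)) u +
          sg (S.deg y * (S.deg x + S.wdeg u)) • S.right (S.tw (S.deg x + S.deg y) l)
            (fun u => S.shuffle (fun w => f (y :: w)) (x :: u) v) u := by
      have := S.right_sign (S.deg y) (S.deg y * S.deg x) (S.tw (S.deg x) l)
        (fun u => S.shuffle (fun w => f (y :: w)) (x :: u) v) u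
      simp only [shuffle_cons_cons, right_add, mul_add] at this ⊢
      rw [this, tw_tw, add_comm (S.deg y)]
    have b2 : ∀ l : X → A →+ A, S.right l (fun v => S.shuffle f (x :: u) (y :: v)) v =
        S.right l (fun v => S.shuffle (fun w => f (x :: w)) u (y :: v)) v +
          sg (S.deg y * (S.deg x + S.wdeg u)) •
            S.right l (fun v => S.shuffle (fun w => f (y :: w)) (x :: u) v) v := by
      intro l
      have := S.right_sign 0 (S.deg y * (S.deg x + S.wdeg u)) l
        (fun v => S.shuffle (fun w => f (y :: w)) (x :: u) v) v
      simp only [zero_mul, add_zero, tw_zero] at this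
      simp only [shuffle_cons_cons, right_add, this]
    have e : ∀ z, (fun w => S.right l f (z :: w)) = fun w =>
        S.right (S.tw (S.deg z) l) (fun w => f (z :: w)) w - emp (l z (f [])) w := fun _ => rfl
    rw [shuffle_cons_cons, e, e, shuffle_sub, shuffle_sub, shuffle_emp_cons, shuffle_emp_cons',
      h1, h2, right_cons, right_cons, right_cons, right_cons, b1, b2]
    simp only [tw_tw, wdeg_cons, sub_zero, shuffle_nil_left, shuffle_nil_right, smul_add, smul_sub,
      tw_apply, emp_zsmul]
    have e1 : sg (S.deg y * (S.deg x + S.wdeg u)) • sg (S.deg y * S.deg x) •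
        emp (l x (f (y :: v))) u = emp (l x (f (y :: v))) u := by
      cases u with
      | nil => simp [sg_smul_self]
      | cons => simp
    rw [e1, add_comm (S.deg x) (S.deg y), add_comm (S.wdeg u) (S.deg x),
      add_comm (S.deg x + S.wdeg u) (S.deg y), mul_comm (S.deg y)]
    abel

lemma cut_left (l : X → A →+ A) (G : List X → List X → A) (w : List X) :
    cut (fun u v => left l (fun u => G u v) u) w = left l (cut G) w := by
  cases w with
  | nil => rfl
  | cons x w =>
    rw [cut_cons, left_nil, zero_add]
    exact cut_map (l x) G w

lemma cut_sub (G H : List X → List X → A) (w : List X) :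
    cut (fun u v => G u v - H u v) w = cut G w - cut H w := by
  rw [eq_sub_iff_add_eq, ← cut_add]
  simp

/-- The last letter of u at one cut is the first letter of v at the preceding cut. Its two actions
cancel because of the minus sign in `right`, and only the last letter of v, the last one of the
whole word, survives. -/
lemma right_cut (l : X → A →+ A) (G : List X → List X → A) (w : List X) :
    S.right l (cut G) w = cut (fun u v => S.right l (fun u => G u v) u +
      S.right (S.tw (S.wdeg u) l) (G u) v + left (S.tw (S.wdeg u) l) (G u) v) w := by
  induction w generalizing l G with
  | nil => simp [right_nil, left_nil, cut_nil]
  | cons x w ih =>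
    have h : (fun w => cut G (x :: w)) = fun w => G [] (x :: w) + cut (fun u v => G (x :: u) v) w :=
      rfl
    rw [right_cons, h, right_add, ih, cut_cons]
    simp only [right_nil, right_cons, left_cons, wdeg_nil, wdeg_cons, tw_zero, tw_tw, cut_nil,
      cut_add, cut_sub]
    rw [cut_emp (fun v => l x (G [] v)) w]
    simp only [add_comm (S.deg x)]
    abel

/-- The second Adams operation on functionals on words. -/
def psi (f : List X → A) : List X → A := cut (S.shuffle f)

/-- The Hochschild differential on functionals on words. -/
def total (l : X → A →+ A) (f : List X → A) (w : List X) : A :=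
  S.bar f w + left l f w + S.right l f w

/-- The differential is pushed through the shuffle product and then through deconcatenation. The
inner outer-action terms, right on u and left on v, are precisely those that `right_cut` absorbs. -/
theorem total_psi (l : X → A →+ A) {f : List X → A} (hf : S.IsSymm f) (w : List X) :
    S.total l (S.psi f) w = S.psi (S.total l f) w := by
  have h : S.shuffle (S.total l f) = fun u v => S.bar (fun u => S.shuffle f u v) u +
      sg (S.wdeg u) • S.bar (fun v => S.shuffle f u v) v + left l (fun u => S.shuffle f u v) u +
      (S.right l (fun u => S.shuffle f u v) u + S.right (S.tw (S.wdeg u) l) (S.shuffle f u) v +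
        left (S.tw (S.wdeg u) l) (S.shuffle f u) v) := by
    funext u v
    have : S.total l f = fun w => S.bar f w + left l f w + S.right l f w := rfl
    rw [this, shuffle_add, shuffle_add, S.shuffle_bar hf, shuffle_left, shuffle_right]
    abel
  rw [psi, psi, h, total, bar_cut, right_cut, ← cut_left, ← cut_add, ← cut_add]

end GradedLetters

end DGHochschild

end

/-! ### Labellings with two labels as shuffles -/

noncomputable section

namespace DGHochschild

/-- The extension of a permutation of `n` letters that moves the letter at the place `k` to the
first place. -/
def extendPerm {n : ℕ} (k : Fin (n + 1)) (σ : Equiv.Perm (Fin n)) : Equiv.Perm (Fin (n + 1)) :=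
  (finSuccEquiv' k).trans ((Equiv.optionCongr σ).trans (finSuccEquiv' 0).symm)

section ExtendPerm

variable {n : ℕ} (k : Fin (n + 1)) (σ : Equiv.Perm (Fin n))

@[simp] lemma extendPerm_self : extendPerm k σ k = 0 := by simp [extendPerm]
@[simp] lemma extendPerm_succAbove (j : Fin n) :
    extendPerm k σ (k.succAbove j) = (σ j).succ := by simp [extendPerm]
@[simp] lemma extendPerm_symm_zero : (extendPerm k σ).symm 0 = k := by
  rw [Equiv.symm_apply_eq, extendPerm_self]
@[simp] lemma extendPerm_symm_succ (j : Fin n) :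
    (extendPerm k σ).symm j.succ = k.succAbove (σ.symm j) := by
  rw [Equiv.symm_apply_eq, extendPerm_succAbove, Equiv.apply_symm_apply]

/-- In a stable sort the first place comes after the places with smaller label and before those with
equal label, so its rank is k. -/
lemma sort_cons {α : Type*} [LinearOrder α] (g : Fin n → α) (l : α)
    (hk : (k : ℕ) = (Finset.univ.filter fun j => g j < l).card) :
    Tuple.sort (Fin.cons l g : Fin (n + 1) → α) = extendPerm k (Tuple.sort g) := by
  have hm := Tuple.monotone_sort g
  have hcard : (Finset.univ.filter fun j => (g ∘ Tuple.sort g) j < l).card = k := by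
    rw [hk]
    exact Finset.card_bij (fun j _ => Tuple.sort g j) (by simp) (by simp)
      (fun j hj => ⟨(Tuple.sort g).symm j, by simpa using hj, by simp⟩)
  have hlt : ∀ j : Fin n, (j : ℕ) < k ↔ g (Tuple.sort g j) < l := fun j => by
    rw [← hcard]
    exact Tuple.lt_card_lt_iff_apply_lt_of_monotone hm
  have hs := eq_sort_iff_strictMono.1 (rfl : Tuple.sort g = Tuple.sort g)
  rw [eq_sort_iff_strictMono]
  intro i j hij
  rw [Prod.Lex.toLex_lt_toLex]
  induction i using Fin.succAboveCases k with
  | x =>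
    induction j using Fin.succAboveCases k with
    | x => exact absurd hij (lt_irrefl _)
    | p j =>
      rw [Fin.lt_succAbove_iff_le_castSucc] at hij
      have h := (hlt j).not.1 (not_lt.2 hij)
      simp only [extendPerm_self, extendPerm_succAbove, Fin.cons_zero, Fin.cons_succ]
      rcases (not_lt.1 h).lt_or_eq with h | h
      · exact Or.inl h
      · exact Or.inr ⟨h, Fin.succ_pos _⟩
  | p i =>
    induction j using Fin.succAboveCases k with
    | x =>
      rw [Fin.succAbove_lt_iff_castSucc_lt] at hij
      simp only [extendPerm_self, extendPerm_succAbove, Fin.cons_zero, Fin.cons_succ]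
      exact Or.inl ((hlt i).1 hij)
    | p j =>
      have := hs (Fin.succAbove_lt_succAbove_iff.1 hij)
      rw [Prod.Lex.toLex_lt_toLex] at this
      simpa using this

/-- The only inversions besides those of σ are between the letter that moves from place k to the
front and the letters it passes. -/
lemma koszulSign_extendPerm (p : Fin (n + 1) → ℤ) :
    koszulSign (extendPerm k σ) p =
      (∏ i : Fin n, if (i : ℕ) < k then sg ((p (k.succAbove i) - 1) * (p k - 1)) else 1) *
        koszulSign σ fun i => p (k.succAbove i) := by
  have h : ∀ (m : ℕ) (τ : Equiv.Perm (Fin m)) (q : Fin m → ℤ), koszulSign τ q =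
      ∏ i, ∏ j, if i < j ∧ τ j < τ i then sg ((q i - 1) * (q j - 1)) else 1 := by
    intro m τ q
    rw [koszulSign, Finset.prod_filter, ← Finset.univ_product_univ, Finset.prod_product]
  rw [h, h, Fin.prod_univ_succAbove _ k, Finset.prod_eq_one (by simp), one_mul,
    ← Finset.prod_mul_distrib]
  refine Finset.prod_congr rfl fun i _ => ?_
  rw [Fin.prod_univ_succAbove _ k]
  simp only [extendPerm_self, extendPerm_succAbove, Fin.succ_pos, and_true,
    Fin.succAbove_lt_succAbove_iff, Fin.succ_lt_succ_iff, Fin.succAbove_lt_iff_castSucc_lt]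
  rfl

end ExtendPerm

namespace GradedLetters

variable {X : Type*} (S : GradedLetters X) {A : Type*} [AddCommGroup A]

lemma ofFn_succAbove {n : ℕ} {a : Fin (n + 1) → X} {k : Fin (n + 1)} {u v : List X} {y : X}
    (h : List.ofFn a = u ++ y :: v) (hk : (k : ℕ) = u.length) :
    a k = y ∧ List.ofFn (fun i => a (k.succAbove i)) = u ++ v := by
  induction u generalizing n with
  | nil =>
    obtain rfl : k = 0 := Fin.ext hk
    rw [List.ofFn_succ, List.nil_append, List.cons.injEq] at h
    exact h
  | cons x u ih =>
    rw [List.ofFn_succ, List.cons_append, List.cons.injEq] at h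
    have hn : n ≠ 0 := by
      rintro rfl
      have := congrArg List.length h.2
      simp at this
    obtain ⟨n, rfl⟩ := Nat.exists_eq_succ_of_ne_zero hn
    obtain ⟨k, rfl⟩ := Fin.exists_succ_eq.2 (show k ≠ 0 by rintro rfl; simp at hk)
    obtain ⟨h1, h2⟩ := ih (k := k) h.2 (by simpa using hk)
    refine ⟨h1, ?_⟩
    rw [List.ofFn_succ, List.cons_append]
    simp only [Fin.succ_succAbove_zero, Fin.succ_succAbove_succ]
    rw [h.1, h2]

lemma prod_sg_wdeg {n : ℕ} {a : Fin n → X} {u v : List X} (h : List.ofFn a = u ++ v) (r : ℤ) :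
    (∏ i : Fin n, if (i : ℕ) < u.length then sg (S.deg (a i) * r) else 1) =
      sg (r * S.wdeg u) := by
  induction u generalizing n with
  | nil => simp
  | cons x u ih =>
    have hn : n ≠ 0 := by
      rintro rfl
      have := congrArg List.length h
      simp at this
    obtain ⟨n, rfl⟩ := Nat.exists_eq_succ_of_ne_zero hn
    rw [List.ofFn_succ, List.cons_append, List.cons.injEq] at h
    rw [Fin.prod_univ_succ]
    simp only [Fin.val_zero, Fin.val_succ, List.length_cons, Nat.add_lt_add_iff_right, ih h.2,
      Nat.zero_lt_succ, if_true, h.1, wdeg_cons, mul_add, sg_add, mul_comm (S.deg x)]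

/-- The number of letters with the label `0`. -/
def zeros {n : ℕ} (g : Fin n → Fin 2) : ℕ := (Finset.univ.filter fun j => g j < 1).card

lemma zeros_cons_zero {n : ℕ} (g : Fin n → Fin 2) :
    zeros (Fin.cons 0 g : Fin (n + 1) → Fin 2) = zeros g + 1 := by
  rw [zeros, zeros, Finset.card_filter, Finset.card_filter, Fin.sum_univ_succ]
  simp [add_comm]

lemma zeros_cons_one {n : ℕ} (g : Fin n → Fin 2) :
    zeros (Fin.cons 1 g : Fin (n + 1) → Fin 2) = zeros g := by
  rw [zeros, zeros, Finset.card_filter, Finset.card_filter, Fin.sum_univ_succ]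
  simp

lemma zeros_le {n : ℕ} (g : Fin n → Fin 2) : zeros g ≤ n :=
  (Finset.card_filter_le _ _).trans (by simp)

/-- The summand of the second Adams operation that is given by a labelling. -/
def term (f : List X → A) {n : ℕ} (a : Fin n → X) (g : Fin n → Fin 2) : A :=
  koszulSign (Tuple.sort g) (fun i => S.deg (a i) + 1) •
    f (List.ofFn fun j => a ((Tuple.sort g).symm j))

lemma term_cons (f : List X → A) {n : ℕ} (a : Fin (n + 1) → X) (g : Fin n → Fin 2) (l : Fin 2)
    (k : Fin (n + 1)) (hk : (k : ℕ) = (Finset.univ.filter fun j => g j < l).card) :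
    S.term f a (Fin.cons l g : Fin (n + 1) → Fin 2) =
      (∏ i : Fin n, if (i : ℕ) < k then sg (S.deg (a (k.succAbove i)) * S.deg (a k)) else 1) •
        S.term (fun w => f (a k :: w)) (fun i => a (k.succAbove i)) g := by
  rw [term, term, sort_cons k g l hk, koszulSign_extendPerm, mul_smul, List.ofFn_succ]
  simp

/-- A label says whether the next letter of the shuffle is taken from u (label 0) or from v (label
1). Splitting by the first label reproduces the recursion for the shuffle product. -/
lemma sum_term_eq_shuffle (f : List X → A) {n : ℕ} (a : Fin n → X) (u v : List X)
    (h : List.ofFn a = u ++ v) :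
    ∑ g : Fin n → Fin 2 with zeros g = u.length, S.term f a g = S.shuffle f u v := by
  induction n generalizing f u v with
  | zero =>
    rw [List.ofFn_zero, eq_comm, List.append_eq_nil_iff] at h
    obtain ⟨rfl, rfl⟩ := h
    rw [Finset.filter_true_of_mem (by simp [zeros]), Fintype.sum_unique]
    simp [term, koszulSign]
  | succ n ih =>
    rw [Finset.sum_filter, ← Equiv.sum_comp (Fin.consEquiv fun _ => Fin 2), Fintype.sum_prod_type,
      Fin.sum_univ_two]
    simp only [Fin.consEquiv, Equiv.coe_fn_mk, zeros_cons_zero, zeros_cons_one]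
    have hlen := congrArg List.length h
    rw [List.length_ofFn, List.length_append] at hlen
    have e1 : ∀ x u', u = x :: u' →
        (∑ g : Fin n → Fin 2, if zeros g + 1 = u.length then
          S.term f a (Fin.cons 0 g : Fin (n + 1) → Fin 2) else 0) =
        S.shuffle (fun w => f (x :: w)) u' v := by
      rintro x u' rfl
      obtain ⟨h1, h2⟩ := ofFn_succAbove (k := 0) (u := []) h rfl
      rw [← ih (fun w => f (x :: w)) (fun i => a (Fin.succAbove 0 i)) u' v h2, Finset.sum_filter]
      refine Finset.sum_congr rfl fun g _ => ?_
      rw [S.term_cons f a g 0 0 (by simp), h1]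
      simp
    have e2 : ∀ y v', v = y :: v' →
        (∑ g : Fin n → Fin 2, if zeros g = u.length then
          S.term f a (Fin.cons 1 g : Fin (n + 1) → Fin 2) else 0) =
        sg (S.deg y * S.wdeg u) • S.shuffle (fun w => f (y :: w)) u v' := by
      rintro y v' rfl
      rw [List.length_cons] at hlen
      -- The first letter of v stands directly after the word u.
      let k : Fin (n + 1) := ⟨u.length, by omega⟩
      obtain ⟨h1, h2⟩ := ofFn_succAbove (k := k) h rfl
      rw [← ih (fun w => f (y :: w)) (fun i => a (k.succAbove i)) u v' h2, Finset.sum_filter,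
        Finset.smul_sum]
      refine Finset.sum_congr rfl fun g _ => ?_
      split_ifs with hg
      · rw [S.term_cons f a g 1 k hg.symm, h1, S.prod_sg_wdeg h2]
      · rw [smul_zero]
    cases u with
    | nil =>
      cases v with
      | nil => simp at hlen
      | cons y v =>
        rw [e2 y v rfl, Finset.sum_eq_zero (by simp)]
        simp
    | cons x u =>
      rw [e1 x u rfl]
      cases v with
      | nil =>
        rw [Finset.sum_eq_zero]
        · simp
        · intro g _
          have := zeros_le g
          rw [if_neg]
          simp at hlen ⊢
          omega
      | cons y v => rw [e2 y v rfl, shuffle_cons_cons, wdeg_cons]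

/-- The number of labels 0 is the place of the cut. -/
lemma sum_term_eq_psi (f : List X → A) {n : ℕ} (a : Fin n → X) :
    ∑ g : Fin n → Fin 2, S.term f a g = S.psi f (List.ofFn a) := by
  rw [psi, cut_eq_sum, List.length_ofFn, ← Finset.sum_fiberwise_of_maps_to (g := zeros)
    (t := Finset.range (n + 1)) fun g _ => Finset.mem_range_succ_iff.2 (zeros_le g)]
  refine Finset.sum_congr rfl fun k hk => ?_
  rw [← S.sum_term_eq_shuffle f a _ _ (List.take_append_drop k _).symm, List.length_take,
    List.length_ofFn, min_eq_left (Finset.mem_range_succ_iff.1 hk)]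

end GradedLetters

end DGHochschild

end

/-! ### Hochschild cochains as functionals on words -/

noncomputable section

namespace DGHochschild

namespace GradedLetters

variable {X : Type*} (S : GradedLetters X) {A : Type*} [AddCommGroup A]

lemma right_zsmul (k : ℤ) (l : X → A →+ A) (f : List X → A) (w : List X) :
    S.right (fun z => k • l z) f w = k • S.right l f w := by
  induction w generalizing l f with
  | nil => simp [right_nil]
  | cons x w ih =>
    have h : S.tw (S.deg x) (fun z => k • l z) = fun z => k • S.tw (S.deg x) l z := by
      funext z
      exact smul_comm _ _ _
    rw [right_cons, right_cons, h, ih, smul_sub, AddMonoidHom.smul_apply, emp_zsmul]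

lemma psi_map {B : Type*} [AddCommGroup B] (h : A →+ B) (f : List X → A) (w : List X) :
    S.psi (fun w => h (f w)) w = h (S.psi f w) := by
  rw [psi, psi, ← cut_map]
  congr 1
  funext u v
  exact S.shuffle_map h f u v

lemma psi_add (f g : List X → A) (w : List X) :
    S.psi (fun w => f w + g w) w = S.psi f w + S.psi g w := by
  rw [psi, psi, psi, ← cut_add]
  congr 1
  funext u v
  exact S.shuffle_add f g u v

end GradedLetters

variable {K : Type u} [Field K] {F : DGAlgebra.{u, v} K}

variable (F) in
/-- Homogeneous elements of a differential graded algebra, with the degrees of `F[1]`. -/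
def letters : GradedLetters (Σ i, F.gr i) where
  deg x := x.1 - 1
  mul x y := ⟨x.1 + y.1, x.2.1 * y.2.1, SetLike.mul_mem_graded x.2.2 y.2.2⟩
  d x := ⟨x.1 + 1, F.d x.2.1, F.d_mem x.2.2⟩
  deg_mul _ _ := by ring
  deg_d _ := by ring

lemma letters_deg (x : Σ i, F.gr i) : (letters F).deg x = x.1 - 1 := rfl

variable (M : DGBimodule F)

/-- The functional on words of homogeneous elements that is given by a family of multilinear
maps. -/
def ev : Fam M → List (Σ i, F.gr i) → M
  | c, [] => c 0 Fin.elim0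
  | c, x :: w => ev (lc M x.2.1 c) w

lemma ev_cons (c : Fam M) (x : Σ i, F.gr i) (w : List (Σ i, F.gr i)) :
    ev M c (x :: w) = ev M (lc M x.2.1 c) w := rfl

lemma ev_ofFn (c : Fam M) {n : ℕ} (a : Fin n → Σ i, F.gr i) :
    ev M c (List.ofFn a) = c n fun i => (a i).2.1 := by
  induction n generalizing c with
  | zero => exact congrArg (c 0) (Subsingleton.elim _ _)
  | succ n ih =>
    rw [List.ofFn_succ, ev_cons, ih, lc_apply]
    congr 1
    funext i
    refine Fin.cases ?_ (fun i => ?_) i <;> rfl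

lemma ev_eq (c : Fam M) (w : List (Σ i, F.gr i)) :
    ev M c w = c w.length fun i => (w.get i).2.1 := by
  conv_lhs => rw [← List.ofFn_get w]
  exact ev_ofFn M c _

lemma ev_congr {c c' : Fam M} {w : List (Σ i, F.gr i)} (h : c w.length = c' w.length) :
    ev M c w = ev M c' w := by rw [ev_eq, ev_eq, h]

lemma ext_of_ev {c c' : Fam M} (h : ∀ w, ev M c w = ev M c' w) : c = c' := by
  funext n
  refine multilinear_ext fun p a ha => ?_
  have := h (List.ofFn fun i => (⟨p i, a i, ha i⟩ : Σ i, F.gr i))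
  rwa [ev_ofFn, ev_ofFn] at this

lemma ev_add (c c' : Fam M) (w : List (Σ i, F.gr i)) :
    ev M (c + c') w = ev M c w + ev M c' w := by simp only [ev_eq]; rfl

lemma ev_sub (c c' : Fam M) (w : List (Σ i, F.gr i)) :
    ev M (c - c') w = ev M c w - ev M c' w := by simp only [ev_eq]; rfl

lemma ev_zsmul (r : ℤ) (c : Fam M) (w : List (Σ i, F.gr i)) :
    ev M (r • c) w = r • ev M c w := by simp only [ev_eq]; rfl

lemma lc_zsmul (r : ℤ) (x : F) (c : Fam M) : lc M (r • x) c = r • lc M x c := by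
  funext n; ext a
  change (c (n + 1)).curryLeft (r • x) a = r • (c (n + 1)).curryLeft x a
  rw [map_zsmul]
  rfl

lemma mm_zsmul (r : ℤ) (x : F) (c : Fam M) : mm M (r • x) c = r • mm M x c := by
  refine fam_ext M ?_ fun y => ?_
  · change (0 : Multi M 0) = r • (0 : Multi M 0)
    rw [smul_zero]
  · rw [lc_mm, smul_mul_assoc, lc_zsmul, map_zsmul, lc_mm]

/-- Both sides satisfy the same recursion in the first letter; the signs agree because the degree of
a letter in F[1] is one less than in F. -/
lemma ev_opP (c : Fam M) (w : List (Σ i, F.gr i)) :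
    ev M (opP M c) w = (letters F).bar (ev M c) w := by
  induction w generalizing c with
  | nil =>
    change opP M c 0 _ = 0
    rw [opP_zero]
    rfl
  | cons x w ih =>
    rw [ev_cons, lc_opP, F.eps_apply x.2.2, lc_zsmul, map_zsmul, mm_zsmul, ev_sub, ev_sub,
      ev_zsmul, ev_zsmul, ih, GradedLetters.bar_cons, letters_deg, sg_sub, sg_one, mul_neg_one]
    cases w with
    | nil =>
      have h : ev M (mm M x.2.1 c) [] = 0 := rfl
      rw [GradedLetters.head_nil, h, letters_deg, sg_sub, sg_one, mul_neg_one]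
      simp only [neg_smul, smul_neg, smul_add, sg_smul_self, smul_zero, sub_zero]
      rw [sub_eq_add_neg, neg_neg]
      rfl
    | cons z w =>
      have h : ev M (mm M x.2.1 c) (z :: w) = ev M c ((letters F).mul x z :: w) := by
        rw [ev_cons, lc_mm]
        rfl
      rw [GradedLetters.head_cons, h, letters_deg, sg_sub, sg_one, mul_neg_one]
      simp only [neg_smul, smul_neg, smul_add, sg_smul_self, neg_neg]
      have h' : ev M (lc M (F.d x.2.1) c) (z :: w) = ev M c ((letters F).d x :: z :: w) := rfl
      rw [h']
      have h'' : ∀ w, ev M (lc M x.2.1 c) w = ev M c (x :: w) := fun _ => rfl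
      simp only [← h'']
      abel

/-- The action of homogeneous elements in the Hochschild differential of cochains of degree
`m`. -/
def act (m : ℤ) (x : Σ i, F.gr i) : M →+ M := sg (m * x.1) • (M.lact x.2.1).toAddMonoidHom

lemma act_apply (m : ℤ) (x : Σ i, F.gr i) (a : M) : act M m x a = sg (m * x.1) • M.lact x.2.1 a :=
  rfl

lemma ev_opL (m : ℤ) (c : Fam M) (w : List (Σ i, F.gr i)) :
    ev M (opL M m c) w = GradedLetters.left (act M m) (ev M c) w := by
  cases w with
  | nil => rfl
  | cons x w =>
    rw [ev_cons, lc_opL, GradedLetters.left_cons, ev_eq, ev_eq, act_apply]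
    have h : F.sgn m x.2.1 = sg (m * x.1) • x.2.1 := signMap_apply F.gr m x.2.2
    rw [h]
    change M.lact (sg (m * x.1) • x.2.1) _ = _
    rw [map_zsmul]
    rfl

/-- The bimodules in which the right action is determined by the left action, with the Koszul
sign. -/
def DGBimodule.IsSymmetric (M : DGBimodule F) : Prop :=
  ∀ ⦃i j : ℤ⦄ ⦃a : F⦄ ⦃x : M⦄, a ∈ F.gr i → x ∈ M.gr j →
    M.ract x a = sg (i * j) • M.lact a x

variable {M}

/-- Symmetry turns the right action of the last argument into a left action. The resulting sign
involves the degree of the value of c, and is collected letter by letter: fixing the first argument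
x makes c a cochain of degree m + |x| - 1. -/
lemma ev_opR (hM : M.IsSymmetric) {m : ℤ} {c : Fam M} (hc : c ∈ cochains M m)
    (w : List (Σ i, F.gr i)) :
    ev M (opR M c) w = (letters F).right (act M m) (ev M c) w := by
  induction w generalizing m c with
  | nil => rfl
  | cons x w ih =>
    cases w with
    | nil =>
      have h0 : c 0 Fin.elim0 ∈ M.gr m := by
        have := hc 0 Fin.elim0 Fin.elim0 fun i => i.elim0
        simpa using this
      have h1 : ev M (opR M c) [x] = sg 1 • M.ract (c 0 Fin.elim0) x.2.1 := by
        rw [ev_eq]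
        change sg ((0 : ℕ) + 1) • M.ract (c 0 _) x.2.1 = _
        rw [Nat.cast_zero, zero_add]
        congr 4
        exact Subsingleton.elim _ _
      rw [h1, hM x.2.2 h0, GradedLetters.right_cons, GradedLetters.right_nil, zero_sub,
        GradedLetters.emp_nil, act_apply, sg_one, neg_smul, one_smul, mul_comm]
      rfl
    | cons z w =>
      have h1 : ev M (lc M x.2.1 (opR M c)) (z :: w) =
          ev M (sg (x.1 - 1) • opR M (lc M x.2.1 c)) (z :: w) := by
        refine ev_congr M ?_
        rw [List.length_cons]
        ext a
        change opR M c (w.length + 1 + 1) (Fin.cons x.2.1 a) =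
          sg (x.1 - 1) • opR M (lc M x.2.1 c) (w.length + 1) a
        rw [opR_apply, opR_apply, lc_apply]
        have h2 : (fun j : Fin (w.length + 1) =>
            F.eps ((Fin.cons x.2.1 a : Fin (w.length + 1 + 1) → F) j.castSucc)) =
            Fin.cons (F.eps x.2.1) fun j => F.eps (a j.castSucc) := by
          funext j
          refine Fin.cases ?_ (fun j => ?_) j <;> rfl
        have h3 : (Fin.cons x.2.1 a : Fin (w.length + 1 + 1) → F) (Fin.last (w.length + 1)) =
            a (Fin.last _) := rfl
        rw [h2, h3, F.eps_apply x.2.2]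
        change _ • M.ract (lc M (sg x.1 • x.2.1) c w.length _) _ = _
        rw [lc_zsmul]
        change _ • M.ract (sg x.1 • (lc M x.2.1 c w.length _)) _ = _
        rw [map_zsmul, LinearMap.smul_apply, lc_apply, smul_smul, smul_smul]
        congr 1
        push_cast
        rw [sg_sub, sg_succ, sg_one]
        ring
      -- The twist by x changes the action for degree m into the one for degree m + |x| - 1, up to a
      -- global sign. The exponents agree only modulo 2.
      have h2 : (letters F).tw ((letters F).deg x) (act M m) =
          fun y => sg (x.1 - 1) • act M (m + x.1 - 1) y := by
        funext y
        rw [GradedLetters.tw, act, act, smul_smul, smul_smul, ← sg_add, ← sg_add, letters_deg,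
          letters_deg]
        refine congrArg (· • _) (sg_eq_sg ?_)
        push_cast
        ring_nf
        reduce_mod_char
      rw [ev_cons, h1, ev_zsmul, ih (lc_mem x.2.2 hc), GradedLetters.right_cons (x := x), h2,
        GradedLetters.right_zsmul, GradedLetters.emp_cons, sub_zero]
      rfl

lemma ev_isSymm (hF : F.IsSupercommutative) (c : Fam M) : (letters F).IsSymm (ev M c) := by
  intro u x y v
  induction u generalizing c with
  | nil =>
    have h : ((letters F).mul y x).2.1 = sg (x.1 * y.1) • ((letters F).mul x y).2.1 := by
      rw [mul_comm x.1]
      exact hF y.2.2 x.2.2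
    rw [List.nil_append, ev_cons, h, lc_zsmul, ev_zsmul, letters_deg, letters_deg,
      sub_add_cancel, sub_add_cancel]
    rfl
  | cons z u ih => exact ih _

variable (M) in
/-- The second Adams operation on families of multilinear maps. -/
def adamsFam : Fam M →ₗ[K] Fam M where
  toFun c n := adams M n (Fin 2) (c n)
  map_add' _ _ := funext fun _ => map_add _ _ _
  map_smul' r c := funext fun n => (adams M n (Fin 2)).map_smul r (c n)

lemma ev_adamsFam (c : Fam M) (w : List (Σ i, F.gr i)) :
    ev M (adamsFam M c) w = (letters F).psi (ev M c) w := by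
  conv_lhs => rw [← List.ofFn_get w]
  conv_rhs => rw [← List.ofFn_get w]
  rw [ev_ofFn, ← GradedLetters.sum_term_eq_psi]
  change adams M w.length (Fin 2) (c w.length) _ = _
  rw [adams, LinearMap.sum_apply, sum_apply]
  refine Finset.sum_congr rfl fun g _ => ?_
  rw [permAct_apply M _ _ (p := fun i => (w.get i).1) (fun i => (w.get i).2.2),
    GradedLetters.term, ev_ofFn]
  simp [letters_deg]

lemma permAct_mem {m : ℤ} {c : Fam M} (hc : c ∈ cochains M m) {n : ℕ} (σ : Equiv.Perm (Fin n))
    {p : Fin n → ℤ} {a : Fin n → F} (ha : ∀ i, a i ∈ F.gr (p i)) :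
    permAct M σ (c n) a ∈ M.gr (∑ i, (p i - 1) + m) := by
  rw [permAct_apply M _ _ ha, ← Equiv.sum_comp σ.symm]
  exact zsmul_mem (hc n (fun j => p (σ.symm j)) _ fun j => ha _) _

lemma adamsFam_mem {m : ℤ} {c : Fam M} (hc : c ∈ cochains M m) :
    adamsFam M c ∈ cochains M m := by
  intro n p a ha
  change adams M n (Fin 2) (c n) a ∈ M.gr _
  rw [adams, LinearMap.sum_apply, sum_apply]
  exact sum_mem fun g _ => permAct_mem hc _ ha

lemma ev_delta (hM : M.IsSymmetric) {m : ℤ} {c : Fam M} (hc : c ∈ cochains M m)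
    (w : List (Σ i, F.gr i)) :
    ev M (delta M m c) w = sg m • M.d (ev M c w) + (letters F).total (act M m) (ev M c) w := by
  rw [delta_eq', ev_add, ev_add, ev_add, ev_opP, ev_opL, ev_opR hM hc, GradedLetters.total,
    add_assoc, add_assoc, add_assoc]
  congr 1
  rw [ev_eq, ev_eq]
  rfl

/-- The second Adams operation commutes with the Hochschild differential. -/
theorem delta_adamsFam (hF : F.IsSupercommutative) (hM : M.IsSymmetric) {m : ℤ} {c : Fam M}
    (hc : c ∈ cochains M m) : delta M m (adamsFam M c) = adamsFam M (delta M m c) := by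
  refine ext_of_ev M fun w => ?_
  have h1 : ev M (adamsFam M c) = (letters F).psi (ev M c) := funext (ev_adamsFam c)
  have h2 : ev M (delta M m c) = fun w => (sg m • M.d.toAddMonoidHom) (ev M c w) +
    (letters F).total (act M m) (ev M c) w := funext (ev_delta hM hc)
  -- The differential of the values commutes with ψ² by additivity; the remaining terms are covered
  -- by `GradedLetters.total_psi`.
  rw [ev_delta hM (adamsFam_mem hc), ev_adamsFam, ev_adamsFam, h1, h2, GradedLetters.psi_add,
    GradedLetters.psi_map, GradedLetters.total_psi _ _ (ev_isSymm hF c)]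
  rfl

end DGHochschild

end

/-! ### The Hodge decomposition and its behaviour under the chain maps -/

noncomputable section

namespace DGHochschild

variable {K : Type u} [Field K] {F : DGAlgebra.{u, v} K}

section HodgeDecomposition

variable (M : DGBimodule F)

lemma eulerian_apply {n : ℕ} (k : ℕ) (c : Multi M n) {p : Fin n → ℤ} {a : Fin n → F}
    (ha : ∀ i, a i ∈ F.gr (p i)) :
    eulerian M n k c a = ∑ σ : Equiv.Perm (Fin n), eulerianCoeff K n k (descents σ) •
      koszulSign σ p • c fun j => a (σ.symm j) := by
  rw [eulerian, LinearMap.sum_apply, sum_apply]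
  refine Finset.sum_congr rfl fun σ _ => ?_
  rw [← permAct_apply M σ c ha]
  rfl

lemma mem_hodge_iff {k : ℕ} {m : ℤ} {c : Fam M} :
    c ∈ hodge M k m ↔ c ∈ cochains M m ∧ ∀ n, eulerian M n k (c n) = c n := by
  refine and_congr Iff.rfl (forall_congr' fun n => ⟨fun h => multilinear_ext fun p a ha => ?_,
    fun h p a ha => ?_⟩)
  · rw [eulerian_apply M k _ ha, h p a ha]
  · rw [← eulerian_apply M k _ ha, h]

/-- The projection to the `k`-th Hodge component. -/
def hodgeProj (k : ℕ) : Fam M →ₗ[K] Fam M where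
  toFun c n := eulerian M n k (c n)
  map_add' _ _ := funext fun _ => map_add _ _ _
  map_smul' r c := funext fun n => (eulerian M n k).map_smul r (c n)

lemma hodgeProj_apply (k : ℕ) (c : Fam M) (n : ℕ) :
    hodgeProj M k c n = eulerian M n k (c n) := rfl

variable {M}

lemma hodgeProj_eq_self {k : ℕ} {m : ℤ} {c : Fam M} (hc : c ∈ hodge M k m) :
    hodgeProj M k c = c :=
  funext ((mem_hodge_iff M).1 hc).2

lemma apply_eq_zero_of_mem_hodge {k n : ℕ} {m : ℤ} {c : Fam M} (hc : c ∈ hodge M k m)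
    (h : n < k) : c n = 0 := by
  rw [← ((mem_hodge_iff M).1 hc).2 n, eulerian_eq_zero M h, LinearMap.zero_apply]

lemma hodgeProj_mem_cochains {m : ℤ} {c : Fam M} (hc : c ∈ cochains M m) (k : ℕ) :
    hodgeProj M k c ∈ cochains M m := by
  intro n p a ha
  rw [hodgeProj_apply, eulerian, LinearMap.sum_apply, sum_apply]
  exact sum_mem fun σ _ => Submodule.smul_mem _ _ (permAct_mem hc σ ha)

variable [CharZero K]

lemma hodgeProj_mem {m : ℤ} {c : Fam M} (hc : c ∈ cochains M m) (k : ℕ) :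
    hodgeProj M k c ∈ hodge M k m :=
  (mem_hodge_iff M).2 ⟨hodgeProj_mem_cochains hc k, fun n => by
    rw [hodgeProj_apply, ← Module.End.mul_apply, eulerian_mul, if_pos rfl]⟩

lemma sum_hodgeProj (c : Fam M) (n : ℕ) :
    ∑ k ∈ Finset.range (n + 1), hodgeProj M k c n = c n := by
  simp only [hodgeProj_apply, ← LinearMap.sum_apply]
  rw [sum_eulerian, Module.End.one_apply]

/-- Uniqueness of the decomposition: by orthogonality e_n(k) extracts the k-th summand. For k > n
both sides vanish in the component n. -/
lemma eq_hodgeProj {m : ℤ} {c : Fam M} {f : ℕ → Fam M} (hf : ∀ k, f k ∈ hodge M k m)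
    (h : ∀ n, ∑ k ∈ Finset.range (n + 1), f k n = c n) (k : ℕ) : f k = hodgeProj M k c := by
  funext n
  rcases lt_or_ge n k with hk | hk
  · rw [apply_eq_zero_of_mem_hodge (hf k) hk, hodgeProj_apply, eulerian_eq_zero M hk,
      LinearMap.zero_apply]
  · rw [hodgeProj_apply, ← h n, map_sum, Finset.sum_eq_single k]
    · exact (((mem_hodge_iff M).1 (hf k)).2 n).symm
    · intro j _ hj
      rw [← ((mem_hodge_iff M).1 (hf j)).2 n, ← Module.End.mul_apply, eulerian_mul,
        if_neg hj.symm, LinearMap.zero_apply]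
    · intro hk'
      exact absurd (Finset.mem_range_succ_iff.2 hk) hk'

lemma adamsFam_of_mem_hodge {k : ℕ} {m : ℤ} {c : Fam M} (hc : c ∈ hodge M k m) :
    adamsFam M c = (2 : K) ^ k • c := by
  funext n
  rcases lt_or_ge n k with hk | hk
  · change adams M n (Fin 2) (c n) = (2 : K) ^ k • c n
    rw [apply_eq_zero_of_mem_hodge hc hk, map_zero, smul_zero]
  · exact (eulerian_apply_eq_self_iff M hk (c n)).1 (((mem_hodge_iff M).1 hc).2 n)

/-- For n ≥ k the Hodge condition says that ψ² acts by 2^k. Since this eigenvalue is the same for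
all n, it is preserved by a differential that commutes with ψ² and mixes n with n + 1. For n < k
nothing is left, because the differential does not lower the number of arguments. -/
lemma delta_mem_hodge (hF : F.IsSupercommutative) (hM : M.IsSymmetric) {k : ℕ} {m : ℤ}
    {c : Fam M} (hc : c ∈ hodge M k m) : delta M m c ∈ hodge M k (m + 1) := by
  refine (mem_hodge_iff M).2 ⟨delta_mem hc.1, fun n => ?_⟩
  rcases lt_or_ge n k with hk | hk
  · rw [delta_apply_eq_zero M m fun i hi => apply_eq_zero_of_mem_hodge hc (hi.trans_lt hk),
      map_zero]
  · rw [eulerian_apply_eq_self_iff M hk]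
    have h := delta_adamsFam hF hM hc.1
    rw [adamsFam_of_mem_hodge hc, map_smul] at h
    exact (congrFun h n).symm

/-- The Hodge decomposition of the Hochschild complex of a supercommutative algebra with
coefficients in a symmetric bimodule. -/
theorem hasHodgeDecomposition (hF : F.IsSupercommutative) (hM : M.IsSymmetric) :
    HasHodgeDecomposition M :=
  ⟨fun _ _ _ hc => delta_mem_hodge hF hM hc, fun _ c hc =>
    ⟨fun k => hodgeProj M k c, ⟨hodgeProj_mem hc, sum_hodgeProj c⟩,
      fun _ hf => funext (eq_hodgeProj hf.1 hf.2)⟩⟩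

/-- The coboundaries of the components of c lie in the Hodge components and add up to the coboundary
of c, so uniqueness identifies them. -/
lemma delta_hodgeProj (h : HasHodgeDecomposition M) {m : ℤ} {c : Fam M} (hc : c ∈ cochains M m)
    (k : ℕ) : delta M m (hodgeProj M k c) = hodgeProj M k (delta M m c) := by
  refine eq_hodgeProj (f := fun k => delta M m (hodgeProj M k c))
    (fun k => h.1 k m _ (hodgeProj_mem hc k)) (fun n => ?_) k
  rw [← sub_eq_zero, ← Finset.sum_apply, ← Pi.sub_apply, ← map_sum, ← map_sub]
  -- The component n of a coboundary depends only on the components i ≤ n, where the first n + 1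
  -- projections already add up to c.
  refine delta_apply_eq_zero M m fun i hi => ?_
  rw [Pi.sub_apply, Finset.sum_apply, sub_eq_zero, ← sum_hodgeProj c i]
  refine (Finset.sum_subset (Finset.range_subset_range.2 (by omega)) fun j _ hj => ?_).symm
  rw [hodgeProj_apply, eulerian_eq_zero M (by simpa using hj), LinearMap.zero_apply]

/-- The cone of a chain map that is compatible with the projections is exact on the Hodge
components if it is exact. -/
lemma cone_exact_hodge {G : DGAlgebra.{u, v} K} {N : DGBimodule G} (hM : HasHodgeDecomposition M)
    (hN : HasHodgeDecomposition N) (g : Fam M →ₗ[K] Fam N)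
    (hg : ∀ k c, g (hodgeProj M k c) = hodgeProj N k (g c)) {m : ℤ}
    (H : ∀ c ∈ cochains M (m + 1 + 1), ∀ e ∈ cochains N (m + 1), delta M (m + 1 + 1) c = 0 →
      g c = delta N (m + 1) e → ∃ c' ∈ cochains M (m + 1), ∃ e' ∈ cochains N m,
        delta M (m + 1) c' = c ∧ g c' - e = delta N m e') (k : ℕ) :
    ∀ c ∈ hodge M k (m + 1 + 1), ∀ e ∈ hodge N k (m + 1), delta M (m + 1 + 1) c = 0 →
      g c = delta N (m + 1) e → ∃ c' ∈ hodge M k (m + 1), ∃ e' ∈ hodge N k m,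
        delta M (m + 1) c' = c ∧ g c' - e = delta N m e' := by
  intro c hc e he h1 h2
  obtain ⟨c', hc', e', he', h3, h4⟩ := H c hc.1 e he.1 h1 h2
  refine ⟨hodgeProj M k c', hodgeProj_mem hc' k, hodgeProj N k e', hodgeProj_mem he' k, ?_, ?_⟩
  · rw [delta_hodgeProj hM hc', h3, hodgeProj_eq_self hc]
  · rw [delta_hodgeProj hN he', ← h4, map_sub, hg, hodgeProj_eq_self he]

end HodgeDecomposition

/-! ### The chain maps on Hodge components -/

section Functoriality

variable {G : DGAlgebra.{u, v} K}

lemma coeffFam_hodgeProj {M N : DGBimodule F} (f : M.Hom N) (k : ℕ) (c : Fam M) :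
    coeffFam f (hodgeProj M k c) = hodgeProj N k (coeffFam f c) := by
  funext n
  refine multilinear_ext fun p a ha => ?_
  rw [coeffFam_apply, hodgeProj_apply, hodgeProj_apply, eulerian_apply M k _ ha,
    eulerian_apply N k _ ha, map_sum]
  simp only [map_smul, map_zsmul, coeffFam_apply]

lemma restrictFam_hodgeProj (φ : F.Hom G) (N : DGBimodule G) (k : ℕ) (c : Fam N) :
    restrictFam φ N (hodgeProj N k c) =
      hodgeProj (DGBimodule.restrict φ N) k (restrictFam φ N c) := by
  funext n
  refine multilinear_ext fun p a ha => ?_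
  rw [restrictFam_apply, hodgeProj_apply, hodgeProj_apply,
    eulerian_apply N k _ (fun i => φ.map_mem (ha i)), eulerian_apply _ k _ ha]
  rfl

lemma isSymmetric_regular (hF : F.IsSupercommutative) : (DGBimodule.regular F).IsSymmetric := by
  intro i j a x ha hx
  rw [mul_comm i]
  exact hF hx ha

lemma DGBimodule.IsSymmetric.restrict {N : DGBimodule G} (hN : N.IsSymmetric) (φ : F.Hom G) :
    (DGBimodule.restrict φ N).IsSymmetric :=
  fun _ _ _ _ ha hx => hN (φ.map_mem ha) hx

open DGBimodule

variable [CharZero K] {φ : F.Hom G}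

theorem quasiIso_hodgeCoeffMap_homOfAlgHom (hφ : φ.IsQuasiIso)
    (h₁ : HasHodgeDecomposition (regular F))
    (h₂ : HasHodgeDecomposition (DGBimodule.restrict φ (regular G))) (k : ℕ) :
    QuasiIso (hodgeCoeffMap (homOfAlgHom φ) h₁ h₂ k) := by
  obtain ⟨I⟩ := hφ.nonempty_homotopyInverse
  exact (quasiIso_ofHom_restrict_iff (hodge (regular F) k)
    (hodge (DGBimodule.restrict φ (regular G)) k)
    (delta (regular F)) (delta (DGBimodule.restrict φ (regular G))) (coeffFam (homOfAlgHom φ))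
    (fun _ _ h => h₁.1 k _ _ h) (fun _ _ h => h₂.1 k _ _ h) (fun _ _ h => coeffFam_hodge _ h)
    (fun _ => ModuleCat.hom_ext (LinearMap.ext fun c => Subtype.ext (delta_delta c.2.1)))
    (fun _ => ModuleCat.hom_ext (LinearMap.ext fun c => Subtype.ext (delta_delta c.2.1)))
    (hodgeCoeffMap (homOfAlgHom φ) h₁ h₂ k) (fun _ => rfl)).2 fun m =>
      cone_exact_hodge h₁ h₂ _ (coeffFam_hodgeProj _) (cone_exact_coeffFam I m) k

theorem quasiIso_hodgeRestrictMap (hφ : φ.IsQuasiIso) {N : DGBimodule G}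
    (h₁ : HasHodgeDecomposition N) (h₂ : HasHodgeDecomposition (DGBimodule.restrict φ N)) (k : ℕ) :
    QuasiIso (hodgeRestrictMap φ N h₁ h₂ k) := by
  obtain ⟨I⟩ := hφ.nonempty_homotopyInverse
  exact (quasiIso_ofHom_restrict_iff (hodge N k) (hodge (DGBimodule.restrict φ N) k)
    (delta N) (delta (DGBimodule.restrict φ N)) (restrictFam φ N)
    (fun _ _ h => h₁.1 k _ _ h) (fun _ _ h => h₂.1 k _ _ h) (fun _ _ h => restrictFam_hodge _ _ h)
    (fun _ => ModuleCat.hom_ext (LinearMap.ext fun c => Subtype.ext (delta_delta c.2.1)))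
    (fun _ => ModuleCat.hom_ext (LinearMap.ext fun c => Subtype.ext (delta_delta c.2.1)))
    (hodgeRestrictMap φ N h₁ h₂ k) (fun _ => rfl)).2 fun m =>
      cone_exact_hodge h₁ h₂ _ (restrictFam_hodgeProj φ N) (cone_exact_restrictFam I N m) k

end Functoriality

end DGHochschild

end

theorem mainTheorem10 {K : Type u} [Field K] {Ft F : DGHochschild.DGAlgebra.{u, v} K}
    (φ : Ft.Hom F) (hφ : φ.IsQuasiIso) :
    (QuasiIso (DGHochschild.coeffMap (DGHochschild.DGBimodule.homOfAlgHom φ)) ∧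
      QuasiIso (DGHochschild.restrictMap φ (DGHochschild.DGBimodule.regular F))) ∧
    (CharZero K → Ft.IsSupercommutative → F.IsSupercommutative →
      ∃ (h₁ : DGHochschild.HasHodgeDecomposition (DGHochschild.DGBimodule.regular Ft))
        (h₂ : DGHochschild.HasHodgeDecomposition
          (DGHochschild.DGBimodule.restrict φ (DGHochschild.DGBimodule.regular F)))
        (h₃ : DGHochschild.HasHodgeDecomposition (DGHochschild.DGBimodule.regular F)),
        ∀ k : ℕ,
          QuasiIso (DGHochschild.hodgeCoeffMap (DGHochschild.DGBimodule.homOfAlgHom φ) h₁ h₂ k) ∧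
          QuasiIso (DGHochschild.hodgeRestrictMap φ
            (DGHochschild.DGBimodule.regular F) h₃ h₂ k)) := by
  refine ⟨⟨DGHochschild.quasiIso_coeffMap_homOfAlgHom hφ,
    DGHochschild.quasiIso_restrictMap hφ _⟩, fun _ hFt hF => ?_⟩
  have hs := DGHochschild.isSymmetric_regular hF
  have h₂ := DGHochschild.hasHodgeDecomposition hFt (hs.restrict φ)
  exact ⟨DGHochschild.hasHodgeDecomposition hFt (DGHochschild.isSymmetric_regular hFt), h₂,
    DGHochschild.hasHodgeDecomposition hF hs, fun k =>
      ⟨DGHochschild.quasiIso_hodgeCoeffMap_homOfAlgHom hφ _ _ k,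
        DGHochschild.quasiIso_hodgeRestrictMap hφ _ _ k⟩⟩
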